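/- Let $N\geqslant 2$, let $h$ be a formal parameter, let $P$ be the flip of $\mathbb{C}^N\otimes\mathbb{C}^N$, and let $R(u)=1-hPu^{-1}$ and $\overline{R}(u)=g(u/h)R(u)$, where $g(u)\in 1+u^{-1}\mathbb{C}[[u^{-1}]]$ is the unique series with $g(u+N)=g(u)(1-u^{-2})$. The double Yangian $\mathrm{DY}(\mathfrak{gl}_N)$ is the associative $\mathbb{C}[[h]]$-algebra generated by a central element $C$ and elements $t_{ij}^{(\pm r)}$, $1\leqslant i,j\leqslant N$, $r\geqslant 1$, subject to $$R(u-v)T_1(u)T_2(v)=T_2(v)T_1(u)R(u-v),\qquad R(u-v)T^+_1(u)T^+_2(v)=T^+_2(v)T^+_1(u)R(u-v),$$ $$\overline{R}(u-v+hC/2)\,T_1(u)T^+_2(v)=T^+_2(v)T_1(u)\,\overline{R}(u-v-hC/2),$$ where $T(u)$ and $T^+(u)$ are the matrices with entries $t_{ij}(u)=\delta_{ij}+h\sum_{r\geqslant1}t_{ij}^{(r)}u^{-r}$ and $t^+_{ij}(u)=\delta_{ij}-h\sum_{r\geqslant1}t_{ij}^{(-r)}u^{r-1}$, negative powers are expanded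 in negative powers of the leftmost variable, and powers of $h$ dividing a coefficient of a relation are cancelled. For $c\in\mathbb{C}$ let $\mathrm{DY}_c(\mathfrak{gl}_N)$ be the quotient by the ideal generated by $C-c$, let $\widehat{\mathrm{DY}}_c(\mathfrak{gl}_N)$ be its $h$-adic completion, and let $\mathcal{V}_c(\mathfrak{gl}_N)$ be the $h$-adic completion of the quotient of $\mathrm{DY}_c(\mathfrak{gl}_N)$ by the left ideal generated by all $t_{ij}^{(r)}$, $r\geqslant 1$, with $\mathbf{1}$ the image of the unit. Let $0\leqslant M\leqslant N$, let $G=(g_{ij})=\mathrm{diag}(1,\ldots,1,-1,\ldots,-1)$ with $M$ entries equal to $1$, and put $B^+(u)=T^+(u)\,G\,T^+(-u)^{-1}$ and $B(u)=T(u+hc)\,G\,T(-u)^{-1}$. Define $b_{ij}^{(-r)}\in\widehat{\mathrm{DY}}_c(\mathfrak{gl}_N)$ by $b^+_{ij}(u)=g_{ij}-h\sum_{r\geqslant 1}b_{ij}^{(-r)}u^{r-1}$, and let $\mathrm{B}^+(\mathfrak{gl}_N)$ be the algebra of all $x\in\widehat{\mathrm{DY}}_c(\mathfrak{gl}_N)$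 such that, for some $k\geqslant 0$, $h^kx$ lies in the subalgebra generated by the $b_{ij}^{(-r)}$. Let $\mathcal{W}_c(\mathfrak{gl}_N)\subseteq\mathcal{V}_c(\mathfrak{gl}_N)$ be the $h$-adic completion (the closure in $\mathcal{V}_c(\mathfrak{gl}_N)$) of $\mathrm{B}^+(\mathfrak{gl}_N)\mathbf{1}$. Its submodule of invariants is $$\mathfrak{z}(\mathcal{W}_c(\mathfrak{gl}_N))=\{w\in\mathcal{W}_c(\mathfrak{gl}_N): B(u)w=Gw\}.$$ Let $n\geqslant1$, and let $H^{(n)}$ and $A^{(n)}$ be the images on $(\mathbb{C}^N)^{\otimes n}$ of the symmetrizer $\frac{1}{n!}\sum_{s\in\mathfrak{S}_n}s$ and of the anti-symmetrizer $\frac{1}{n!}\sum_{s\in\mathfrak{S}_n}\mathrm{sgn}(s)\,s$. For $w=(w_1,\ldots,w_n)$ put $T^+_n(w|0)=T^+_1(w_1)\cdots T^+_n(w_n)$ and $\overleftarrow{T}{}^+_n(w|0)=T^+_n(w_n)\cdots T^+_1(w_1)$, where $T^+_k$ acts in the $k$-th tensor factor, and let $u_\pm=(u,u\pm h,\ldots,u\pm(n-1)h)$.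 **Statement.** Suppose that $G=I$ or $G=-I$, and let $c=-N/2$. Then all coefficients of the Taylor series in $u$ $$\mathrm{tr}_{1,\ldots,n}\,H^{(n)}\,T^+_n(u_+|0)\,\overleftarrow{T}{}^+_n(-u_+|0)^{-1}\,\mathbf{1}\qquad\text{and}\qquad \mathrm{tr}_{1,\ldots,n}\,A^{(n)}\,T^+_n(u_-|0)\,\overleftarrow{T}{}^+_n(-u_-|0)^{-1}\,\mathbf{1}$$ belong to the submodule of invariants $\mathfrak{z}(\mathcal{W}_{-N/2}(\mathfrak{gl}_N))$. -/

import Mathlib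

noncomputable section

namespace RTT

/-! ### The ground ring `ℂ[[h]]` and `h`-adic completions -/

/-- The ground ring `ℂ[[h]]`. -/
abbrev Ch : Type := PowerSeries ℂ

/-- The formal parameter `h`. -/
def hh : Ch := PowerSeries.X

/-- The formal parameter `h` as an element of a `ℂ[[h]]`-algebra. -/
def hIn (A : Type) [Ring A] [Algebra Ch A] : A := algebraMap Ch A hh

/-- The embedding of the complex numbers into a `ℂ[[h]]`-algebra. -/
def cst (A : Type) [Ring A] [Algebra Ch A] : ℂ →+* A :=
  (algebraMap Ch A).comp PowerSeries.C

section Completion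

variable (A : Type) [Ring A] [Algebra Ch A]

/-- The two-sided ideal `hⁿ A`. -/
def hIdeal (n : ℕ) : Ideal A := Ideal.span {algebraMap Ch A (hh ^ n)}

theorem mem_hIdeal {n : ℕ} {x : A} :
    x ∈ hIdeal A n ↔ ∃ a : A, algebraMap Ch A (hh ^ n) * a = x := by
  rw [hIdeal, Ideal.mem_span_singleton']
  simp only [(Algebra.commutes (hh ^ n) _ : algebraMap Ch A (hh ^ n) * _ = _)]

instance hIdeal_isTwoSided (n : ℕ) : (hIdeal A n).IsTwoSided := by
  refine ⟨fun {a} b ha => ?_⟩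
  rw [mem_hIdeal] at ha ⊢
  obtain ⟨x, rfl⟩ := ha
  exact ⟨x * b, by rw [mul_assoc]⟩

theorem hIdeal_succ_le (n : ℕ) : hIdeal A (n + 1) ≤ hIdeal A n := by
  intro x hx
  rw [mem_hIdeal] at hx ⊢
  obtain ⟨a, rfl⟩ := hx
  exact ⟨algebraMap Ch A hh * a, by rw [← mul_assoc, ← map_mul, pow_succ]⟩

/-- The `h`-adic completion `lim A / hⁿ A` of a `ℂ[[h]]`-algebra `A`, realized as the algebra of
compatible families in `∏ A / hⁿ A`. -/
def Completion : Subalgebra Ch (∀ n : ℕ, A ⧸ hIdeal A n) where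
  carrier := {f | ∀ n, Ideal.Quotient.factor (hIdeal_succ_le A n) (f (n + 1)) = f n}
  mul_mem' := by
    intro a b ha hb n
    simp only [Pi.mul_apply, map_mul, ha n, hb n]
  add_mem' := by
    intro a b ha hb n
    simp only [Pi.add_apply, map_add, ha n, hb n]
  algebraMap_mem' := by
    intro r n
    rfl

/-- The canonical homomorphism from `A` to its `h`-adic completion. -/
def toCompletion : A →+* Completion A where
  toFun a := ⟨fun _ => Ideal.Quotient.mk _ a, fun _ => rfl⟩
  map_one' := rfl
  map_mul' _ _ := rfl
  map_zero' := rfl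
  map_add' _ _ := rfl

variable {A} in
/-- The sum `∑ₛ hˢ xₛ` of an `h`-adically convergent series, with all `xₛ` in `A`; modulo `hⁿ` it
is the finite sum over `s < n`. -/
def hSum (x : ℕ → A) : Completion A :=
  ⟨fun n => Ideal.Quotient.mk _ (∑ s ∈ Finset.range n, algebraMap Ch A (hh ^ s) * x s), by
    intro n
    rw [Ideal.Quotient.factor_mk, Ideal.Quotient.eq, Finset.sum_range_succ, add_sub_cancel_left]
    exact (mem_hIdeal A).2 ⟨_, rfl⟩⟩

variable (M : Type) [AddCommGroup M] [Module A M]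

theorem hIdeal_smul_top_le (n : ℕ) :
    hIdeal A (n + 1) • (⊤ : Submodule A M) ≤ hIdeal A n • (⊤ : Submodule A M) :=
  Submodule.smul_mono_left (hIdeal_succ_le A n)

/-- The `h`-adic completion `lim M / hⁿ M` of an `A`-module `M`, realized as the module of
compatible families in `∏ M / hⁿ M`.  It is a module over the `h`-adic completion of `A`. -/
def ModCompletion : Submodule (Completion A) (∀ n : ℕ, M ⧸ hIdeal A n • (⊤ : Submodule A M)) where
  carrier := {f | ∀ n, Submodule.factor (hIdeal_smul_top_le A M n) (f (n + 1)) = f n}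
  add_mem' := by
    intro a b ha hb n
    simp only [Pi.add_apply, map_add, ha n, hb n]
  zero_mem' := by
    intro n
    simp only [Pi.zero_apply, map_zero]
  smul_mem' := by
    rintro ⟨c, hc⟩ f hf n
    have hc' := hc n
    have hf' := hf n
    change Submodule.factor _ (c (n + 1) • f (n + 1)) = c n • f n
    rw [← hc', ← hf']
    obtain ⟨a, ha⟩ := Ideal.Quotient.mk_surjective (c (n + 1))
    obtain ⟨m, hm⟩ := Submodule.Quotient.mk_surjective _ (f (n + 1))
    rw [← ha, ← hm]
    rfl

end Completion

/-! ### Formal series -/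

section Series

variable {S : Type} [Ring S]

/-- The series `(u - y)⁻¹`, expanded in nonnegative powers of `y`, as a series in `X = u⁻¹`. -/
def invSub (y : S) : PowerSeries S := PowerSeries.mk fun k => if k = 0 then 0 else y ^ (k - 1)

/-- The series `∑ₖ aₖ sᵏ`, where `s` is a series without constant term. -/
def compSeries (a : ℕ → S) (s : PowerSeries S) : PowerSeries S :=
  PowerSeries.mk fun p => ∑ k ∈ Finset.range (p + 1), PowerSeries.coeff p (s ^ k) * a k

/-- In the variable `X = u⁻¹`, `(u - y) (u - y)⁻¹ = 1` reads `(1 - y X) (u - y)⁻¹ = X`. -/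
theorem one_sub_mul_invSub (y : S) :
    (1 - PowerSeries.C y * PowerSeries.X) * invSub y = PowerSeries.X := by
  ext n
  rw [sub_mul, one_mul, mul_assoc, map_sub, PowerSeries.coeff_C_mul]
  rcases n with _ | _ | n
  · simp [invSub]
  · simp [invSub, PowerSeries.coeff_succ_X_mul]
  · simp [invSub, PowerSeries.coeff_succ_X_mul, PowerSeries.coeff_X, pow_succ']

end Series

/-- The coefficients of the series `g`, see `isG_gSeries`. -/
def gCoeff (N : ℕ) : ℕ → ℂ
  | 0 => 1
  | m + 1 =>
    (gCoeff N m + ∑ k : Fin (m + 1),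
      PowerSeries.coeff (m + 2) (invSub (-(N : ℂ)) ^ (k : ℕ)) * gCoeff N k) / ((m + 1) * N)

/-- The series `g(u) ∈ 1 + u⁻¹ ℂ[[u⁻¹]]`, as a series in `X = u⁻¹`. -/
def gSeries (N : ℕ) : PowerSeries ℂ := PowerSeries.mk (gCoeff N)

/-- `g(u) ∈ 1 + u⁻¹ ℂ[[u⁻¹]]` and `g(u + N) = g(u) (1 - u⁻²)`. -/
def IsG (N : ℕ) (g : PowerSeries ℂ) : Prop :=
  PowerSeries.constantCoeff g = 1 ∧
    compSeries (fun k => PowerSeries.coeff k g) (invSub (-(N : ℂ))) = g * (1 - PowerSeries.X ^ 2)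

theorem coeff_invSub_pow (y : ℂ) (k j : ℕ) :
    PowerSeries.coeff (k + j) (invSub y ^ k) =
      PowerSeries.coeff j ((PowerSeries.mk fun i => y ^ i) ^ k) := by
  have h : invSub y = PowerSeries.X * PowerSeries.mk fun i => y ^ i := by
    ext n
    rcases n with _ | n
    · simp [invSub]
    · simp [invSub, PowerSeries.coeff_succ_X_mul]
  rw [h, mul_pow, add_comm, PowerSeries.coeff_X_pow_mul]

theorem coeff_self_invSub_pow (y : ℂ) (k : ℕ) : PowerSeries.coeff k (invSub y ^ k) = 1 := by
  have := coeff_invSub_pow y k 0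
  rw [add_zero] at this
  simp [this]

theorem coeff_succ_invSub_pow (y : ℂ) (k : ℕ) :
    PowerSeries.coeff (k + 1) (invSub y ^ k) = k * y := by
  rw [coeff_invSub_pow]
  induction k with
  | zero => simp
  | succ k ih =>
    rw [pow_succ, PowerSeries.coeff_mul, Finset.Nat.antidiagonal_succ]
    simp [ih]
    ring

/-- The functional equation for `g`, written as a recurrence for its coefficients. -/
theorem isG_iff (N : ℕ) (g : PowerSeries ℂ) :
    IsG N g ↔ PowerSeries.coeff 0 g = 1 ∧ ∀ m : ℕ, ((m + 1) * N : ℂ) * PowerSeries.coeff (m + 1) g =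
      PowerSeries.coeff m g + ∑ k ∈ Finset.range (m + 1),
        PowerSeries.coeff (m + 2) (invSub (-(N : ℂ)) ^ k) * PowerSeries.coeff k g := by
  rw [IsG, PowerSeries.coeff_zero_eq_constantCoeff_apply]
  refine and_congr_right fun h0 => ?_
  have key : ∀ m : ℕ, (PowerSeries.coeff (m + 2)
      (compSeries (fun k => PowerSeries.coeff k g) (invSub (-(N : ℂ)))) =
      PowerSeries.coeff (m + 2) (g * (1 - PowerSeries.X ^ 2))) ↔
      ((m + 1) * N : ℂ) * PowerSeries.coeff (m + 1) g =
      PowerSeries.coeff m g + ∑ k ∈ Finset.range (m + 1),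
        PowerSeries.coeff (m + 2) (invSub (-(N : ℂ)) ^ k) * PowerSeries.coeff k g := by
    intro m
    rw [compSeries, PowerSeries.coeff_mk, Finset.sum_range_succ, Finset.sum_range_succ,
      coeff_self_invSub_pow, show m + 2 = (m + 1) + 1 from rfl, coeff_succ_invSub_pow,
      mul_sub, mul_one, map_sub, show m + 1 + 1 = m + 2 from rfl, PowerSeries.coeff_mul_X_pow]
    push_cast
    constructor <;> intro h <;> linear_combination -h
  constructor
  · intro h m
    exact (key m).1 (by rw [h])
  · intro h
    ext n
    rcases n with _ | _ | m
    · simp [compSeries]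
    · have h1 : PowerSeries.coeff 1 (g * (1 - PowerSeries.X ^ 2)) = PowerSeries.coeff 1 g := by
        rw [mul_sub, mul_one, map_sub, PowerSeries.coeff_mul_X_pow']
        simp
      rw [zero_add, h1]
      have h2 := coeff_self_invSub_pow (-(N : ℂ)) 1
      simp only [compSeries, PowerSeries.coeff_mk, Finset.sum_range_succ, Finset.sum_range_zero,
        h2, pow_zero, PowerSeries.coeff_one]
      simp
    · exact (key m).2 (h m)

/-- `g` is the unique series in `1 + u⁻¹ ℂ[[u⁻¹]]` with `g(u + N) = g(u) (1 - u⁻²)`. -/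
theorem isG_gSeries {N : ℕ} (hN : N ≠ 0) : IsG N (gSeries N) := by
  have hN' : (N : ℂ) ≠ 0 := by exact_mod_cast hN
  rw [isG_iff]
  refine ⟨by simp [gSeries, gCoeff], fun m => ?_⟩
  have hm : ((m : ℂ) + 1) ≠ 0 := by exact_mod_cast m.succ_ne_zero
  simp only [gSeries, PowerSeries.coeff_mk]
  rw [gCoeff, Finset.sum_range, mul_div_cancel₀ _ (mul_ne_zero hm hN')]

theorem isG_unique {N : ℕ} (hN : N ≠ 0) {g : PowerSeries ℂ} (hg : IsG N g) : g = gSeries N := by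
  have hN' : (N : ℂ) ≠ 0 := by exact_mod_cast hN
  have h1 := (isG_iff N g).1 hg
  have h2 := (isG_iff N _).1 (isG_gSeries hN)
  ext n
  induction n using Nat.strong_induction_on with
  | _ n ih =>
    rcases n with _ | m
    · rw [h1.1, h2.1]
    · have hm : ((m : ℂ) + 1) ≠ 0 := by exact_mod_cast m.succ_ne_zero
      apply mul_left_cancel₀ (mul_ne_zero hm hN')
      rw [h1.2, h2.2, ih m (by omega)]
      congr 1
      refine Finset.sum_congr rfl fun k hk => ?_
      rw [ih k (by simpa using hk)]
/-! ### Invertibility of the matrices `T(-u)` and `T⁺(±u + α h)` -/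

section Units

open PowerSeries

/-- The geometric series in an abstract adically complete situation. -/
theorem isUnit_one_sub_of_adic {E : Type} [Ring E] (J : ℕ → AddSubgroup E)
    (hl : ∀ n a b, b ∈ J n → a * b ∈ J n) (hr : ∀ n a b, a ∈ J n → a * b ∈ J n)
    (hinf : ∀ e, (∀ n, e ∈ J n) → e = 0) (x z : E) (hx : ∀ n, x ^ n ∈ J n)
    (hz : ∀ n, z - ∑ k ∈ Finset.range n, x ^ k ∈ J n) : IsUnit (1 - x) := by
  have h1 : (1 - x) * z = 1 := by
    rw [← sub_eq_zero]
    refine hinf _ fun n => ?_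
    have : (1 - x) * z - 1 = (1 - x) * (z - ∑ k ∈ Finset.range n, x ^ k) - x ^ n := by
      rw [mul_sub, mul_neg_geom_sum]
      abel
    rw [this]
    exact sub_mem (hl _ _ _ (hz n)) (hx n)
  have h2 : z * (1 - x) = 1 := by
    rw [← sub_eq_zero]
    refine hinf _ fun n => ?_
    have : z * (1 - x) - 1 = (z - ∑ k ∈ Finset.range n, x ^ k) * (1 - x) - x ^ n := by
      rw [sub_mul, geom_sum_mul_neg]
      abel
    rw [this]
    exact sub_mem (hr _ _ _ (hz n)) (hx n)
  exact ⟨⟨1 - x, z, h1, h2⟩, rfl⟩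

variable {m : Type} [Fintype m] [DecidableEq m]

/-- A matrix of power series with identity constant term is invertible. -/
theorem isUnit_of_constantCoeff {S : Type} [Ring S] (U : Matrix m m (PowerSeries S))
    (hU : ∀ i j, coeff 0 (U i j) = (1 : Matrix m m S) i j) : IsUnit U := by
  obtain ⟨x, hx⟩ : ∃ x, x = 1 - U := ⟨_, rfl⟩
  have h0 : ∀ i j, coeff 0 (x i j) = 0 := by
    intro i j
    rw [hx, Matrix.sub_apply, map_sub, hU, Matrix.one_apply, Matrix.one_apply]
    split <;> simp
  have hpow : ∀ k a, a < k → ∀ i j, coeff a ((x ^ k) i j) = 0 := by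
    intro k
    induction k with
    | zero => intro a ha; omega
    | succ k ih =>
      intro a ha i j
      rw [pow_succ, Matrix.mul_apply, map_sum]
      refine Finset.sum_eq_zero fun l _ => ?_
      rw [coeff_mul]
      refine Finset.sum_eq_zero fun p hp => ?_
      rw [Finset.HasAntidiagonal.mem_antidiagonal] at hp
      rcases Nat.eq_zero_or_pos p.2 with h2 | h2
      · rw [h2, h0, mul_zero]
      · rw [ih p.1 (by omega), zero_mul]
  have hU' : U = 1 - x := by rw [hx, sub_sub_cancel]
  rw [hU']
  refine isUnit_one_sub_of_adic (E := Matrix m m (PowerSeries S))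
    (fun n => { carrier := {M : Matrix m m (PowerSeries S) | ∀ a, a < n → ∀ i j, coeff a (M i j) = 0}
                add_mem' := fun {M M'} h h' a ha i j => by
                  rw [Matrix.add_apply, map_add, h a ha, h' a ha, add_zero]
                zero_mem' := fun a ha i j => by rw [Matrix.zero_apply, map_zero]
                neg_mem' := fun {M} h a ha i j => by
                  rw [Matrix.neg_apply, map_neg, h a ha, neg_zero] })
    ?_ ?_ ?_ x
    (Matrix.of fun i j => PowerSeries.mk fun a =>
      coeff a ((∑ k ∈ Finset.range (a + 1), x ^ k) i j)) (fun n => hpow n) ?_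
  · intro n M M' h a ha i j
    rw [Matrix.mul_apply, map_sum]
    refine Finset.sum_eq_zero fun l _ => ?_
    rw [coeff_mul]
    refine Finset.sum_eq_zero fun p hp => ?_
    rw [Finset.HasAntidiagonal.mem_antidiagonal] at hp
    rw [h p.2 (by omega), mul_zero]
  · intro n M M' h a ha i j
    rw [Matrix.mul_apply, map_sum]
    refine Finset.sum_eq_zero fun l _ => ?_
    rw [coeff_mul]
    refine Finset.sum_eq_zero fun p hp => ?_
    rw [Finset.HasAntidiagonal.mem_antidiagonal] at hp
    rw [h p.1 (by omega), zero_mul]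
  · intro M h
    ext i j a
    exact h (a + 1) a (by omega) i j
  · intro n a ha i j
    rw [Matrix.sub_apply, map_sub, Matrix.of_apply, coeff_mk, sub_eq_zero]
    rw [Matrix.sum_apply, Matrix.sum_apply, map_sum, map_sum]
    refine Finset.sum_subset (Finset.range_mono (by omega)) fun k _ hk => ?_
    exact hpow k a (by simpa using hk) i j

theorem val_hh_pow (A : Type) [Ring A] [Algebra Ch A] (n : ℕ) :
    (algebraMap Ch (Completion A) (hh ^ n)).val n = 0 :=
  Ideal.Quotient.eq_zero_iff_mem.2 ((mem_hIdeal A).2 ⟨1, mul_one _⟩)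

/-- A matrix of power series over an `h`-adic completion which is `1` modulo `h` is invertible. -/
theorem isUnit_of_one_sub_h {A : Type} [Ring A] [Algebra Ch A]
    (Q : Matrix m m (PowerSeries (Completion A))) :
    IsUnit (1 - (C (hIn (Completion A)) : PowerSeries (Completion A)) • Q) := by
  obtain ⟨x, hx⟩ : ∃ x, x = (C (hIn (Completion A)) : PowerSeries (Completion A)) • Q := ⟨_, rfl⟩
  rw [← hx]
  have hpow : ∀ n, ∃ Q' : Matrix m m (PowerSeries (Completion A)),
      x ^ n = (C (algebraMap Ch (Completion A) (hh ^ n)) : PowerSeries (Completion A)) • Q' := by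
    intro n
    induction n with
    | zero => exact ⟨1, by rw [pow_zero, pow_zero, map_one, map_one, one_smul]⟩
    | succ n ih =>
      obtain ⟨Q', hQ'⟩ := ih
      refine ⟨Q' * Q, ?_⟩
      rw [pow_succ, hQ', hx]
      ext1 i j
      rw [Matrix.mul_apply, Matrix.smul_apply, Matrix.mul_apply, smul_eq_mul, Finset.mul_sum]
      refine Finset.sum_congr rfl fun l _ => ?_
      have hc : Commute (C (hIn (Completion A))) (Q' i l) := by
        refine PowerSeries.ext fun b => ?_
        rw [coeff_C_mul, coeff_mul_C]
        exact Algebra.commutes (A := Completion A) hh _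
      rw [Matrix.smul_apply, Matrix.smul_apply, smul_eq_mul, smul_eq_mul, mul_assoc,
        ← mul_assoc (Q' i l), ← hc.eq, pow_succ, map_mul, map_mul]
      simp only [mul_assoc]
      rfl
  have hpow' : ∀ k n, n ≤ k → ∀ i j a, (coeff a ((x ^ k) i j)).val n = 0 := by
    intro k n hnk i j a
    obtain ⟨d, rfl⟩ := Nat.exists_eq_add_of_le hnk
    obtain ⟨Q', hQ'⟩ := hpow (n + d)
    rw [hQ', Matrix.smul_apply, smul_eq_mul, coeff_C_mul, pow_add, map_mul]
    change (algebraMap Ch (Completion A) (hh ^ n)).val n * _ * _ = 0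
    rw [val_hh_pow, zero_mul, zero_mul]
  refine isUnit_one_sub_of_adic (E := Matrix m m (PowerSeries (Completion A)))
    (fun n => { carrier := {M : Matrix m m (PowerSeries (Completion A)) | ∀ i j a, (coeff a (M i j)).val n = 0}
                add_mem' := fun {M M'} h h' i j a => by
                  rw [Matrix.add_apply, map_add]
                  change (coeff a (M i j)).val n + (coeff a (M' i j)).val n = 0
                  rw [h, h', add_zero]
                zero_mem' := fun i j a => by rw [Matrix.zero_apply, map_zero]; rfl
                neg_mem' := fun {M} h i j a => by
                  rw [Matrix.neg_apply, map_neg]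
                  change -(coeff a (M i j)).val n = 0
                  rw [h, neg_zero] })
    ?_ ?_ ?_ x
    (Matrix.of fun i j => PowerSeries.mk fun a =>
      ⟨fun n => (coeff a ((∑ k ∈ Finset.range n, x ^ k) i j)).val n, ?_⟩)
    (fun n => hpow' n n le_rfl) ?_
  · intro n M M' h i j a
    rw [Matrix.mul_apply, map_sum]
    simp only [coeff_mul]
    rw [AddSubmonoidClass.coe_finsetSum, Finset.sum_apply]
    refine Finset.sum_eq_zero fun l _ => ?_
    rw [AddSubmonoidClass.coe_finsetSum, Finset.sum_apply]
    refine Finset.sum_eq_zero fun p _ => ?_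
    change _ * (coeff p.2 (M' l j)).val n = 0
    rw [h, mul_zero]
  · intro n M M' h i j a
    rw [Matrix.mul_apply, map_sum]
    simp only [coeff_mul]
    rw [AddSubmonoidClass.coe_finsetSum, Finset.sum_apply]
    refine Finset.sum_eq_zero fun l _ => ?_
    rw [AddSubmonoidClass.coe_finsetSum, Finset.sum_apply]
    refine Finset.sum_eq_zero fun p _ => ?_
    change (coeff p.1 (M i l)).val n * _ = 0
    rw [h, zero_mul]
  · intro M h
    ext i j a n
    exact h n i j a
  · intro n
    dsimp only
    rw [Finset.sum_range_succ, Matrix.add_apply, map_add]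
    have h2 := (coeff a ((∑ k ∈ Finset.range n, x ^ k) i j)).2 n
    have h3 : Ideal.Quotient.factor (hIdeal_succ_le A n) ((coeff a ((x ^ n) i j)).val (n + 1)) = 0 :=
      ((coeff a ((x ^ n) i j)).2 n).trans (hpow' n n le_rfl i j a)
    change Ideal.Quotient.factor (hIdeal_succ_le A n)
      ((coeff a ((∑ k ∈ Finset.range n, x ^ k) i j)).val (n + 1) +
        (coeff a ((x ^ n) i j)).val (n + 1)) = _
    rw [map_add, h3, add_zero]
    exact h2
  · intro n i j a
    rw [Matrix.sub_apply, map_sub, Matrix.of_apply, coeff_mk]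
    exact sub_self _

end Units

/-! ### Matrices on tensor powers of `ℂᴺ`

`(End ℂᴺ)^{⊗ n} ⊗ S` is the ring of matrices over `S` indexed by `Fin n → Fin N`. -/

section Tensor

variable {N n : ℕ} {S : Type} [Ring S]

/-- The matrix `M ∈ End ℂᴺ ⊗ S` placed in the `k`-th tensor factor of `(End ℂᴺ)^{⊗ n} ⊗ S`. -/
def atFactor (k : Fin n) (M : Matrix (Fin N) (Fin N) S) :
    Matrix (Fin n → Fin N) (Fin n → Fin N) S :=
  Matrix.of fun I J => if ∀ l, l ≠ k → I l = J l then M (I k) (J k) else 0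

theorem atFactor_one (k : Fin n) : atFactor k (1 : Matrix (Fin N) (Fin N) S) = 1 := by
  ext I J
  simp only [atFactor, Matrix.of_apply, Matrix.one_apply]
  by_cases h : I = J
  · simp [h]
  · rw [if_neg h]
    split_ifs with h1 h2
    · exact (h (funext fun l => by
        by_cases hl : l = k
        · rw [hl, h2]
        · exact h1 l hl)).elim
    · rfl
    · rfl

theorem atFactor_mul (k : Fin n) (M M' : Matrix (Fin N) (Fin N) S) :
    atFactor k (M * M') = atFactor k M * atFactor k M' := by
  ext I J
  simp only [Matrix.mul_apply, atFactor, Matrix.of_apply]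
  have hinj : Function.Injective fun l : Fin N => Function.update I k l :=
    Function.update_injective I k
  rw [← Finset.sum_subset (Finset.subset_univ (Finset.univ.map ⟨_, hinj⟩))]
  · rw [Finset.sum_map]
    simp only [Function.Embedding.coeFn_mk, Function.update_self]
    split_ifs with h
    · refine Finset.sum_congr rfl fun l _ => ?_
      rw [if_pos, if_pos]
      · intro a ha
        rw [Function.update_of_ne ha, h a ha]
      · intro a ha
        rw [Function.update_of_ne ha]
    · symm
      refine Finset.sum_eq_zero fun l _ => ?_
      rw [if_neg (c := ∀ a, a ≠ k → Function.update I k l a = J a), mul_zero]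
      intro h'
      exact h fun a ha => by rw [← h' a ha, Function.update_of_ne ha]
  · intro K _ hK
    rw [if_neg, zero_mul]
    intro h'
    refine hK (Finset.mem_map.2 ⟨K k, Finset.mem_univ _, ?_⟩)
    funext a
    by_cases ha : a = k
    · subst ha
      simp
    · simp [Function.update_of_ne ha, h' a ha]

theorem isUnit_atFactor (k : Fin n) {M : Matrix (Fin N) (Fin N) S} (hM : IsUnit M) :
    IsUnit (atFactor k M) := by
  obtain ⟨U, rfl⟩ := hM
  exact ⟨⟨atFactor k U, atFactor k (U⁻¹ : _), by rw [← atFactor_mul, U.mul_inv, atFactor_one],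
    by rw [← atFactor_mul, U.inv_mul, atFactor_one]⟩, rfl⟩

/-- The action of a permutation on `(ℂᴺ)^{⊗ n}`: the factor in position `l` moves to position
`σ l`. -/
def permOp (σ : Equiv.Perm (Fin n)) : Matrix (Fin n → Fin N) (Fin n → Fin N) S :=
  Matrix.of fun I J => if I ∘ σ = J then 1 else 0

/-- The operator `P : x ⊗ y ↦ y ⊗ x` on `ℂᴺ ⊗ ℂᴺ`. -/
def flipOp : Matrix (Fin 2 → Fin N) (Fin 2 → Fin N) S := permOp (Equiv.swap 0 1)

variable (N n)

/-- The image `H⁽ⁿ⁾` of the symmetrizer. -/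
def symmetrizer : Matrix (Fin n → Fin N) (Fin n → Fin N) ℂ :=
  (n.factorial : ℂ)⁻¹ • ∑ σ : Equiv.Perm (Fin n), permOp σ

/-- The image `A⁽ⁿ⁾` of the anti-symmetrizer. -/
def antisymmetrizer : Matrix (Fin n → Fin N) (Fin n → Fin N) ℂ :=
  (n.factorial : ℂ)⁻¹ • ∑ σ : Equiv.Perm (Fin n), ((Equiv.Perm.sign σ : ℤ) : ℂ) • permOp σ

end Tensor

/-! ### The double Yangian -/

/-- The generators of the double Yangian: `C`, `t_{ij}^{(r+1)}` and `t_{ij}^{(-r-1)}`, `r ≥ 0`. -/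
inductive Gen (N : ℕ) : Type
  | C : Gen N
  | tPos (i j : Fin N) (r : ℕ) : Gen N
  | tNeg (i j : Fin N) (r : ℕ) : Gen N

/-- The free `ℂ[[h]]`-algebra on the generators. -/
abbrev FreeGen (N : ℕ) : Type := FreeAlgebra Ch (Gen N)

section Coefficients

variable {N : ℕ} {A : Type} [Ring A] [Algebra Ch A]

/-- With `p i j r` in the role of `t_{ij}^{(r+1)}`, the coefficient of `u^{-k}` in
`t_{ij}(u) = δ_{ij} + h ∑_{r ≥ 1} t_{ij}^{(r)} u^{-r}`. -/
def posCoeff (p : Fin N → Fin N → ℕ → A) (i j : Fin N) : ℕ → A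
  | 0 => if i = j then 1 else 0
  | r + 1 => hIn A * p i j r

/-- With `q i j r` in the role of `t_{ij}^{(-r-1)}`, the coefficient of `uᵐ` in
`t⁺_{ij}(u) = δ_{ij} - h ∑_{r ≥ 1} t_{ij}^{(-r)} u^{r-1}`. -/
def negCoeff (q : Fin N → Fin N → ℕ → A) (i j : Fin N) (m : ℕ) : A :=
  (if m = 0 ∧ i = j then 1 else 0) - hIn A * q i j m

end Coefficients

section Relations

open PowerSeries

variable (N : ℕ)

/-- The generators as elements of the free algebra. -/
def gen (x : Gen N) : FreeGen N := FreeAlgebra.ι Ch x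

/-- Series in two variables over the free algebra; `X` is the variable attached to `u` (either `u`
or `u⁻¹`), and `C X` is the variable attached to `v` (either `v` or `v⁻¹`). -/
abbrev TwoVar : Type := PowerSeries (PowerSeries (FreeGen N))

/-- The matrix `T` as a series in one variable, which stands for the inverse of its argument. -/
def freeT : Matrix (Fin N) (Fin N) (PowerSeries (FreeGen N)) :=
  Matrix.of fun i j => PowerSeries.mk (posCoeff (fun i j r => gen N (.tPos i j r)) i j)

/-- The matrix `T⁺` as a series in one variable, which stands for its argument. -/
def freeTPlus : Matrix (Fin N) (Fin N) (PowerSeries (FreeGen N)) :=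
  Matrix.of fun i j => PowerSeries.mk (negCoeff (fun i j r => gen N (.tNeg i j r)) i j)

/-- `M₁(u)`: the matrix `M` in the first tensor factor, with the variable attached to `u`. -/
def first (M : Matrix (Fin N) (Fin N) (PowerSeries (FreeGen N))) :
    Matrix (Fin 2 → Fin N) (Fin 2 → Fin N) (TwoVar N) :=
  atFactor 0 (M.map (PowerSeries.map (C (R := FreeGen N))))

/-- `M₂(v)`: the matrix `M` in the second tensor factor, with the variable attached to `v`. -/
def second (M : Matrix (Fin N) (Fin N) (PowerSeries (FreeGen N))) :
    Matrix (Fin 2 → Fin N) (Fin 2 → Fin N) (TwoVar N) :=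
  atFactor 1 (M.map (C (R := PowerSeries (FreeGen N))))

/-- `h` as a series in two variables. -/
def hTwo : TwoVar N := C (C (hIn (FreeGen N)))

/-- `(u - v) R(u - v) = (u - v) - h P`, in the variables `u`, `v`. -/
def yangPlus : Matrix (Fin 2 → Fin N) (Fin 2 → Fin N) (TwoVar N) :=
  (X - C X : TwoVar N) • 1 - hTwo N • flipOp

/-- `u⁻¹ v⁻¹ (u - v) R(u - v) = (v⁻¹ - u⁻¹) - h u⁻¹ v⁻¹ P`, in the variables `u⁻¹`, `v⁻¹`. -/
def yang : Matrix (Fin 2 → Fin N) (Fin 2 → Fin N) (TwoVar N) :=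
  (C X - X : TwoVar N) • 1 - (hTwo N * X * C X) • flipOp

/-- `R̄(u - y) = g((u - y) / h) (1 - h P (u - y)⁻¹)`, in the variables `u⁻¹`, `v`, where `y` is a
series in `v`, and the negative powers of `u - y` are expanded in negative powers of `u`. -/
def rBar (y : PowerSeries (FreeGen N)) :
    Matrix (Fin 2 → Fin N) (Fin 2 → Fin N) (TwoVar N) :=
  compSeries (fun k => C (cst (FreeGen N) (coeff k (gSeries N)) * hIn (FreeGen N) ^ k))
      (invSub y) •
    (1 - (hTwo N * invSub y) • flipOp)

/-- `h C / 2`. -/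
def halfC : FreeGen N := cst (FreeGen N) (1 / 2) * hIn (FreeGen N) * gen N .C

/-- `R(u - v) T₁(u) T₂(v) - T₂(v) T₁(u) R(u - v)`, multiplied by `u⁻¹ v⁻¹ (u - v)`. -/
def rttPos : Matrix (Fin 2 → Fin N) (Fin 2 → Fin N) (TwoVar N) :=
  yang N * first N (freeT N) * second N (freeT N) -
    second N (freeT N) * first N (freeT N) * yang N

/-- `R(u - v) T⁺₁(u) T⁺₂(v) - T⁺₂(v) T⁺₁(u) R(u - v)`, multiplied by `u - v`. -/
def rttNeg : Matrix (Fin 2 → Fin N) (Fin 2 → Fin N) (TwoVar N) :=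
  yangPlus N * first N (freeTPlus N) * second N (freeTPlus N) -
    second N (freeTPlus N) * first N (freeTPlus N) * yangPlus N

/-- `R̄(u - v + hC/2) T₁(u) T⁺₂(v) - T⁺₂(v) T₁(u) R̄(u - v - hC/2)`. -/
def rttMixed : Matrix (Fin 2 → Fin N) (Fin 2 → Fin N) (TwoVar N) :=
  rBar N (X - C (halfC N)) * first N (freeT N) * second N (freeTPlus N) -
    second N (freeTPlus N) * first N (freeT N) * rBar N (X + C (halfC N))

/-- The elements of the free algebra that have to vanish: the coefficients of the three families
of `RTT` relations. -/
def rttCoeffs : Set (FreeGen N) :=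
  {e | ∃ (L : Matrix (Fin 2 → Fin N) (Fin 2 → Fin N) (TwoVar N)) (I J : Fin 2 → Fin N) (p q : ℕ),
    (L = rttPos N ∨ L = rttNeg N ∨ L = rttMixed N) ∧ e = coeff q (coeff p (L I J))}

/-- The defining relations of the double Yangian: `C` is central, and the `RTT` relations hold.
As usual, powers of `h` which divide a coefficient of an `RTT` relation (in the free algebra,
which has no `h`-torsion) are cancelled, so that the double Yangian is a flat deformation; the
coefficients are all divisible by `h²`, since `T(u)`, `T⁺(u)` and the `R`-matrices are `1`
modulo `h`.  The case `k = 0` gives the relations without any cancellation. -/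
inductive DYRel : FreeGen N → FreeGen N → Prop
  | central (x : Gen N) : DYRel (gen N .C * gen N x) (gen N x * gen N .C)
  | rtt (k : ℕ) (r : FreeGen N) (hr : hIn (FreeGen N) ^ k * r ∈ rttCoeffs N) : DYRel r 0

/-- The double Yangian `DY(gl_N)`. -/
def DY : Type := RingQuot (DYRel N)

instance : Ring (DY N) := inferInstanceAs (Ring (RingQuot (DYRel N)))

instance : Algebra Ch (DY N) := inferInstanceAs (Algebra Ch (RingQuot (DYRel N)))

/-- The projection of the free algebra onto the double Yangian. -/
def toDY : FreeGen N →ₐ[Ch] DY N := RingQuot.mkAlgHom Ch (DYRel N)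

/-- The relation `C = c`. -/
inductive LevelRel (c : ℂ) : DY N → DY N → Prop
  | level : LevelRel c (toDY N (gen N .C)) (cst (DY N) c)

/-- The double Yangian `DY_c(gl_N)` at the level `c`. -/
def DYc (c : ℂ) : Type := RingQuot (LevelRel N c)

instance (c : ℂ) : Ring (DYc N c) := inferInstanceAs (Ring (RingQuot (LevelRel N c)))

instance (c : ℂ) : Algebra Ch (DYc N c) :=
  inferInstanceAs (Algebra Ch (RingQuot (LevelRel N c)))

/-- The projection of the double Yangian onto the double Yangian at the level `c`. -/
def toDYc (c : ℂ) : DY N →ₐ[Ch] DYc N c := RingQuot.mkAlgHom Ch (LevelRel N c)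

/-- The image of a generator in `DY_c(gl_N)`. -/
def genC (c : ℂ) (x : Gen N) : DYc N c := toDYc N c (toDY N (gen N x))

end Relations

/-! ### The vacuum module over the double Yangian -/

section Vacuum

variable (N : ℕ) (c : ℂ)

/-- The `h`-adically completed double Yangian at the level `c`. -/
def DYHat : Type := Completion (DYc N c)

instance : Ring (DYHat N c) := inferInstanceAs (Ring (Completion (DYc N c)))

instance : Algebra Ch (DYHat N c) := inferInstanceAs (Algebra Ch (Completion (DYc N c)))

/-- The canonical homomorphism from `DY_c(gl_N)` to its completion. -/
def toDYHat : DYc N c →+* DYHat N c := toCompletion (DYc N c)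

/-- The sum `∑ₛ hˢ xₛ` in the completed double Yangian, with all `xₛ` in `DY_c(gl_N)`. -/
def hatSum (x : ℕ → DYc N c) : DYHat N c := hSum x

/-- The left ideal of `DY_c(gl_N)` generated by all `t_{ij}^{(r)}`, `r ≥ 1`. -/
def vacIdeal : Ideal (DYc N c) :=
  Ideal.span {x | ∃ (i j : Fin N) (r : ℕ), x = genC N c (.tPos i j r)}

/-- The vacuum module `𝒱_c(gl_N)`: the `h`-adic completion of the quotient of `DY_c(gl_N)` by the
left ideal `vacIdeal`. -/
def VModule : Type := ModCompletion (DYc N c) (DYc N c ⧸ vacIdeal N c)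

instance : AddCommGroup (VModule N c) :=
  inferInstanceAs (AddCommGroup (ModCompletion (DYc N c) (DYc N c ⧸ vacIdeal N c)))

/-- The action of the completed double Yangian on the vacuum module. -/
instance : Module (DYHat N c) (VModule N c) :=
  inferInstanceAs (Module (Completion (DYc N c))
    (ModCompletion (DYc N c) (DYc N c ⧸ vacIdeal N c)))

/-- The structure of a `ℂ[[h]]`-module on the vacuum module. -/
instance : Module Ch (VModule N c) := Module.compHom _ (algebraMap Ch (DYHat N c))

instance : IsScalarTower Ch (DYHat N c) (VModule N c) := by
  refine ⟨fun a x v => ?_⟩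
  rw [Algebra.smul_def, mul_smul]
  rfl

/-- The image `𝟏` of the unit of `DY_c(gl_N)` in the vacuum module. -/
def vac : VModule N c :=
  (⟨fun _ => Submodule.Quotient.mk (Submodule.Quotient.mk 1), fun _ => rfl⟩ :
    ModCompletion (DYc N c) (DYc N c ⧸ vacIdeal N c))

/-! ### Reflection algebras -/

/-- Complex numbers as constant series over the completed double Yangian. -/
def cstSeries : ℂ →+* PowerSeries (DYHat N c) := PowerSeries.C.comp (cst (DYHat N c))

/-- `T(x)` as a series in `X = u⁻¹`, where `s` is the expansion of `x⁻¹`. -/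
def matT (s : PowerSeries (DYHat N c)) : Matrix (Fin N) (Fin N) (PowerSeries (DYHat N c)) :=
  Matrix.of fun i j => compSeries
    (fun k => toDYHat N c (posCoeff (fun i j r => genC N c (.tPos i j r)) i j k)) s

/-- `T⁺(ε u + α h)` as a series in `X = u`: the coefficient of `uᵃ` is the `h`-adically convergent
sum over `s` of `binom (a + s) a * εᵃ * (α h)ˢ` times the coefficient of `x^{a+s}` in `T⁺(x)`. -/
def matTPlus (ε α : ℂ) : Matrix (Fin N) (Fin N) (PowerSeries (DYHat N c)) :=
  Matrix.of fun i j => PowerSeries.mk fun a => hatSum N c fun s =>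
    cst (DYc N c) (((a + s).choose a : ℂ) * ε ^ a * α ^ s) *
      negCoeff (fun i j r => genC N c (.tNeg i j r)) i j (a + s)

/-- `T(x)` is invertible, since its constant term in `u⁻¹` is `1`. -/
theorem isUnit_matT (s : PowerSeries (DYHat N c)) : IsUnit (matT N c s) := by
  refine isUnit_of_constantCoeff _ fun i j => ?_
  simp only [matT, compSeries, Matrix.of_apply, PowerSeries.coeff_mk, Finset.sum_range_succ,
    Finset.sum_range_zero, pow_zero, PowerSeries.coeff_zero_one, one_mul, zero_add, posCoeff,
    Matrix.one_apply]
  split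
  · exact map_one _
  · exact map_zero _

/-- `T⁺(ε u + α h)` is invertible, since it is `1` modulo `h`. -/
theorem isUnit_matTPlus (ε α : ℂ) : IsUnit (matTPlus N c ε α) := by
  have h : matTPlus N c ε α = 1 - (PowerSeries.C (hIn (DYHat N c)) : PowerSeries (DYHat N c)) •
      Matrix.of fun i j => PowerSeries.mk fun a => hatSum N c fun s =>
        cst (DYc N c) (((a + s).choose a : ℂ) * ε ^ a * α ^ s) *
          genC N c (.tNeg i j (a + s)) := by
    ext i j a
    rw [Matrix.sub_apply, Matrix.smul_apply, smul_eq_mul, map_sub, PowerSeries.coeff_C_mul]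
    simp only [matTPlus, Matrix.of_apply, PowerSeries.coeff_mk]
    have h1 : PowerSeries.coeff a
        ((1 : Matrix (Fin N) (Fin N) (PowerSeries (DYHat N c))) i j) =
        toDYHat N c (if a = 0 ∧ i = j then 1 else 0) := by
      rw [Matrix.one_apply]
      by_cases hij : i = j
      · by_cases ha : a = 0
        · simp [hij, ha]
        · simp [hij, ha, PowerSeries.coeff_one]
      · simp [hij]
    rw [h1]
    apply Subtype.ext
    funext n
    change Ideal.Quotient.mk (hIdeal (DYc N c) n) _ = Ideal.Quotient.mk (hIdeal (DYc N c) n) _ -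
      Ideal.Quotient.mk (hIdeal (DYc N c) n) (hIn (DYc N c)) *
      Ideal.Quotient.mk (hIdeal (DYc N c) n) _
    rw [← map_mul, ← map_sub]
    rcases n with _ | n
    · rw [Ideal.Quotient.eq]
      exact (mem_hIdeal _).2 ⟨_, by rw [pow_zero, map_one, one_mul]⟩
    · congr 1
      simp only [negCoeff, mul_sub, Finset.sum_sub_distrib, Finset.mul_sum]
      congr 1
      · rw [Finset.sum_eq_single 0]
        · by_cases ha : a = 0 <;> simp [ha]
        · intro s _ hs
          simp [hs]
        · simp
      · refine Finset.sum_congr rfl fun s _ => ?_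
        simp only [hIn, cst, RingHom.comp_apply]
        rw [← mul_assoc, ← mul_assoc, ← mul_assoc, ← mul_assoc, ← map_mul, ← map_mul,
          ← map_mul, ← map_mul, mul_comm hh, mul_right_comm]
  rw [h]
  exact isUnit_of_one_sub_h (A := DYc N c) _

/-- The diagonal matrix `G = diag(1, …, 1, -1, …, -1)`, with `M` entries equal to `1`. -/
def matG (M : ℕ) : Matrix (Fin N) (Fin N) ℂ :=
  Matrix.diagonal fun i => if (i : ℕ) < M then 1 else -1

variable (M : ℕ)

/-- `B⁺(u) = T⁺(u) G T⁺(-u)⁻¹` as a series in `X = u`. -/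
def matBPlus : Matrix (Fin N) (Fin N) (PowerSeries (DYHat N c)) :=
  matTPlus N c 1 0 * (matG N M).map (cstSeries N c) * Ring.inverse (matTPlus N c (-1) 0)

/-- `B(u) = T(u + hc) G T(-u)⁻¹` as a series in `X = u⁻¹`. -/
def matB : Matrix (Fin N) (Fin N) (PowerSeries (DYHat N c)) :=
  matT N c (invSub (-(hIn (DYHat N c) * cst (DYHat N c) c))) * (matG N M).map (cstSeries N c) *
    Ring.inverse (matT N c (-PowerSeries.X))

/-- The elements `b_{ij}^{(-r-1)}`, `r ≥ 0`, given by
`b⁺_{ij}(u) = g_{ij} - h ∑_{r ≥ 1} b_{ij}^{(-r)} u^{r-1}`. -/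
def bNegGens : Set (DYHat N c) :=
  {x | ∃ (i j : Fin N) (r : ℕ), PowerSeries.coeff r (matBPlus N c M i j) =
    PowerSeries.coeff r (cstSeries N c (matG N M i j)) - hIn (DYHat N c) * x}

/-- The subalgebra generated by the elements `b_{ij}^{(-r)}`. -/
def bPlusPre : Subalgebra Ch (DYHat N c) := Algebra.adjoin Ch (bNegGens N c M)

/-- The subalgebra `[S] = {v : hⁿ v ∈ S for some n ≥ 0}`. -/
def saturation (S : Subalgebra Ch (DYHat N c)) : Subalgebra Ch (DYHat N c) where
  carrier := {v | ∃ n : ℕ, hh ^ n • v ∈ S}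
  mul_mem' := by
    rintro a b ⟨m, ha⟩ ⟨n, hb⟩
    refine ⟨m + n, ?_⟩
    rw [pow_add, ← smul_mul_smul_comm]
    exact S.mul_mem ha hb
  add_mem' := by
    rintro a b ⟨m, ha⟩ ⟨n, hb⟩
    refine ⟨m + n, ?_⟩
    rw [smul_add]
    refine S.add_mem ?_ ?_
    · rw [add_comm, pow_add, mul_smul]
      exact S.smul_mem ha _
    · rw [pow_add, mul_smul]
      exact S.smul_mem hb _
  algebraMap_mem' := by
    intro r
    exact ⟨0, by rw [pow_zero, one_smul]; exact S.algebraMap_mem r⟩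

/-- The algebra `B⁺(gl_N)`. -/
def bPlus : Subalgebra Ch (DYHat N c) := saturation N c (bPlusPre N c M)

/-- The `B⁺(gl_N)`-submodule `𝒲'_c(gl_N)` of the vacuum module generated by `𝟏`. -/
def wPre : Submodule (bPlus N c M) (VModule N c) := Submodule.span (bPlus N c M) {vac N c}

/-- The vacuum module `𝒲_c(gl_N)`: the `h`-adic completion of `𝒲'_c(gl_N)`.  Since `B⁺(gl_N)` is
saturated, the `h`-adic topology of `𝒲'_c(gl_N)` is induced from `𝒱_c(gl_N)`, which is complete,
so the completion is the closure of `𝒲'_c(gl_N)` in the `h`-adic topology of `𝒱_c(gl_N)`. -/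
def wModule : Submodule Ch (VModule N c) where
  carrier := {w | ∀ n : ℕ, ∃ w' ∈ wPre N c M, ∃ v : VModule N c, w = w' + hh ^ n • v}
  add_mem' := by
    intro a b ha hb n
    obtain ⟨a', ha', x, rfl⟩ := ha n
    obtain ⟨b', hb', y, rfl⟩ := hb n
    exact ⟨a' + b', add_mem ha' hb', x + y, by rw [smul_add]; abel⟩
  zero_mem' := fun n => ⟨0, zero_mem _, 0, by rw [smul_zero, add_zero]⟩
  smul_mem' := by
    intro r a ha n
    obtain ⟨a', ha', x, rfl⟩ := ha n
    refine ⟨r • a', ?_, r • x, by rw [smul_add, smul_comm]⟩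
    exact (wPre N c M).smul_mem (algebraMap Ch (bPlus N c M) r) ha'

/-- The submodule of invariants `𝔷(𝒲_c(gl_N)) = {w ∈ 𝒲_c(gl_N) : B(u) w = G w}`. -/
def invariants : Submodule Ch (VModule N c) where
  carrier := {w | w ∈ wModule N c M ∧ ∀ (i j : Fin N) (k : ℕ),
    PowerSeries.coeff k (matB N c M i j) • w =
      PowerSeries.coeff k (cstSeries N c (matG N M i j)) • w}
  add_mem' := by
    rintro a b ⟨ha, ha'⟩ ⟨hb, hb'⟩
    exact ⟨add_mem ha hb, fun i j k => by rw [smul_add, smul_add, ha', hb']⟩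
  zero_mem' := ⟨zero_mem _, fun i j k => by rw [smul_zero, smul_zero]⟩
  smul_mem' := by
    rintro r a ⟨ha, ha'⟩
    refine ⟨Submodule.smul_mem _ r ha, fun i j k => ?_⟩
    rw [← algebraMap_smul (DYHat N c) r a, ← mul_smul, ← mul_smul, ← Algebra.commutes,
      ← Algebra.commutes, mul_smul, mul_smul, ha']

/-! ### The symmetrizer and anti-symmetrizer series -/

variable (n : ℕ)

/-- `T⁺_n(w|0) = T⁺₁(w₁) ⋯ T⁺_n(w_n)`, where `w_k = ε u + α (k - 1) h` for `k = 1, …, n`. -/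
def tPlusProd (ε α : ℂ) : Matrix (Fin n → Fin N) (Fin n → Fin N) (PowerSeries (DYHat N c)) :=
  (List.ofFn fun k : Fin n => atFactor k (matTPlus N c ε (α * (k : ℕ)))).prod

/-- The product `T⁺_n(w_n) ⋯ T⁺₁(w₁)` in the opposite order, where `w_k = ε u + α (k - 1) h` for
`k = 1, …, n`. -/
def tPlusRevProd (ε α : ℂ) : Matrix (Fin n → Fin N) (Fin n → Fin N) (PowerSeries (DYHat N c)) :=
  (List.ofFn fun k : Fin n => atFactor k (matTPlus N c ε (α * (k : ℕ)))).reverse.prod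

theorem isUnit_tPlusRevProd (ε α : ℂ) : IsUnit (tPlusRevProd N c n ε α) := by
  refine List.prod_induction _ (fun _ _ => IsUnit.mul) isUnit_one fun x hx => ?_
  rw [List.mem_reverse, List.mem_ofFn] at hx
  obtain ⟨k, rfl⟩ := hx
  exact isUnit_atFactor k (isUnit_matTPlus N c _ _)

/-- The series `tr_{1,…,n} H⁽ⁿ⁾ T⁺_n(u₊|0) (T⁺_n reversed)(-u₊|0)⁻¹` in `u`, where
`u₊ = (u, u + h, …, u + (n-1) h)`. -/
def rowSeries : PowerSeries (DYHat N c) :=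
  Matrix.trace ((symmetrizer N n).map (cstSeries N c) * tPlusProd N c n 1 1 *
    Ring.inverse (tPlusRevProd N c n (-1) (-1)))

/-- The series `tr_{1,…,n} A⁽ⁿ⁾ T⁺_n(u₋|0) (T⁺_n reversed)(-u₋|0)⁻¹` in `u`, where
`u₋ = (u, u - h, …, u - (n-1) h)`. -/
def colSeries : PowerSeries (DYHat N c) :=
  Matrix.trace ((antisymmetrizer N n).map (cstSeries N c) * tPlusProd N c n 1 (-1) *
    Ring.inverse (tPlusRevProd N c n (-1) 1))

end Vacuum

end RTT

end

noncomputable section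

namespace RTT

/-! ### Operators on tensor powers -/

section TensorLemmas

variable {N n : ℕ} {S : Type} [Ring S]

/-! Let e = 1 for the symmetrizer and e = -1 for the anti-symmetrizer, let Q be the projector, and
let X be the product of the T⁺(u + ekh), k < n, and of the inverses T⁺(-u - ekh)⁻¹, both in
ascending order of the tensor factors. Arguments of neighbouring factors differ by eh, where the
R-matrix degenerates to a multiple of 1 + eP. Hence the product of Q with the first half of X, and
then QX itself, absorbs every transposition on the right up to the sign e (`absorbs_ordProd`).

Invariance. Put t = T(v + hc) and t' = T(-v) in an additional tensor factor; as G = ±I, the matrix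
B(v) is ± t t'⁻¹. Moving t and t'⁻¹ through X uses four exchange relations, and each of them leaves
an ordered product of n R-matrices on either side. These R-matrices do not commute, but behind an
absorbing operator such a product collapses to a multiple of 1 - κ ∑ P, where P runs over the flips
of the additional factor with the others (`fusion`). All these products therefore commute behind
absorbing operators (`Fused.comm`). The shift by hc in t makes the products on the right of the
exchange relations mutually inverse, and there remains an identity Q t t'⁻¹ β X = Q α X γ t t'⁻¹ δ.
Multiply by γ⁻¹ and take the trace over the tensor power. On the left β and γ⁻¹ cancel, on the right
α and δ cancel, both by crossing symmetry of the R-matrix (`ptr_crossed`). Crossing requires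
arguments that differ by Nh; they differ by -2ch, and this is the only place where c = -N/2 is used.
Finally t t'⁻¹ - 1 has entries which annihilate the vacuum. The algebra is in `reflection_trace`,
and its application in `trace_invariant`.

The scalar input is unitarity and crossing of the series g. Unitarity holds because g(u) g(-u) (1 -
u⁻²) is N-periodic and thus constant (`gSeries_unitary`); crossing is then the functional equation
of g (`gS_crossing`).

Membership in the module generated by B⁺. Induct on the number of factors: the new T⁺(u + ekh) is
moved past the old inverses with the help of operators (2u + γh) - hP. By absorption these become
scalars 2u + γ'h on one side of the identity, while the other side is built from B⁺(u + ekh).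
Division by 2u + γ'h is possible in the h-adic closure (`mem_bSeries_of_absorbs`).

Arguments such as ±u + αh are handled by evaluation homomorphisms on power series with
noncommutative coefficients at central, topologically nilpotent points (`evalHom`). Absence of
h-torsion in the double Yangian is never used: where a factor h has to disappear, u - v is divided
out beforehand (`exists_div_sub`). -/

theorem atFactor_apply (k : Fin n) (M : Matrix (Fin N) (Fin N) S) (I J : Fin n → Fin N) :
    atFactor k M I J = if ∀ l, l ≠ k → I l = J l then M (I k) (J k) else 0 := rfl

theorem permOp_apply (σ : Equiv.Perm (Fin n)) (I J : Fin n → Fin N) :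
    (permOp σ : Matrix _ _ S) I J = if I ∘ σ = J then 1 else 0 := rfl

theorem permOp_mul_apply (σ : Equiv.Perm (Fin n)) (F : Matrix (Fin n → Fin N) (Fin n → Fin N) S)
    (I J : Fin n → Fin N) :
    ((permOp σ : Matrix (Fin n → Fin N) (Fin n → Fin N) S) * F) I J = F (I ∘ σ) J := by
  rw [Matrix.mul_apply, Finset.sum_eq_single (I ∘ σ)]
  · simp [permOp_apply]
  · intro K _ hK
    rw [permOp_apply, if_neg (Ne.symm hK), zero_mul]
  · simp

theorem mul_permOp_apply (σ : Equiv.Perm (Fin n)) (F : Matrix (Fin n → Fin N) (Fin n → Fin N) S)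
    (I J : Fin n → Fin N) :
    (F * (permOp σ : Matrix (Fin n → Fin N) (Fin n → Fin N) S)) I J = F I (J ∘ σ.symm) := by
  rw [Matrix.mul_apply, Finset.sum_eq_single (J ∘ σ.symm)]
  · rw [permOp_apply, if_pos, mul_one]
    funext a
    simp
  · intro K _ hK
    rw [permOp_apply, if_neg, mul_zero]
    rintro rfl
    exact hK (funext fun a => by simp)
  · simp

theorem permOp_one : (permOp 1 : Matrix (Fin n → Fin N) (Fin n → Fin N) S) = 1 := by
  ext I J
  rw [permOp_apply, Matrix.one_apply]
  rfl

theorem permOp_mul (σ τ : Equiv.Perm (Fin n)) :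
    (permOp σ * permOp τ : Matrix (Fin n → Fin N) (Fin n → Fin N) S) = permOp (σ * τ) := by
  ext I J
  rw [permOp_mul_apply, permOp_apply, permOp_apply]
  rfl

theorem permOp_mul_atFactor (σ : Equiv.Perm (Fin n)) (k : Fin n) (M : Matrix (Fin N) (Fin N) S) :
    permOp σ * atFactor k M = atFactor (σ k) M * permOp σ := by
  ext I J
  rw [permOp_mul_apply, mul_permOp_apply, atFactor_apply, atFactor_apply]
  have h : (∀ l, l ≠ k → (I ∘ σ) l = J l) ↔ ∀ l, l ≠ σ k → I l = (J ∘ σ.symm) l := by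
    constructor
    · intro h l hl
      have := h (σ.symm l) (fun hh => hl (by rw [← hh, Equiv.apply_symm_apply]))
      simpa using this
    · intro h l hl
      have := h (σ l) (fun hh => hl (σ.injective hh))
      simpa using this
  rw [if_congr h rfl rfl]
  simp only [Function.comp_apply, Equiv.symm_apply_apply]

/-- The entries of the two matrices are multiplied in the order of the operators, so that relations
in a noncommutative coefficient ring can be read off from operator identities and conversely. -/
theorem atFactor_mul_atFactor_apply {k l : Fin n} (hkl : k ≠ l) (M M' : Matrix (Fin N) (Fin N) S)
    (I J : Fin n → Fin N) :
    (atFactor k M * atFactor l M') I J =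
      if ∀ a, a ≠ k → a ≠ l → I a = J a then M (I k) (J k) * M' (I l) (J l) else 0 := by
  rw [Matrix.mul_apply, Finset.sum_eq_single (Function.update I k (J k))]
  · rw [atFactor_apply, if_pos fun a ha => (Function.update_of_ne ha _ _).symm, atFactor_apply,
      Function.update_self, Function.update_of_ne hkl.symm, mul_ite, mul_zero]
    congr 1
    refine propext ⟨fun h a hk hl => ?_, fun h a hl => ?_⟩
    · simpa [Function.update_of_ne hk] using h a hl
    · by_cases hk : a = k
      · subst hk
        simp
      · rw [Function.update_of_ne hk, h a hk hl]
  · intro K _ hK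
    rw [atFactor_apply, atFactor_apply]
    split_ifs with h1 h2
    · exfalso
      apply hK
      funext a
      by_cases hk : a = k
      · subst hk
        rw [Function.update_self, h2 a hkl]
      · rw [Function.update_of_ne hk, h1 a hk]
    all_goals simp
  · simp

theorem atFactor_commute {k l : Fin n} (hkl : k ≠ l) {M M' : Matrix (Fin N) (Fin N) S}
    (h : ∀ a b c d, Commute (M a b) (M' c d)) : Commute (atFactor k M) (atFactor l M') := by
  ext I J
  rw [atFactor_mul_atFactor_apply hkl, atFactor_mul_atFactor_apply hkl.symm, (h _ _ _ _).eq]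
  congr 1
  exact propext ⟨fun h a hk hl => h a hl hk, fun h a hk hl => h a hl hk⟩

theorem atFactor_add (k : Fin n) (M M' : Matrix (Fin N) (Fin N) S) :
    atFactor k (M + M') = atFactor k M + atFactor k M' := by
  ext I J
  simp only [atFactor_apply, Matrix.add_apply]
  split_ifs <;> simp

theorem atFactor_zero (k : Fin n) : atFactor k (0 : Matrix (Fin N) (Fin N) S) = 0 := by
  ext I J
  simp [atFactor_apply]

theorem atFactor_sum {α : Type} (s : Finset α) (k : Fin n) (f : α → Matrix (Fin N) (Fin N) S) :
    atFactor k (∑ a ∈ s, f a) = ∑ a ∈ s, atFactor k (f a) :=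
  map_sum (⟨⟨atFactor k, atFactor_zero k⟩, atFactor_add k⟩ : Matrix (Fin N) (Fin N) S →+ _) f s

theorem atFactor_smul {K : Type} [CommRing K] [Algebra K S] (r : K) (k : Fin n)
    (M : Matrix (Fin N) (Fin N) S) : atFactor k (r • M) = r • atFactor k M := by
  ext I J
  simp only [atFactor_apply, Matrix.smul_apply]
  split_ifs <;> simp

theorem atFactor_neg (k : Fin n) (M : Matrix (Fin N) (Fin N) S) :
    atFactor k (-M) = -atFactor k M := by
  ext I J
  simp only [atFactor_apply, Matrix.neg_apply]
  split_ifs <;> simp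

theorem atFactor_sub (k : Fin n) (M M' : Matrix (Fin N) (Fin N) S) :
    atFactor k (M - M') = atFactor k M - atFactor k M' := by
  rw [sub_eq_add_neg, atFactor_add, atFactor_neg, sub_eq_add_neg]

theorem atFactor_map {S' : Type} [Ring S'] (φ : S →+* S') (k : Fin n)
    (M : Matrix (Fin N) (Fin N) S) : (atFactor k M).map φ = atFactor k (M.map φ) := by
  ext I J
  simp only [atFactor_apply, Matrix.map_apply]
  split_ifs <;> simp

theorem permOp_map {S' : Type} [Ring S'] (φ : S →+* S') (σ : Equiv.Perm (Fin n)) :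
    (permOp σ : Matrix (Fin n → Fin N) (Fin n → Fin N) S).map φ = permOp σ := by
  ext I J
  simp only [permOp_apply, Matrix.map_apply]
  split_ifs <;> simp

/-- An operator `Θ` on a tensor power absorbs the transpositions of the factors in `s` up to the
sign `e`. -/
def Absorbs {K : Type} [CommRing K] [Algebra K S] (e : K) (s : Set (Fin n))
    (Θ : Matrix (Fin n → Fin N) (Fin n → Fin N) S) : Prop :=
  ∀ i ∈ s, ∀ j ∈ s, i ≠ j → Θ * permOp (Equiv.swap i j) = e • Θ

/-- `(1/n!) ∑ eˢ s`, the symmetrizer for `e = 1` and the anti-symmetrizer for `e = -1`, as an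
operator characterized by its properties. -/
structure IsSymm {K : Type} [CommRing K] [Algebra K S] (e : K)
    (Q : Matrix (Fin n → Fin N) (Fin n → Fin N) S) : Prop where
  right : Absorbs e Set.univ Q
  left : ∀ i j : Fin n, i ≠ j → permOp (Equiv.swap i j) * Q = e • Q
  central : ∀ I J x, Commute (Q I J) x
  absorb : ∀ Θ : Matrix (Fin n → Fin N) (Fin n → Fin N) S, Absorbs e Set.univ Θ → Θ * Q = Θ

end TensorLemmas

/-! ### Operators on `ℂᴺ ⊗ (ℂᴺ)^{⊗ n}` as block matrices -/

section Blocks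

/-- Operators on `ℂᴺ ⊗ (ℂᴺ)^{⊗ n}` with coefficients in `S`, as matrices whose entries are
operators on `(ℂᴺ)^{⊗ n}`. -/
abbrev Blk (N n : ℕ) (S : Type) : Type :=
  Matrix (Fin N) (Fin N) (Matrix (Fin n → Fin N) (Fin n → Fin N) S)

variable {N n : ℕ} {S : Type} [Ring S]

/-- Operators on the additional tensor factor. -/
def onZero : Matrix (Fin N) (Fin N) S →+* Blk N n S := (Matrix.scalar (Fin n → Fin N)).mapMatrix

/-- Operators on the tensor power. -/
def onRest : Matrix (Fin n → Fin N) (Fin n → Fin N) S →+* Blk N n S := Matrix.scalar (Fin N)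

/-- The flip of the additional tensor factor with the factor `k`. -/
def flipZero (k : Fin n) : Blk N n S := Matrix.of fun a b => atFactor k (Matrix.single b a 1)

theorem flipZero_apply (k : Fin n) (a b : Fin N) :
    (flipZero k : Blk N n S) a b = atFactor k (Matrix.single b a 1) := rfl

theorem onZero_apply (t : Matrix (Fin N) (Fin N) S) (a b : Fin N) :
    (onZero t : Blk N n S) a b = Matrix.scalar (Fin n → Fin N) (t a b) := rfl

theorem onRest_mul_apply (X : Matrix (Fin n → Fin N) (Fin n → Fin N) S) (E : Blk N n S)
    (a b : Fin N) : (onRest X * E) a b = X * E a b := by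
  simp [onRest, Matrix.scalar_apply, Matrix.diagonal_mul]

theorem mul_onRest_apply (X : Matrix (Fin n → Fin N) (Fin n → Fin N) S) (E : Blk N n S)
    (a b : Fin N) : (E * onRest X) a b = E a b * X := by
  simp [onRest, Matrix.scalar_apply, Matrix.mul_diagonal]

theorem scalar_eq_atFactor (k : Fin n) (x : S) :
    Matrix.scalar (Fin n → Fin N) x = atFactor k (Matrix.scalar (Fin N) x) := by
  ext I J
  simp only [Matrix.scalar_apply, Matrix.diagonal_apply, atFactor_apply]
  by_cases h : I = J
  · simp [h]
  · rw [if_neg h]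
    split_ifs with h1 h2
    · exact (h (funext fun l => by
        by_cases hl : l = k
        · rw [hl, h2]
        · exact h1 l hl)).elim
    · rfl
    · rfl

theorem onRest_atFactor_flipZero (σ : Equiv.Perm (Fin n)) (k : Fin n) :
    onRest (permOp σ) * (flipZero k : Blk N n S) = flipZero (σ k) * onRest (permOp σ) := by
  ext1 a b
  rw [onRest_mul_apply, mul_onRest_apply, flipZero_apply, flipZero_apply, permOp_mul_atFactor]

theorem flipZero_mul_self (k : Fin n) : (flipZero k * flipZero k : Blk N n S) = 1 := by
  ext1 a b
  rw [Matrix.mul_apply]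
  simp only [flipZero_apply, ← atFactor_mul]
  rw [← atFactor_sum, Matrix.one_apply]
  split_ifs with h
  · subst h
    rw [← atFactor_one k]
    congr 1
    ext i j
    rw [Matrix.sum_apply, Matrix.one_apply, Finset.sum_eq_single i]
    · simp [Matrix.single_apply]
    · intro c _ hc
      simp [hc]
    · simp
  · rw [← atFactor_zero k]
    congr 1
    refine Finset.sum_eq_zero fun c _ => ?_
    rw [Matrix.single_mul_single_of_ne _ _ _ _ h]

/-- A product of two flips with the additional factor contains a transposition inside the tensor
power. It stands on the left, where an absorbing operator turns it into a sign; this drives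
`fusion`. -/
theorem flipZero_mul_flipZero {i k : Fin n} (hik : i ≠ k) :
    (flipZero k * flipZero i : Blk N n S) = onRest (permOp (Equiv.swap i k)) * flipZero k := by
  ext a b I J
  rw [onRest_mul_apply, Matrix.mul_apply, Matrix.sum_apply, permOp_mul_apply, flipZero_apply,
    atFactor_apply]
  simp only [flipZero_apply, atFactor_mul_atFactor_apply hik.symm, Matrix.single_apply]
  have hc : (∀ l, l ≠ k → (I ∘ Equiv.swap i k) l = J l) ↔
      (∀ l, l ≠ k → l ≠ i → I l = J l) ∧ I k = J i := by
    constructor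
    · intro h
      refine ⟨fun l hk hi => ?_, ?_⟩
      · simpa [Equiv.swap_apply_of_ne_of_ne hi hk] using h l hk
      · simpa using h i hik
    · rintro ⟨h1, h2⟩ l hl
      by_cases hi : l = i
      · subst hi
        simpa using h2
      · simpa [Equiv.swap_apply_of_ne_of_ne hi hl] using h1 l hl hi
  rw [if_congr hc rfl rfl]
  simp only [Function.comp_apply, Equiv.swap_apply_right]
  by_cases h : ∀ l, l ≠ k → l ≠ i → I l = J l
  · have h' := eq_true h
    simp only [h', if_true, true_and]
    rw [Finset.sum_eq_single (I k)]
    · by_cases h1 : I k = J i <;> by_cases h2 : a = J k <;> by_cases h3 : b = I i <;>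
        simp [h1, h2, h3]
    · intro c _ hc
      simp [hc]
    · simp
  · simp [h]

variable {K : Type} [CommRing K] [Algebra K S]

/-- The operator `g (1 - q P)`, where `P` is the flip of the additional tensor factor with the
factor `k`. -/
def rOp (k : Fin n) (g q : K) : Blk N n S := g • (1 - q • flipZero k)

/-- Unitarity: P² = 1 gives (1 - qP)(1 + qP) = 1 - q². -/
theorem rOp_mul_rOp (k : Fin n) {g g' q : K} (h : g * g' * (1 - q ^ 2) = 1) :
    (rOp k g q * rOp k g' (-q) : Blk N n S) = 1 := by
  rw [rOp, rOp, smul_mul_smul_comm]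
  have : ((1 : Blk N n S) - q • flipZero k) * (1 - (-q) • flipZero k) = (1 - q ^ 2) • 1 := by
    rw [sub_mul, mul_sub, mul_sub, mul_one, one_mul, mul_one, smul_mul_smul_comm,
      flipZero_mul_self]
    module
  rw [this, smul_smul, h, one_smul]

/-- Passes from the scalar form of the RTT relation to operators. All blocks involved live in the
single tensor factor `k`, so the comparison reduces to N × N matrices over the coefficient ring. -/
theorem rOp_mixed (k : Fin n) (g q g' q' : K) (t s : Matrix (Fin N) (Fin N) S)
    (h : ∀ a b i j, g • (t a b * s i j - q • (t i b * s a j)) =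
      g' • (s i j * t a b - q' • (s i b * t a j))) :
    (rOp k g q * onZero t * onRest (atFactor k s) : Blk N n S) =
      onRest (atFactor k s) * onZero t * rOp k g' q' := by
  have e1 : ∀ a b, (onZero t * onRest (atFactor k s) : Blk N n S) a b =
      atFactor k (Matrix.scalar (Fin N) (t a b) * s) := fun a b => by
    rw [mul_onRest_apply, onZero_apply, scalar_eq_atFactor k, atFactor_mul]
  have e2 : ∀ a b, (onRest (atFactor k s) * onZero t : Blk N n S) a b =
      atFactor k (s * Matrix.scalar (Fin N) (t a b)) := fun a b => by
    rw [onRest_mul_apply, onZero_apply, scalar_eq_atFactor k, atFactor_mul]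
  rw [mul_assoc, rOp, rOp, smul_mul_assoc, sub_mul, one_mul, smul_mul_assoc, mul_smul_comm,
    mul_sub, mul_one, mul_smul_comm]
  ext1 a b
  rw [Matrix.smul_apply, Matrix.smul_apply, Matrix.sub_apply, Matrix.sub_apply, Matrix.smul_apply,
    Matrix.smul_apply, Matrix.mul_apply (M := (flipZero k : Blk N n S)),
    Matrix.mul_apply (N := (flipZero k : Blk N n S))]
  simp only [e1, e2, flipZero_apply, ← atFactor_mul, ← atFactor_sum, ← atFactor_smul,
    ← atFactor_sub]
  refine congrArg (atFactor k) ?_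
  ext i j
  rw [Matrix.smul_apply, Matrix.smul_apply, Matrix.sub_apply, Matrix.sub_apply, Matrix.smul_apply,
    Matrix.smul_apply]
  have f1 : (∑ c, Matrix.single c a (1 : S) * (Matrix.scalar (Fin N) (t c b) * s)) i j =
      t i b * s a j := by
    rw [Matrix.sum_apply, Finset.sum_eq_single i]
    · simp [Matrix.scalar_apply, Matrix.diagonal_mul]
    · intro c _ hc
      rw [Matrix.single_mul_apply_of_ne _ _ _ _ _ hc.symm]
    · simp
  have f2 : (∑ c, s * Matrix.scalar (Fin N) (t a c) * Matrix.single b c (1 : S)) i j =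
      s i b * t a j := by
    rw [Matrix.sum_apply, Finset.sum_eq_single j]
    · simp [Matrix.scalar_apply, Matrix.mul_diagonal]
    · intro c _ hc
      rw [Matrix.mul_single_apply_of_ne _ _ _ _ _ hc.symm]
    · simp
  rw [f1, f2]
  simpa [Matrix.scalar_apply, Matrix.diagonal_mul, Matrix.mul_diagonal] using h a b i j

/-! ### Central operators -/

/-- The operators with central matrix elements. -/
def centralOps (N n : ℕ) (K S : Type) [Ring S] [CommRing K] [Algebra K S] :
    Subalgebra K (Blk N n S) where
  carrier := {E | ∀ a b I J x, Commute (E a b I J) x}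
  mul_mem' := by
    intro E F hE hF a b I J x
    rw [Matrix.mul_apply, Matrix.sum_apply]
    refine Commute.sum_left _ _ _ fun c _ => ?_
    rw [Matrix.mul_apply]
    exact Commute.sum_left _ _ _ fun L _ => (hE _ _ _ _ _).mul_left (hF _ _ _ _ _)
  add_mem' := by
    intro E F hE hF a b I J x
    exact (hE _ _ _ _ _).add_left (hF _ _ _ _ _)
  algebraMap_mem' := by
    intro r a b I J x
    rw [Matrix.algebraMap_matrix_apply]
    split_ifs
    · rw [Matrix.algebraMap_matrix_apply]
      split_ifs
      · exact Algebra.commutes r x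
      · exact Commute.zero_left x
    · exact Commute.zero_left x

theorem flipZero_mem (k : Fin n) : (flipZero k : Blk N n S) ∈ centralOps N n K S := by
  intro a b I J x
  rw [flipZero_apply, atFactor_apply, Matrix.single_apply]
  split_ifs
  · exact Commute.one_left x
  · exact Commute.zero_left x
  · exact Commute.zero_left x

theorem rOp_mem (k : Fin n) (g q : K) : (rOp k g q : Blk N n S) ∈ centralOps N n K S :=
  Subalgebra.smul_mem _ (sub_mem (one_mem _) (Subalgebra.smul_mem _ (flipZero_mem k) _)) _

theorem commute_onRest_rOp {k l : Fin n} (hkl : k ≠ l) (g q : K) (s : Matrix (Fin N) (Fin N) S) :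
    Commute (rOp k g q : Blk N n S) (onRest (atFactor l s)) := by
  have : Commute (flipZero k : Blk N n S) (onRest (atFactor l s)) := by
    ext1 a b
    rw [onRest_mul_apply, mul_onRest_apply]
    refine (atFactor_commute hkl fun _ _ _ _ => ?_).eq
    rw [Matrix.single_apply]
    split_ifs
    · exact Commute.one_left _
    · exact Commute.zero_left _
  exact ((Commute.one_left _).sub_left (this.smul_left q)).smul_left g

end Blocks

/-! ### Exchange relations for ordered products -/

section Exchange

/-- Operators attached to different factors commute, so only the pair closest to `t` has to be
exchanged at each step. This is why the products of the `R i` and `R' i` run in the order opposite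
to that of the `T i`. -/
theorem exchange_prod {E α : Type} [Ring E] (R R' T : α → E) (t : E)
    (hR : ∀ i j, i ≠ j → Commute (R i) (T j)) (hR' : ∀ i j, i ≠ j → Commute (R' i) (T j))
    (h : ∀ i, R i * t * T i = T i * t * R' i) (l : List α) (hl : l.Nodup) :
    (l.reverse.map R).prod * t * (l.map T).prod = (l.map T).prod * t * (l.reverse.map R').prod := by
  induction l with
  | nil => simp
  | cons i l ih =>
    rw [List.nodup_cons] at hl
    have c1 : Commute (l.reverse.map R).prod (T i) := by
      refine Commute.list_prod_left _ _ fun x hx => ?_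
      obtain ⟨j, hj, rfl⟩ := List.mem_map.1 hx
      exact hR _ _ fun hji => hl.1 (hji ▸ List.mem_reverse.1 hj)
    have c2 : Commute (R' i) (l.map T).prod := by
      refine Commute.list_prod_right _ _ fun x hx => ?_
      obtain ⟨j, hj, rfl⟩ := List.mem_map.1 hx
      exact hR' _ _ fun hji => hl.1 (hji ▸ hj)
    simp only [List.reverse_cons, List.map_append, List.prod_append, List.map_cons, List.map_nil,
      List.prod_cons, List.prod_nil, mul_one]
    calc _ = (l.reverse.map R).prod * (R i * t * T i) * (l.map T).prod := by simp only [mul_assoc]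
      _ = ((l.reverse.map R).prod * T i) * t * (R' i * (l.map T).prod) := by
        rw [h]; simp only [mul_assoc]
      _ = T i * ((l.reverse.map R).prod * t * (l.map T).prod) * R' i := by
        rw [c1.eq, c2.eq]; simp only [mul_assoc]
      _ = _ := by rw [ih hl.2]; simp only [mul_assoc]

theorem prod_mul_prod_reverse {E α : Type} [Monoid E] (A B : α → E) (h : ∀ i, A i * B i = 1)
    (l : List α) : (l.map A).prod * (l.reverse.map B).prod = 1 := by
  induction l with
  | nil => simp
  | cons i l ih =>
    simp only [List.reverse_cons, List.map_append, List.prod_append, List.map_cons, List.map_nil,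
      List.prod_cons, List.prod_nil, mul_one]
    calc _ = A i * ((l.map A).prod * (l.reverse.map B).prod) * B i := by simp only [mul_assoc]
      _ = 1 := by rw [ih, mul_one, h]

end Exchange

/-! ### Fusion of ordered products of R-matrices behind symmetrizers -/

section Fusion

variable {N n : ℕ} {S : Type} [Ring S] {K : Type} [CommRing K] [Algebra K S]

/-- A block operator absorbs the transpositions of the factors in `s` up to the sign `e`. -/
def BlkAbsorbs (e : K) (s : Set (Fin n)) (Θ : Blk N n S) : Prop :=
  ∀ i ∈ s, ∀ j ∈ s, i ≠ j → Θ * onRest (permOp (Equiv.swap i j)) = e • Θ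

theorem BlkAbsorbs.mul {e : K} {s : Set (Fin n)} {Θ X : Blk N n S} (hΘ : BlkAbsorbs e s Θ)
    (hX : ∀ i ∈ s, ∀ j ∈ s, Commute X (onRest (permOp (Equiv.swap i j)))) :
    BlkAbsorbs e s (Θ * X) := by
  intro i hi j hj hij
  rw [mul_assoc, (hX i hi j hj).eq, ← mul_assoc, hΘ i hi j hj hij, smul_mul_assoc]

theorem commute_flipZero {i j k : Fin n} (hi : k ≠ i) (hj : k ≠ j) :
    Commute (flipZero k : Blk N n S) (onRest (permOp (Equiv.swap i j))) := by
  rw [commute_iff_eq, onRest_atFactor_flipZero, Equiv.swap_apply_of_ne_of_ne hi hj]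

theorem commute_sum_flipZero (σ : Equiv.Perm (Fin n)) :
    Commute (∑ k, flipZero k : Blk N n S) (onRest (permOp σ)) := by
  rw [commute_iff_eq, Finset.mul_sum, Finset.sum_mul]
  simp only [onRest_atFactor_flipZero]
  exact (Equiv.sum_comp σ fun k => (flipZero k : Blk N n S) * onRest (permOp σ)).symm

theorem commute_onZero (t : Matrix (Fin N) (Fin N) S) (X : Matrix (Fin n → Fin N) (Fin n → Fin N) S)
    (h : ∀ I J x, Commute (X I J) x) : Commute (onZero t : Blk N n S) (onRest X) := by
  ext a b I J
  rw [onRest_mul_apply, mul_onRest_apply, onZero_apply, Matrix.scalar_apply, Matrix.diagonal_mul,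
    Matrix.mul_diagonal, (h I J _).eq]

theorem permOp_central (σ : Equiv.Perm (Fin n)) (I J : Fin n → Fin N) (x : S) :
    Commute ((permOp σ : Matrix _ _ S) I J) x := by
  rw [permOp_apply]
  split_ifs
  · exact Commute.one_left x
  · exact Commute.zero_left x

/-- The condition on `q` says that 1/q_a = 1/κ - e(k - 1 - a), that is, the spectral parameters form
an arithmetic progression with step e. Expanding the product gives terms with several flips;
absorption reduces each of them to a single flip, and the progression is what makes all the
coefficients equal to κ. -/
theorem fusion (e : K) (k : ℕ) : ∀ (j : Fin k → Fin n) (_ : Function.Injective j) (g q : Fin k → K)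
    (κ : K) (_ : ∀ a, q a * (1 - e * ((k : K) - 1 - (a : ℕ)) * κ) = κ) (Θ : Blk N n S)
    (_ : BlkAbsorbs e (Set.range j) Θ),
    Θ * (List.ofFn fun a => rOp (j a) (g a) (q a)).prod =
      (∏ a, g a) • (Θ * (1 - κ • ∑ a, flipZero (j a))) := by
  induction k with
  | zero => intro j _ g q κ _ Θ _; simp
  | succ k ih =>
    intro j hj g q κ hq Θ hΘ
    -- After multiplication by the first R-matrix only the transpositions of the remaining factors
    -- are still absorbed. The induction therefore needs a set of factors that shrinks.
    have hΘ' : BlkAbsorbs e (Set.range (j ∘ Fin.succ)) (Θ * rOp (j 0) (g 0) (q 0)) := by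
      refine BlkAbsorbs.mul (fun i hi l hl => hΘ i ?_ l ?_) ?_
      · exact Set.range_comp_subset_range _ _ hi
      · exact Set.range_comp_subset_range _ _ hl
      · rintro _ ⟨a, rfl⟩ _ ⟨b, rfl⟩
        have ha : ∀ c : Fin k, j 0 ≠ j c.succ := fun c h => Fin.succ_ne_zero c (hj h).symm
        exact (((Commute.one_left _).sub_left
          ((commute_flipZero (ha a) (ha b)).smul_left (q 0))).smul_left (g 0))
    have hIH := ih (j ∘ Fin.succ) (hj.comp (Fin.succ_injective k)) (g ∘ Fin.succ) (q ∘ Fin.succ) κ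
      (fun a => by
        have := hq a.succ
        rw [Fin.val_succ] at this
        push_cast at this
        rw [Function.comp_apply]
        linear_combination this) _ hΘ'
    simp only [Function.comp_apply] at hIH
    rw [List.ofFn_succ, List.prod_cons, ← mul_assoc, hIH, Fin.prod_univ_succ, Fin.sum_univ_succ]
    -- P₀Pₐ is a transposition times P₀, and Θ swallows the transposition at the cost of e.
    have key : Θ * flipZero (j 0) * ∑ a : Fin k, flipZero (j a.succ) =
        ((k : K) * e) • (Θ * flipZero (j 0)) := by
      have hc : ∀ Y : Blk N n S, k • Y = ∑ _a : Fin k, Y := fun Y => by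
        rw [Finset.sum_const, Finset.card_fin]
      rw [Finset.mul_sum, mul_smul, Nat.cast_smul_eq_nsmul, hc]
      refine Finset.sum_congr rfl fun a _ => ?_
      have hne : j a.succ ≠ j 0 := fun h => Fin.succ_ne_zero a (hj h)
      rw [mul_assoc, flipZero_mul_flipZero hne, ← mul_assoc,
        hΘ _ ⟨_, rfl⟩ _ ⟨_, rfl⟩ hne, smul_mul_assoc]
    have h0 := hq 0
    push_cast [Fin.val_zero] at h0
    rw [rOp, mul_comm (g 0), mul_smul]
    congr 1
    rw [mul_smul_comm, smul_mul_assoc]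
    congr 1
    -- This is the parameter condition for a = 0: the contribution of the k mixed terms corrects the
    -- coefficient q₀ of the first flip to κ.
    have h1 : κ = q 0 - q 0 * κ * (k * e) := by linear_combination -h0
    have h2 : Θ * (1 - q 0 • flipZero (j 0)) * (1 - κ • ∑ a : Fin k, flipZero (j a.succ)) =
        Θ - q 0 • (Θ * flipZero (j 0)) - κ • (Θ * ∑ a : Fin k, flipZero (j a.succ)) +
        (q 0 * κ) • (Θ * flipZero (j 0) * ∑ a : Fin k, flipZero (j a.succ)) := by
      simp only [mul_sub, sub_mul, mul_one, mul_smul_comm, smul_mul_assoc]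
      module
    rw [h2, key, mul_sub, mul_one, mul_smul_comm, mul_add, smul_add]
    generalize Θ * flipZero (j 0) = Y
    generalize Θ * ∑ a : Fin k, flipZero (j a.succ) = W
    rw [smul_smul]
    have h3 : κ • Y = (q 0) • Y - (q 0 * κ * (k * e)) • Y := by rw [← sub_smul, ← h1]
    rw [h3]
    abel

/-- `X` acts on the right of absorbing operators as `c (1 - κ ∑ P)`. -/
def Fused (e : K) (X : Blk N n S) : Prop :=
  ∃ c κ : K, ∀ Θ : Blk N n S, BlkAbsorbs e Set.univ Θ →
    Θ * X = c • (Θ * (1 - κ • ∑ k, flipZero k))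

theorem fused_ofFn (e : K) (j : Fin n → Fin n) (hj : Function.Injective j) (g q : Fin n → K)
    (κ : K) (hq : ∀ a, q a * (1 - e * ((n : K) - 1 - (a : ℕ)) * κ) = κ) :
    Fused e (List.ofFn fun a => (rOp (j a) (g a) (q a) : Blk N n S)).prod := by
  refine ⟨∏ a, g a, κ, fun Θ hΘ => ?_⟩
  rw [fusion e n j hj g q κ hq Θ fun i _ l _ => hΘ i trivial l trivial]
  have hsum := (Equiv.ofBijective j (Finite.injective_iff_bijective.1 hj)).sum_comp
    fun k => (flipZero k : Blk N n S)
  simp only [Equiv.ofBijective_apply] at hsum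
  rw [hsum]

/-- The sum of all flips with the additional factor is invariant under conjugation by the symmetric
group of the tensor power. -/
theorem Fused.absorbs {e : K} {X Θ : Blk N n S} (hX : Fused e X)
    (hΘ : BlkAbsorbs e Set.univ Θ) : BlkAbsorbs e Set.univ (Θ * X) := by
  obtain ⟨c, κ, h⟩ := hX
  rw [h Θ hΘ, ← mul_smul_comm]
  exact hΘ.mul fun i _ j _ =>
    ((Commute.one_left _).sub_left ((commute_sum_flipZero _).smul_left κ)).smul_left c

/-- Both operators act as linear polynomials in the same element ∑ P, first on Θ and then again on
the result, which still absorbs. -/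
theorem Fused.comm {e : K} {X Y Θ : Blk N n S} (hX : Fused e X) (hY : Fused e Y)
    (hΘ : BlkAbsorbs e Set.univ Θ) : Θ * X * Y = Θ * Y * X := by
  have h1 := hX.absorbs hΘ
  have h2 := hY.absorbs hΘ
  obtain ⟨c, κ, h⟩ := hX
  obtain ⟨c', κ', h'⟩ := hY
  rw [h' _ h1, h _ h2, h _ hΘ, h' _ hΘ]
  simp only [mul_sub, sub_mul, mul_one, mul_smul_comm, smul_mul_assoc, smul_sub, smul_smul]
  module

end Fusion

/-! ### Crossing symmetry through partial transposition -/

section Crossing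

variable {N n : ℕ} {S : Type} [Ring S] {K : Type} [CommRing K] [Algebra K S]

/-- `∑ s' a' ⊗ a'' s'' = 1` in terms of matrix blocks. -/
def Crossed (s a : Blk N n S) : Prop := s.transpose * a.transpose = 1

/-- All blocks of `E` commute with all blocks of `F`. -/
def BlocksCommute (E F : Blk N n S) : Prop := ∀ a b c d, Commute (E a b) (F c d)

/-- `transpose` acts on the outer matrix only and leaves the blocks alone, so it is the partial
transposition in the additional factor. It reverses products only when the blocks commute with each
other. -/
theorem BlocksCommute.transpose_mul {E F : Blk N n S} (h : BlocksCommute E F) :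
    (E * F).transpose = F.transpose * E.transpose := by
  ext1 a b
  rw [Matrix.transpose_apply, Matrix.mul_apply, Matrix.mul_apply]
  exact Finset.sum_congr rfl fun c _ => (h _ _ _ _).eq

theorem BlocksCommute.list_prod {α : Type} {E : Blk N n S} {F : α → Blk N n S} {l : List α}
    (h : ∀ i ∈ l, BlocksCommute E (F i)) : BlocksCommute E (l.map F).prod := by
  induction l with
  | nil =>
    intro a b c d
    rw [List.map_nil, List.prod_nil, Matrix.one_apply]
    split_ifs
    · exact Commute.one_right _
    · exact Commute.zero_right _
  | cons i l ih =>
    intro a b c d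
    rw [List.map_cons, List.prod_cons, Matrix.mul_apply]
    exact Commute.sum_right _ _ _ fun x _ => (h i (by simp) _ _ _ _).mul_right
      (ih (fun j hj => h j (by simp [hj])) _ _ _ _)

theorem BlocksCommute.symm {E F : Blk N n S} (h : BlocksCommute E F) : BlocksCommute F E :=
  fun a b c d => (h c d a b).symm

theorem blocksCommute_rOp {k l : Fin n} (hkl : k ≠ l) (g q g' q' : K) :
    BlocksCommute (rOp k g q : Blk N n S) (rOp l g' q') := by
  have h : ∀ (k : Fin n) (g q : K) (a b : Fin N), (rOp k g q : Blk N n S) a b =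
      atFactor k (g • ((if a = b then 1 else 0) - q • Matrix.single b a (1 : S))) := by
    intro k g q a b
    rw [rOp, Matrix.smul_apply, Matrix.sub_apply, Matrix.smul_apply, flipZero_apply,
      Matrix.one_apply, atFactor_smul, atFactor_sub, atFactor_smul]
    split_ifs
    · rw [atFactor_one]
    · rw [atFactor_zero]
  intro a b c d
  rw [h, h]
  refine atFactor_commute hkl fun i j i' j' => ?_
  rw [Matrix.smul_apply, Matrix.smul_apply]
  refine Commute.smul_left (Commute.smul_right ?_ _) _
  rw [Matrix.sub_apply, Matrix.sub_apply, Matrix.smul_apply, Matrix.smul_apply]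
  have c1 : ∀ (a b i j : Fin N) (x : S), Commute ((if a = b then (1 : Matrix (Fin N) (Fin N) S) else 0) i j) x := by
    intro a b i j x
    split_ifs
    · rw [Matrix.one_apply]
      split_ifs
      · exact Commute.one_left x
      · exact Commute.zero_left x
    · exact Commute.zero_left x
  have c2 : ∀ (a b i j : Fin N) (x : S) (q : K), Commute (q • Matrix.single a b (1 : S) i j) x := by
    intro a b i j x q
    rw [Matrix.single_apply]
    split_ifs
    · exact (Commute.one_left x).smul_left q
    · exact (Commute.zero_left x).smul_left q
  exact (c1 _ _ _ _ _).sub_left (c2 _ _ _ _ _ _)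

/-- Partial transposition reverses both products. With the `s i` and the `a i` in opposite orders,
the transposed pairs are nested, and they cancel from the inside out. -/
theorem crossed_prod {α : Type} (s a : α → Blk N n S) (h : ∀ i, Crossed (s i) (a i))
    (hs : ∀ i j, i ≠ j → BlocksCommute (s i) (s j)) (ha : ∀ i j, i ≠ j → BlocksCommute (a i) (a j))
    (l : List α) (hl : l.Nodup) : Crossed (l.reverse.map s).prod (l.map a).prod := by
  induction l with
  | nil =>
    simp [Crossed]
  | cons i l ih =>
    rw [List.nodup_cons] at hl
    have h1 : BlocksCommute (a i) (l.map a).prod := BlocksCommute.list_prod fun j hj =>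
      ha _ _ fun hij => hl.1 (hij ▸ hj)
    have h2 : BlocksCommute (s i) (l.reverse.map s).prod := BlocksCommute.list_prod fun j hj =>
      hs _ _ fun hij => hl.1 (hij ▸ List.mem_reverse.1 hj)
    simp only [List.reverse_cons, List.map_append, List.prod_append, List.map_cons, List.map_nil,
      List.prod_cons, List.prod_nil, mul_one]
    rw [Crossed, h1.transpose_mul, h2.symm.transpose_mul]
    calc _ = (s i).transpose * ((l.reverse.map s).prod.transpose * (l.map a).prod.transpose) *
          (a i).transpose := by simp only [mul_assoc]
      _ = 1 := by
        have := ih hl.2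
        rw [Crossed] at this
        rw [this, mul_one]
        exact h i

/-- The partial transpose K of a flip satisfies K² = N K. Hence (1 - qK)(1 - q'K) = 1 - (q + q' - N
q q') K. -/
theorem crossed_rOp (k : Fin n) {g q g' q' : K} (hg : g * g' = 1) (hq : q + q' = N * q * q') :
    Crossed (rOp k g q : Blk N n S) (rOp k g' q') := by
  have hK : ((flipZero k : Blk N n S).transpose * (flipZero k).transpose) =
      (N : K) • (flipZero k).transpose := by
    ext1 a b
    rw [Matrix.mul_apply, Matrix.smul_apply, Nat.cast_smul_eq_nsmul]
    simp only [Matrix.transpose_apply, flipZero_apply, ← atFactor_mul,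
      Matrix.single_mul_single_same, mul_one]
    rw [Finset.sum_const, Finset.card_fin]
  rw [Crossed, rOp, rOp, Matrix.transpose_smul, Matrix.transpose_smul, Matrix.transpose_sub,
    Matrix.transpose_sub, Matrix.transpose_smul, Matrix.transpose_smul, Matrix.transpose_one,
    smul_mul_smul_comm, hg, one_smul, sub_mul, mul_sub, mul_sub, mul_one, one_mul, mul_one,
    smul_mul_smul_comm, hK, smul_smul]
  have : (q * q' * N) • (flipZero k : Blk N n S).transpose =
      q • (flipZero k : Blk N n S).transpose + q' • (flipZero k : Blk N n S).transpose := by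
    rw [← add_smul, hq]
    congr 1
    ring
  rw [this]
  abel

end Crossing

/-! ### Partial traces and the invariance argument in abstract form -/

section Trace

variable {N n : ℕ} {S : Type} [Ring S] {K : Type} [CommRing K] [Algebra K S]

theorem trace_mul_comm_of_commute {ι : Type} [Fintype ι] {Y Z : Matrix ι ι S}
    (h : ∀ i j k l, Commute (Y i j) (Z k l)) : Matrix.trace (Y * Z) = Matrix.trace (Z * Y) := by
  simp only [Matrix.trace, Matrix.diag_apply, Matrix.mul_apply]
  rw [Finset.sum_comm]
  exact Finset.sum_congr rfl fun i _ => Finset.sum_congr rfl fun j _ => (h _ _ _ _).eq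

/-- The partial trace over the tensor power. -/
def ptr (E : Blk N n S) : Matrix (Fin N) (Fin N) S := Matrix.of fun a b => Matrix.trace (E a b)

theorem ptr_onZero_mul (t : Matrix (Fin N) (Fin N) S) (E : Blk N n S) :
    ptr (onZero t * E) = t * ptr E := by
  ext a b
  rw [ptr, Matrix.of_apply, Matrix.mul_apply, Matrix.mul_apply, Matrix.trace_sum]
  refine Finset.sum_congr rfl fun c _ => ?_
  rw [onZero_apply, Matrix.scalar_apply, Matrix.trace, ptr, Matrix.of_apply, Matrix.trace,
    Finset.mul_sum]
  refine Finset.sum_congr rfl fun I _ => ?_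
  rw [Matrix.diag_apply, Matrix.diag_apply, Matrix.diagonal_mul]

variable {e : K} {Q : Matrix (Fin n → Fin N) (Fin n → Fin N) S}

theorem Absorbs.onRest {Θ : Matrix (Fin n → Fin N) (Fin n → Fin N) S}
    (hΘ : Absorbs e Set.univ Θ) : BlkAbsorbs e Set.univ (onRest Θ : Blk N n S) := by
  intro i hi j hj hij
  rw [← map_mul, hΘ i hi j hj hij]
  ext1 a b
  simp only [RTT.onRest, Matrix.scalar_apply, Matrix.smul_apply, Matrix.diagonal_apply]
  split_ifs <;> simp

theorem BlkAbsorbs.mul_left {Θ : Blk N n S} (hΘ : BlkAbsorbs e Set.univ Θ) (E : Blk N n S) :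
    BlkAbsorbs e Set.univ (E * Θ) := by
  intro i hi j hj hij
  rw [mul_assoc, hΘ i hi j hj hij, mul_smul_comm]

theorem IsSymm.blkAbsorbs (hQ : IsSymm e Q) : BlkAbsorbs e Set.univ (onRest Q : Blk N n S) :=
  hQ.right.onRest

theorem IsSymm.blk_absorb (hQ : IsSymm e Q) {Θ : Blk N n S} (hΘ : BlkAbsorbs e Set.univ Θ) :
    Θ * onRest Q = Θ := by
  ext1 a b
  rw [mul_onRest_apply]
  refine hQ.absorb _ fun i hi j hj hij => ?_
  have := hΘ i hi j hj hij
  have := congrFun (congrFun this a) b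
  rwa [mul_onRest_apply] at this

/-- Under the trace over the tensor power, Q makes it possible to bring `A` around to the right of
`s`, block by block. The sum over the inner index of the additional factor is then an entry of the
product in `Crossed`. -/
theorem ptr_crossed (hQ : IsSymm e Q) {X : Matrix (Fin n → Fin N) (Fin n → Fin N) S}
    (hX : Absorbs e Set.univ (Q * X)) {A s : Blk N n S} (hA : A ∈ centralOps N n K S)
    (hAf : Fused e A) (hsf : Fused e s) (h : Crossed s A) :
    ptr (onRest Q * A * onRest X * s) = Matrix.scalar (Fin N) (Matrix.trace (Q * X)) := by
  have hQX : BlkAbsorbs e Set.univ (onRest (Q * X) : Blk N n S) := hX.onRest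
  have h1 := hQ.blk_absorb (hAf.absorbs hQ.blkAbsorbs)
  have h2 := hQ.blk_absorb (hsf.absorbs hQX)
  ext p r
  -- A second copy of Q is inserted by idempotence and moved next to X through the absorbing
  -- operator QA. Cyclicity of the trace is legitimate because QA has central entries.
  have key : ∀ c, Matrix.trace (Q * A p c * X * s c r) = Matrix.trace (Q * X * (s c r * A p c)) := by
    intro c
    have h1' := congrFun (congrFun h1 p) c
    rw [mul_onRest_apply, onRest_mul_apply] at h1'
    have h2' := congrFun (congrFun h2 c) r
    rw [mul_onRest_apply, onRest_mul_apply] at h2'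
    have hc : ∀ i j k l, Commute ((Q * A p c) i j) ((Q * X * s c r) k l) := by
      intro i j k l
      rw [Matrix.mul_apply]
      exact Commute.sum_left _ _ _ fun L _ => (hQ.central _ _ _).mul_left (hA _ _ _ _ _)
    calc _ = Matrix.trace ((Q * A p c) * (Q * X * s c r)) := by
          rw [← h1']; simp only [mul_assoc]
          congr 3
          have := hQ.absorb Q hQ.right
          rw [← mul_assoc Q Q, this]
      _ = Matrix.trace ((Q * X * s c r) * (Q * A p c)) := trace_mul_comm_of_commute hc
      _ = _ := by rw [← mul_assoc, h2']; simp only [mul_assoc]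
  rw [ptr, Matrix.of_apply, Matrix.mul_apply, Matrix.trace_sum]
  simp only [mul_onRest_apply, onRest_mul_apply, key]
  rw [← Matrix.trace_sum, ← Finset.mul_sum]
  have h' := congrFun (congrFun h r) p
  rw [Matrix.mul_apply] at h'
  simp only [Matrix.transpose_apply] at h'
  rw [h', Matrix.one_apply, Matrix.scalar_apply, Matrix.diagonal_apply]
  split_ifs with h3 h4 h4
  · rw [mul_one]
  · exact absurd h3.symm h4
  · exact absurd h4.symm h3
  · rw [mul_zero, Matrix.trace_zero]

/-- `I` is only a left ideal. A factor on the right is harmless as its central entries can be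
written on the left. -/
theorem ptr_mem_of_mem (I : Ideal S) (E F : Blk N n S) (t : Matrix (Fin N) (Fin N) S)
    (ht : ∀ a b, t a b ∈ I) (hF : F ∈ centralOps N n K S) (a b : Fin N) :
    ptr (E * onZero t * F) a b ∈ I := by
  have h1 : ∀ a b I' J, (E * onZero t : Blk N n S) a b I' J ∈ I := by
    intro a b I' J
    rw [Matrix.mul_apply, Matrix.sum_apply]
    refine sum_mem fun c _ => ?_
    rw [onZero_apply, Matrix.scalar_apply, Matrix.mul_diagonal]
    exact I.mul_mem_left _ (ht _ _)
  rw [ptr, Matrix.of_apply, Matrix.trace]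
  refine sum_mem fun L _ => ?_
  rw [Matrix.diag_apply, Matrix.mul_apply, Matrix.sum_apply]
  refine sum_mem fun c _ => ?_
  rw [Matrix.mul_apply]
  refine sum_mem fun L' _ => ?_
  rw [← (hF c b L' L _).eq]
  exact I.mul_mem_left _ (h1 _ _ _ _)

/-- The relations `hα`, `hβ`, `hγ`, `hδ` move t and t' through T and T'. The right-hand operator of
`hδ` is the inverse of that of `hα`, and those of `hβ` and `hγ` are inverse to each other, so all
inner R-matrices cancel once `α₂` and `γ₂` have been interchanged. Crossing then removes the outer
ones. -/
theorem reflection_trace (I : Ideal S) (hQ : IsSymm e Q)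
    {T T' Tinv : Matrix (Fin n → Fin N) (Fin n → Fin N) S} (hT' : T' * Tinv = 1)
    (hTinv : Tinv * T' = 1)
    (hQT : Absorbs e Set.univ (Q * T)) (hQX : Absorbs e Set.univ (Q * (T * Tinv)))
    {t t' tinv : Matrix (Fin N) (Fin N) S} (ht' : t' * tinv = 1) (htinv : tinv * t' = 1)
    (ht1 : ∀ a b, (t * tinv - 1) a b ∈ I)
    {α₁ α₁' α₂ α₂' β₁ β₁' β₂ γ₁ γ₁' γ₂ δ₁ δ₁' : Blk N n S}
    (hα₁ : α₁' * α₁ = 1) (hα₂ : α₂ * α₂' = 1) (hβ₁ : β₁' * β₁ = 1) (hβ₂ : β₂ * γ₂ = 1)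
    (hγ₁ : γ₁ * γ₁' = 1) (hδ₁ : δ₁ * δ₁' = 1)
    (hα : α₁ * onZero t * onRest T = onRest T * onZero t * α₂)
    (hβ : β₁ * onZero t' * onRest T = onRest T * onZero t' * β₂)
    (hγ : γ₁ * onZero t * onRest T' = onRest T' * onZero t * γ₂)
    (hδ : δ₁ * onZero t' * onRest T' = onRest T' * onZero t' * α₂')
    (fα₁ : Fused e α₁') (fα₂ : Fused e α₂) (fγ₂ : Fused e γ₂) (fγ₁ : Fused e γ₁)
    (fγ₁' : Fused e γ₁') (fδ₁ : Fused e δ₁') (fβ₁ : Fused e β₁')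
    (cα₁ : α₁' ∈ centralOps N n K S) (cγ₁' : γ₁' ∈ centralOps N n K S)
    (cδ₁ : δ₁' ∈ centralOps N n K S) (cβ₁ : β₁' ∈ centralOps N n K S)
    (x₁ : Crossed γ₁' β₁') (x₂ : Crossed δ₁' α₁') (a b : Fin N) :
    (t * tinv) a b * Matrix.trace (Q * (T * Tinv)) -
      (if a = b then Matrix.trace (Q * (T * Tinv)) else 0) ∈ I := by
  have hz : (onZero tinv * onZero t' : Blk N n S) = 1 := by rw [← map_mul, htinv, map_one]
  have hz' : (onZero t' * onZero tinv : Blk N n S) = 1 := by rw [← map_mul, ht', map_one]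
  have hr : (onRest T' * onRest Tinv : Blk N n S) = 1 := by rw [← map_mul, hT', map_one]
  have hr' : (onRest Tinv * onRest T' : Blk N n S) = 1 := by rw [← map_mul, hTinv, map_one]
  -- The relation for t' is conjugated into one for t'⁻¹, with β₂⁻¹ = γ₂ on the right. In `E4` below
  -- the relation for t' and T' is inverted in the same way.
  have E2 : onZero tinv * β₁' * onRest T = onRest T * γ₂ * onZero tinv := by
    calc _ = onZero tinv * β₁' * onRest T * onZero t' * (β₂ * γ₂) * onZero tinv := by
          rw [hβ₂, mul_one, mul_assoc _ (onZero t'), hz', mul_one]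
      _ = onZero tinv * β₁' * (onRest T * onZero t' * β₂) * γ₂ * onZero tinv := by
          simp only [mul_assoc]
      _ = onZero tinv * (β₁' * β₁) * onZero t' * onRest T * γ₂ * onZero tinv := by
          rw [← hβ]; simp only [mul_assoc]
      _ = _ := by rw [hβ₁, mul_one, hz, one_mul]
  have E4 : onZero tinv * onRest Tinv = α₂' * onRest Tinv * onZero tinv * δ₁' := by
    calc _ = onZero tinv * onRest Tinv * (δ₁ * (onZero t' * (onRest T' * onRest Tinv) *
            onZero tinv) * δ₁') := by
          rw [hr, mul_one, hz', mul_one, hδ₁, mul_one]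
      _ = onZero tinv * onRest Tinv * (δ₁ * onZero t' * onRest T') * onRest Tinv *
            onZero tinv * δ₁' := by simp only [mul_assoc]
      _ = onZero tinv * (onRest Tinv * onRest T') * onZero t' * α₂' * onRest Tinv *
            onZero tinv * δ₁' := by rw [hδ]; simp only [mul_assoc]
      _ = _ := by rw [hr', mul_one, hz, one_mul]
  have E1 : onZero t * onRest T = α₁' * onRest T * onZero t * α₂ := by
    calc _ = α₁' * α₁ * onZero t * onRest T := by rw [hα₁, one_mul]
      _ = α₁' * (α₁ * onZero t * onRest T) := by simp only [mul_assoc]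
      _ = _ := by rw [hα]; simp only [mul_assoc]
  have E3 : onZero t * γ₂ * onRest Tinv = onRest Tinv * γ₁ * onZero t := by
    calc _ = onRest Tinv * onRest T' * onZero t * γ₂ * onRest Tinv := by rw [hr', one_mul]
      _ = onRest Tinv * (onRest T' * onZero t * γ₂) * onRest Tinv := by simp only [mul_assoc]
      _ = onRest Tinv * γ₁ * onZero t * (onRest T' * onRest Tinv) := by
          rw [← hγ]; simp only [mul_assoc]
      _ = _ := by rw [hr, mul_one]
  have aQ := hQ.blkAbsorbs
  have aα := fα₁.absorbs aQ
  have aT : BlkAbsorbs e Set.univ (onRest Q * α₁' * onRest T) := by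
    rw [← hQ.blk_absorb aα, mul_assoc, ← map_mul]
    exact hQT.onRest.mul_left _
  have aX : BlkAbsorbs e Set.univ (onRest Q * α₁' * onRest (T * Tinv)) := by
    rw [← hQ.blk_absorb aα, mul_assoc, ← map_mul]
    exact hQX.onRest.mul_left _
  have aTt : BlkAbsorbs e Set.univ (onRest Q * α₁' * onRest T * onZero t) :=
    aT.mul fun i _ j _ => commute_onZero t _ (permOp_central _)
  have main : onRest Q * onZero (t * tinv) * β₁' * onRest (T * Tinv) =
      onRest Q * α₁' * onRest (T * Tinv) * γ₁ * onZero (t * tinv) * δ₁' := by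
    rw [map_mul, map_mul]
    calc _ = onRest Q * onZero t * (onZero tinv * β₁' * onRest T) * onRest Tinv := by
          simp only [mul_assoc]
      _ = onRest Q * (onZero t * onRest T) * γ₂ * (onZero tinv * onRest Tinv) := by
          rw [E2]; simp only [mul_assoc]
      _ = (onRest Q * α₁' * onRest T * onZero t * α₂ * γ₂) * α₂' * onRest Tinv * onZero tinv *
            δ₁' := by rw [E1, E4]; simp only [mul_assoc]
      -- `α₂` and `γ₂` trade places behind the absorbing operator `aTt`; now `α₂` meets its inverse.
      _ = onRest Q * α₁' * onRest T * (onZero t * γ₂ * (α₂ * α₂') * onRest Tinv) * onZero tinv *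
            δ₁' := by rw [fα₂.comm fγ₂ aTt]; simp only [mul_assoc]
      _ = _ := by rw [hα₂, mul_one, E3]; simp only [mul_assoc]
  -- Multiplying by `γ₁'` supplies the crossing partner of `β₁'` on the left-hand side of `main`.
  have L : ptr (onRest Q * onZero (t * tinv) * β₁' * onRest (T * Tinv) * γ₁') =
      t * tinv * Matrix.scalar (Fin N) (Matrix.trace (Q * (T * Tinv))) := by
    rw [← ptr_crossed hQ hQX cβ₁ fβ₁ fγ₁' x₁, ← ptr_onZero_mul,
      ← (commute_onZero (t * tinv) Q hQ.central).eq]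
    simp only [mul_assoc]
  -- In the part with t t'⁻¹ replaced by 1, `γ₁` passes `δ₁'` and cancels against `γ₁'`. What is
  -- left contains t t'⁻¹ - 1 and falls into the ideal.
  have R : onRest Q * α₁' * onRest (T * Tinv) * γ₁ * onZero (t * tinv) * δ₁' * γ₁' =
      onRest Q * α₁' * onRest (T * Tinv) * δ₁' +
      onRest Q * α₁' * onRest (T * Tinv) * γ₁ * onZero (t * tinv - 1) * (δ₁' * γ₁') := by
    rw [map_sub, map_one, mul_sub, mul_one, sub_mul, ← mul_assoc, ← mul_assoc,
      fγ₁.comm fδ₁ aX, mul_assoc _ γ₁ γ₁', hγ₁, mul_one]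
    abel
  rw [main, R] at L
  have L' := congrFun (congrFun L a) b
  have hadd : ∀ E F : Blk N n S, ptr (E + F) = ptr E + ptr F := fun E F => by
    ext a b
    simp [ptr, Matrix.trace_add]
  rw [hadd, ptr_crossed hQ hQX cα₁ fα₁ fδ₁ x₂, Matrix.add_apply, Matrix.scalar_apply,
    Matrix.diagonal_apply, Matrix.mul_diagonal] at L'
  rw [← L', add_sub_cancel_left]
  exact ptr_mem_of_mem I _ _ _ ht1 (mul_mem cδ₁ cγ₁') a b

end Trace

/-! ### Evaluation of power series in complete filtered rings -/

section Evaluation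

open PowerSeries

/-- A complete separated filtration of a ring by two-sided ideals. -/
structure Filt (B : Type) [Ring B] where
  J : ℕ → AddSubgroup B
  mul_left : ∀ n a b, b ∈ J n → a * b ∈ J n
  mul_right : ∀ n a b, a ∈ J n → a * b ∈ J n
  sep : ∀ x, (∀ n, x ∈ J n) → x = 0
  complete : ∀ s : ℕ → B, (∀ n, s (n + 1) - s n ∈ J n) → ∃ b, ∀ n, b - s n ∈ J n

variable {B : Type} [Ring B]

/-- The value of the power series `f` at `z` converges to `b`. -/
def HasEval (F : Filt B) (z : B) (f : PowerSeries B) (b : B) : Prop :=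
  ∀ m, ∃ K₀, ∀ K ≥ K₀, b - (trunc K f).eval z ∈ F.J m

/-- Central topologically nilpotent elements. -/
structure Evaluable (F : Filt B) (z : B) : Prop where
  central : ∀ x, Commute z x
  nilp : ∀ m, ∃ K, z ^ K ∈ F.J m

variable {F : Filt B} {z : B}

theorem Evaluable.eval_mem (_hz : Evaluable F z) {m K : ℕ} (hK : z ^ K ∈ F.J m) {p : Polynomial B}
    (hp : ∀ k < K, p.coeff k = 0) : p.eval z ∈ F.J m := by
  rw [Polynomial.eval_eq_sum, Polynomial.sum]
  refine sum_mem fun k _ => ?_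
  by_cases hk : k < K
  · rw [hp k hk, zero_mul]
    exact zero_mem _
  · obtain ⟨d, rfl⟩ := Nat.exists_eq_add_of_le (not_lt.1 hk)
    rw [pow_add]
    exact F.mul_left _ _ _ (F.mul_right _ _ _ hK)

theorem Evaluable.trunc_sub_mem (hz : Evaluable F z) {m K L L' : ℕ} (hK : z ^ K ∈ F.J m)
    (hL : K ≤ L) (hL' : K ≤ L') (f : PowerSeries B) :
    (trunc L f).eval z - (trunc L' f).eval z ∈ F.J m := by
  rw [← Polynomial.eval_sub]
  refine hz.eval_mem hK fun k hk => ?_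
  rw [Polynomial.coeff_sub, coeff_trunc, coeff_trunc, if_pos (by omega), if_pos (by omega), sub_self]

theorem HasEval.unique {f : PowerSeries B} {b b' : B} (h : HasEval F z f b)
    (h' : HasEval F z f b') : b = b' := by
  rw [← sub_eq_zero]
  refine F.sep _ fun m => ?_
  obtain ⟨K, hK⟩ := h m
  obtain ⟨K', hK'⟩ := h' m
  have := sub_mem (hK (max K K') (le_max_left _ _)) (hK' (max K K') (le_max_right _ _))
  rwa [sub_sub_sub_cancel_right] at this

theorem Evaluable.exists_hasEval (hz : Evaluable F z) (f : PowerSeries B) :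
    ∃ b, HasEval F z f b := by
  choose e he using hz.nilp
  -- Summing the exponents e 0, …, e m yields truncation orders which increase with m and dominate
  -- each individual exponent.
  have he' : ∀ m, ∀ i ≤ m, e i ≤ ∑ j ∈ Finset.range (m + 1), e j := fun m i hi =>
    Finset.single_le_sum (f := e) (fun _ _ => Nat.zero_le _)
      (Finset.mem_range.2 (Nat.lt_succ_of_le hi))
  obtain ⟨b, hb⟩ := F.complete
    (fun m => (trunc (∑ j ∈ Finset.range (m + 1), e j) f).eval z)
    (fun m => hz.trunc_sub_mem (he m) (he' _ _ m.le_succ) (he' _ _ le_rfl) f)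
  refine ⟨b, fun m => ⟨e m, fun K hK => ?_⟩⟩
  have := add_mem (hb m) (hz.trunc_sub_mem (he m) (he' m m le_rfl) hK f)
  rwa [sub_add_sub_cancel] at this

theorem HasEval.add {f g : PowerSeries B} {b c : B} (hf : HasEval F z f b)
    (hg : HasEval F z g c) : HasEval F z (f + g) (b + c) := by
  intro m
  obtain ⟨K, hK⟩ := hf m
  obtain ⟨K', hK'⟩ := hg m
  refine ⟨max K K', fun L hL => ?_⟩
  have := add_mem (hK L ((le_max_left _ _).trans hL)) (hK' L ((le_max_right _ _).trans hL))
  rwa [sub_add_sub_comm, ← Polynomial.eval_add, ← map_add] at this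

/-- Centrality of `z` makes evaluation of polynomials multiplicative over a noncommutative ring. The
product of truncations differs from the truncated product only in degrees at least L, where powers
of `z` are already small. -/
theorem Evaluable.hasEval_mul (hz : Evaluable F z) {f g : PowerSeries B} {b c : B}
    (hf : HasEval F z f b) (hg : HasEval F z g c) : HasEval F z (f * g) (b * c) := by
  intro m
  obtain ⟨K, hK⟩ := hf m
  obtain ⟨K', hK'⟩ := hg m
  obtain ⟨e, he⟩ := hz.nilp m
  refine ⟨max e (max K K'), fun L hL => ?_⟩
  have h1 := hK L (le_trans (by simp) hL)
  have h2 := hK' L (le_trans (by simp) hL)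
  have h3 : ((trunc L f * trunc L g) - trunc L (f * g)).eval z ∈ F.J m := by
    refine hz.eval_mem (K := L) ?_ fun k hk => ?_
    · obtain ⟨d, hd⟩ := Nat.exists_eq_add_of_le (le_trans (le_max_left _ _) hL)
      rw [hd, pow_add]
      exact F.mul_right _ _ _ he
    · rw [Polynomial.coeff_sub, coeff_trunc, if_pos hk, Polynomial.coeff_mul, coeff_mul, sub_eq_zero]
      refine Finset.sum_congr rfl fun p hp => ?_
      rw [Finset.HasAntidiagonal.mem_antidiagonal] at hp
      rw [coeff_trunc, coeff_trunc, if_pos (by omega), if_pos (by omega)]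
  rw [Polynomial.eval_sub] at h3
  have h4 : (trunc L f * trunc L g).eval z = (trunc L f).eval z * (trunc L g).eval z :=
    Polynomial.eval₂_mul_noncomm _ _ fun k => (hz.central _).symm
  rw [h4] at h3
  have := add_mem (add_mem (F.mul_right _ _ c h1) (F.mul_left _ ((trunc L f).eval z) _ h2)) h3
  rwa [show (b - (trunc L f).eval z) * c + (trunc L f).eval z * (c - (trunc L g).eval z) +
    ((trunc L f).eval z * (trunc L g).eval z - (trunc L (f * g)).eval z) =
    b * c - (trunc L (f * g)).eval z by noncomm_ring] at this

theorem hasEval_C (b : B) : HasEval F z (C b) b := by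
  intro m
  refine ⟨1, fun K hK => ?_⟩
  obtain ⟨K, rfl⟩ := Nat.exists_eq_add_of_le' hK
  rw [trunc_C, Polynomial.eval_C, sub_self]
  exact zero_mem _

theorem hasEval_X : HasEval F z X z := by
  intro m
  refine ⟨2, fun K hK => ?_⟩
  obtain ⟨K, rfl⟩ := Nat.exists_eq_add_of_le' hK
  rw [trunc_X, Polynomial.eval_X, sub_self]
  exact zero_mem _

/-- The evaluation of power series at a central topologically nilpotent element. -/
def evalHom (hz : Evaluable F z) : PowerSeries B →+* B where
  toFun f := (hz.exists_hasEval f).choose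
  map_one' := (hz.exists_hasEval 1).choose_spec.unique (by simpa using hasEval_C (F := F) (z := z) 1)
  map_zero' := (hz.exists_hasEval 0).choose_spec.unique
    (by simpa using hasEval_C (F := F) (z := z) 0)
  map_add' f g := (hz.exists_hasEval _).choose_spec.unique
    ((hz.exists_hasEval f).choose_spec.add (hz.exists_hasEval g).choose_spec)
  map_mul' f g := (hz.exists_hasEval _).choose_spec.unique
    (hz.hasEval_mul (hz.exists_hasEval f).choose_spec (hz.exists_hasEval g).choose_spec)

theorem hasEval_evalHom (hz : Evaluable F z) (f : PowerSeries B) : HasEval F z f (evalHom hz f) :=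
  (hz.exists_hasEval f).choose_spec

theorem evalHom_eq (hz : Evaluable F z) {f : PowerSeries B} {b : B} (h : HasEval F z f b) :
    evalHom hz f = b := (hasEval_evalHom hz f).unique h

theorem evalHom_C (hz : Evaluable F z) (b : B) : evalHom hz (C b) = b :=
  evalHom_eq hz (hasEval_C b)

theorem evalHom_X (hz : Evaluable F z) : evalHom hz X = z := evalHom_eq hz hasEval_X

theorem HasEval.map {B' : Type} [Ring B'] {F' : Filt B'} (φ : B →+* B')
    (hφ : ∀ m, ∃ m', ∀ x ∈ F.J m', φ x ∈ F'.J m) {f : PowerSeries B} {b : B}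
    (h : HasEval F z f b) : HasEval F' (φ z) (PowerSeries.map φ f) (φ b) := by
  intro m
  obtain ⟨m', hm'⟩ := hφ m
  obtain ⟨K, hK⟩ := h m'
  refine ⟨K, fun L hL => ?_⟩
  have h1 : (trunc L (PowerSeries.map φ f)).eval (φ z) = φ ((trunc L f).eval z) := by
    rw [trunc_map, Polynomial.eval_map, Polynomial.eval₂_hom]
  rw [h1, ← map_sub]
  exact hm' _ (hK L hL)

end Evaluation

/-! ### Substitution into series in one variable -/

section Substitution

open PowerSeries

variable {S : Type} [Ring S]

/-- The filtration of a power series ring by the order. -/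
def orderFilt (S : Type) [Ring S] : Filt (PowerSeries S) where
  J m :=
    { carrier := {f | ∀ a < m, coeff a f = 0}
      add_mem' := fun {f g} hf hg a ha => by rw [map_add, hf a ha, hg a ha, add_zero]
      zero_mem' := fun a _ => map_zero _
      neg_mem' := fun {f} hf a ha => by rw [map_neg, hf a ha, neg_zero] }
  mul_left m f g hg a ha := by
    rw [coeff_mul]
    refine Finset.sum_eq_zero fun p hp => ?_
    rw [Finset.HasAntidiagonal.mem_antidiagonal] at hp
    rw [hg _ (by omega), mul_zero]
  mul_right m f g hf a ha := by
    rw [coeff_mul]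
    refine Finset.sum_eq_zero fun p hp => ?_
    rw [Finset.HasAntidiagonal.mem_antidiagonal] at hp
    rw [hf _ (by omega), zero_mul]
  sep f hf := by
    ext a
    exact hf (a + 1) a (by omega)
  complete s hs := by
    -- The coefficient of index a is stable from the term s (a + 1) onwards.
    refine ⟨PowerSeries.mk fun a => coeff a (s (a + 1)), fun n a ha => ?_⟩
    rw [map_sub, coeff_mk, sub_eq_zero]
    obtain ⟨d, rfl⟩ := Nat.exists_eq_add_of_le ha
    clear ha
    induction d with
    | zero => rfl
    | succ d ih =>
      rw [ih, eq_comm, ← sub_eq_zero, ← map_sub]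
      exact hs (a + 1 + d) a (by omega)

theorem coeff_eq_zero_of_mem_orderFilt {m a : ℕ} {f : PowerSeries S} (hf : f ∈ (orderFilt S).J m)
    (ha : a < m) : coeff a f = 0 := hf a ha

theorem pow_mem_orderFilt {s : PowerSeries S} (h0 : coeff 0 s = 0) (m : ℕ) :
    s ^ m ∈ (orderFilt S).J m := by
  induction m with
  | zero => intro a ha; omega
  | succ m ih =>
    intro a ha
    rw [pow_succ, coeff_mul]
    refine Finset.sum_eq_zero fun p hp => ?_
    rw [Finset.HasAntidiagonal.mem_antidiagonal] at hp
    rcases Nat.eq_zero_or_pos p.2 with h2 | h2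
    · rw [h2, h0, mul_zero]
    · rw [ih _ (by omega), zero_mul]

/-- Central series without constant term. -/
structure Small (s : PowerSeries S) : Prop where
  coeff_zero : coeff 0 s = 0
  central : ∀ k x, Commute (coeff k s) x

theorem Small.commute {s : PowerSeries S} (hs : Small s) (f : PowerSeries S) : Commute s f := by
  ext n
  rw [coeff_mul, coeff_mul, ← Finset.Nat.sum_antidiagonal_swap]
  exact Finset.sum_congr rfl fun p _ => (hs.central _ _).eq

theorem Small.evaluable {s : PowerSeries S} (hs : Small s) : Evaluable (orderFilt S) s :=
  ⟨hs.commute, fun m => ⟨m, pow_mem_orderFilt hs.coeff_zero m⟩⟩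

/-- The substitution of the series `s` for the variable. -/
def substHom {s : PowerSeries S} (hs : Small s) : PowerSeries S →+* PowerSeries S :=
  (evalHom hs.evaluable).comp (PowerSeries.map C)

theorem hasEval_compSeries {s : PowerSeries S} (hs : Small s) (f : PowerSeries S) :
    HasEval (orderFilt S) s (PowerSeries.map C f) (compSeries (fun k => coeff k f) s) := by
  refine fun m => ⟨m + 1, fun K hK a ha => ?_⟩
  obtain ⟨K, rfl⟩ := Nat.exists_eq_add_of_le' (show 1 ≤ K by omega)
  have h1 : (trunc (K + 1) (PowerSeries.map C f)).eval s =
      ∑ k ∈ Finset.range (K + 1), C (coeff k f) * s ^ k := by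
    rw [Polynomial.eval_eq_sum_range' (n := K + 1)]
    · refine Finset.sum_congr rfl fun k hk => ?_
      rw [coeff_trunc, if_pos (Finset.mem_range.1 hk), coeff_map]
    · exact natDegree_trunc_lt _ _
  rw [map_sub, h1, compSeries, coeff_mk, map_sum, sub_eq_zero]
  simp only [coeff_C_mul]
  rw [← Finset.sum_subset (Finset.range_mono (show a + 1 ≤ K + 1 by omega))]
  · refine Finset.sum_congr rfl fun k _ => ?_
    have h2 : Commute (s ^ k) (C (coeff k f)) := (hs.commute _).pow_left k
    have h3 := congrArg (coeff a) h2.eq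
    rwa [coeff_mul_C, coeff_C_mul] at h3
  · intro k _ hk
    rw [pow_mem_orderFilt hs.coeff_zero k a (by simpa using hk), mul_zero]

theorem substHom_eq {s : PowerSeries S} (hs : Small s) (f : PowerSeries S) :
    substHom hs f = compSeries (fun k => coeff k f) s := evalHom_eq hs.evaluable (hasEval_compSeries hs f)

end Substitution

/-! ### Composition of substitutions and shifts of the variable -/

section SubstitutionLemmas

open PowerSeries

variable {S : Type} [Ring S]

theorem substHom_C {s : PowerSeries S} (hs : Small s) (x : S) : substHom hs (C x) = C x := by
  rw [substHom, RingHom.comp_apply, map_C, evalHom_C]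

theorem substHom_X {s : PowerSeries S} (hs : Small s) : substHom hs X = s := by
  rw [substHom, RingHom.comp_apply, map_X, evalHom_X]

theorem Small.substHom {s r : PowerSeries S} (hs : Small s) (hr : Small r) :
    Small (substHom hs r) := by
  refine ⟨?_, fun k x => ?_⟩
  · rw [substHom_eq, compSeries, coeff_mk]
    simp [hr.coeff_zero]
  · rw [substHom_eq, compSeries, coeff_mk]
    refine Commute.sum_left _ _ _ fun j _ => Commute.mul_left ?_ (hr.central _ _)
    have h := ((hs.commute (C x)).pow_left j).eq
    have := congrArg (coeff k) h
    rwa [coeff_mul_C, coeff_C_mul] at this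

/-- Substitution respects the order filtration, so it maps the limit defining one evaluation to the
limit defining the other; limits are unique. -/
theorem substHom_substHom {s r : PowerSeries S} (hs : Small s) (hr : Small r)
    (f : PowerSeries S) : substHom hs (substHom hr f) = substHom (hs.substHom hr) f := by
  refine HasEval.unique (F := orderFilt S) (z := substHom hs r) (f := PowerSeries.map C f) ?_
    (substHom_eq (hs.substHom hr) f ▸ hasEval_compSeries (hs.substHom hr) f)
  have h1 : HasEval (orderFilt S) r (PowerSeries.map C f) (substHom hr f) :=
    substHom_eq hr f ▸ hasEval_compSeries hr f
  have h2 := h1.map (F' := orderFilt S) (substHom hs) fun m => ⟨m, fun x hx a ha => by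
    rw [substHom_eq, compSeries, coeff_mk]
    refine Finset.sum_eq_zero fun k hk => ?_
    rw [coeff_eq_zero_of_mem_orderFilt hx (by have := Finset.mem_range.1 hk; omega), mul_zero]⟩
  have h3 : PowerSeries.map (substHom hs) (PowerSeries.map C f) = PowerSeries.map C f := by
    ext1 n
    rw [coeff_map, coeff_map, substHom_C]
  rwa [h3] at h2

theorem substHom_congr {s r : PowerSeries S} (hs : Small s) (hr : Small r) (h : s = r)
    (f : PowerSeries S) : substHom hs f = substHom hr f := by
  subst h
  rfl

theorem map_compSeries {S' : Type} [Ring S'] (φ : S →+* S') (a : ℕ → S) (s : PowerSeries S) :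
    PowerSeries.map φ (compSeries a s) = compSeries (fun k => φ (a k)) (PowerSeries.map φ s) := by
  ext n
  simp only [compSeries, coeff_map, coeff_mk, map_sum, map_mul, ← map_pow]

theorem map_invSub {S' : Type} [Ring S'] (φ : S →+* S') (y : S) :
    PowerSeries.map φ (invSub y) = invSub (φ y) := by
  ext n
  simp only [invSub, coeff_map, coeff_mk]
  split_ifs <;> simp

theorem Small.map {S' : Type} [CommRing S'] {T : Type} [Ring T] (φ : S' →+* T)
    (hφ : ∀ x y, Commute (φ x) y) {s : PowerSeries S'} (hs : Small s) :
    Small (PowerSeries.map φ s) :=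
  ⟨by rw [coeff_map, hs.coeff_zero, map_zero], fun k x => by rw [coeff_map]; exact hφ _ _⟩

theorem small_invSub {y : S} (hy : ∀ x, Commute y x) : Small (invSub y) := by
  refine ⟨by simp [invSub], fun k x => ?_⟩
  rw [invSub, coeff_mk]
  split_ifs
  · exact Commute.zero_left x
  · exact (hy x).pow_left _

/-- Cancellation of 1 - yX replaces division by u - y. It is how identities between expanded
inverses are proved below. -/
theorem eq_zero_of_one_sub_mul {y : S} {r : PowerSeries S} (h : (1 - C y * X) * r = 0) : r = 0 := by
  rw [sub_mul, one_mul, mul_assoc, sub_eq_zero] at h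
  ext n
  induction n with
  | zero => rw [h]; simp
  | succ n ih => rw [h, coeff_C_mul, coeff_succ_X_mul, ih]; simp

theorem eq_invSub {y : S} {r : PowerSeries S} (h : (1 - C y * X) * r = X) : r = invSub y := by
  rw [← sub_eq_zero]
  apply eq_zero_of_one_sub_mul (y := y)
  rw [mul_sub, h, one_sub_mul_invSub, sub_self]

theorem substHom_invSub {w y : S} (hw : ∀ x, Commute w x) (hy : ∀ x, Commute y x) :
    substHom (small_invSub hw) (invSub y) = invSub (w + y) := by
  apply eq_invSub
  have h1 := congrArg (substHom (small_invSub hw)) (one_sub_mul_invSub y)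
  rw [map_mul, map_sub, map_one, map_mul, substHom_C, substHom_X] at h1
  -- Up to powers of X this is u - (w + y) = (u - w)(1 - y (u - w)⁻¹).
  have h2 : (1 - C (w + y) * X : PowerSeries S) = (1 - C w * X) * (1 - C y * invSub w) := by
    have hc : Commute (C y) (1 - C w * X : PowerSeries S) := by
      ext n
      rw [coeff_C_mul, coeff_mul_C, (hy _).eq]
    rw [mul_sub, mul_one, ← mul_assoc, ← hc.eq, mul_assoc, one_sub_mul_invSub, map_add, add_mul]
    abel
  rw [h2, mul_assoc, h1, one_sub_mul_invSub]

theorem small_neg_X : Small (-X : PowerSeries S) :=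
  ⟨by simp, fun k x => by
    rw [map_neg, coeff_X]
    split_ifs
    · exact (Commute.one_left x).neg_left
    · exact (Commute.zero_left x).neg_left⟩

theorem substHom_neg_X_invSub (y : S) :
    substHom small_neg_X (invSub y) = -invSub (-y) := by
  rw [eq_comm, neg_eq_iff_eq_neg, eq_comm]
  apply eq_invSub
  have h1 := congrArg (substHom small_neg_X) (one_sub_mul_invSub y)
  rw [map_mul, map_sub, map_one, map_mul, substHom_C, substHom_X] at h1
  rw [mul_neg, neg_eq_iff_eq_neg]
  refine Eq.trans ?_ h1
  congr 1
  rw [map_neg]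
  noncomm_ring

end SubstitutionLemmas

/-! ### Unitarity and crossing symmetry of the normalizing series -/

section Normalization

open PowerSeries

variable {N : ℕ}

theorem commute_all {R : Type} [CommRing R] (y : R) : ∀ x, Commute y x := fun x => mul_comm y x

theorem Small.of_coeff_zero {R : Type} [CommRing R] {s : PowerSeries R} (h : coeff 0 s = 0) :
    Small s := ⟨h, fun _ _ => mul_comm _ _⟩

theorem shift_gSeries (hN : N ≠ 0) :
    substHom (small_invSub (commute_all (-(N : ℂ)))) (gSeries N) = gSeries N * (1 - X ^ 2) := by
  rw [substHom_eq]
  exact (isG_gSeries hN).2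

/-- The shift u ↦ u + N sends u⁻ᵏ to u⁻ᵏ - kN u⁻ᵏ⁻¹ + …. If all coefficients of index 1, …, k - 1
vanish, comparison in degree k + 1 leaves kN f_k = 0. -/
theorem eq_C_of_shift_eq (hN : N ≠ 0) {f : PowerSeries ℂ}
    (hf : substHom (small_invSub (commute_all (-(N : ℂ)))) f = f) : f = C (coeff 0 f) := by
  have key : ∀ k, 1 ≤ k → coeff k f = 0 := by
    intro k
    induction k using Nat.strong_induction_on with
    | _ k ih =>
      intro hk
      have h := congrArg (coeff (k + 1)) hf
      rw [substHom_eq, compSeries, coeff_mk, Finset.sum_range_succ, Finset.sum_range_succ,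
        coeff_self_invSub_pow, coeff_succ_invSub_pow, Finset.sum_eq_zero, zero_add, one_mul,
        add_eq_right] at h
      · have hN' : (N : ℂ) ≠ 0 := by exact_mod_cast hN
        have hk' : (k : ℂ) ≠ 0 := by exact_mod_cast (show k ≠ 0 by omega)
        simpa [hN', hk'] using h
      · intro j hj
        rcases Nat.eq_zero_or_pos j with h0 | h0
        · rw [h0, pow_zero, coeff_one, if_neg (by omega), zero_mul]
        · rw [ih j (Finset.mem_range.1 hj) h0, mul_zero]
  ext k
  rcases Nat.eq_zero_or_pos k with h0 | h0
  · rw [h0, coeff_zero_C]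
  · rw [key k h0, coeff_C, if_neg (by omega)]

/-- The functional equation at u and at -u - N shows that g(u) g(-u) (1 - u⁻²) is invariant under u
↦ u + N. It is therefore constant, and its constant term is 1. -/
theorem gSeries_unitary (hN : N ≠ 0) :
    gSeries N * substHom small_neg_X (gSeries N) * (1 - X ^ 2) = 1 := by
  obtain ⟨s, hs⟩ : ∃ s : PowerSeries ℂ, s = invSub (-(N : ℂ)) := ⟨_, rfl⟩
  have hS : Small s := hs ▸ small_invSub (commute_all _)
  have hS' : Small (-s) := Small.of_coeff_zero (by rw [map_neg, hS.coeff_zero, neg_zero])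
  have hg : substHom hS (gSeries N) = gSeries N * (1 - X ^ 2) := by
    rw [← shift_gSeries hN]
    exact substHom_congr _ _ hs _
  have hsX : (1 - C (-(N : ℂ)) * X) * s = X := by rw [hs, one_sub_mul_invSub]
  -- Here s = (u + N)⁻¹, and the substitution of -s for u⁻¹ is u ↦ -u - N, which is an involution.
  have h1 : substHom hS' s = -X := by
    have h2 := congrArg (substHom hS') hsX
    rw [map_mul, map_sub, map_one, map_mul, substHom_C, substHom_X] at h2
    have h3 : (1 - C (-(N : ℂ)) * X) * (1 - C (-(N : ℂ)) * -s) = 1 := by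
      linear_combination (C (-(N : ℂ))) * hsX
    calc substHom hS' s = (1 - C (-(N : ℂ)) * X) * ((1 - C (-(N : ℂ)) * -s) * substHom hS' s) := by
          rw [← mul_assoc, h3, one_mul]
      _ = -X := by rw [h2, mul_neg, hsX]
  -- The functional equation at -u - N: g(-u) = g(-u - N)(1 - (u + N)⁻²).
  have h2 : substHom small_neg_X (gSeries N) =
      substHom hS (substHom small_neg_X (gSeries N)) * (1 - s ^ 2) := by
    have h3 : substHom hS (substHom small_neg_X (gSeries N)) = substHom hS' (gSeries N) := by
      rw [substHom_substHom]
      refine substHom_congr _ _ ?_ _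
      rw [map_neg, substHom_X]
    have h4 := congrArg (substHom hS') hg
    rw [substHom_substHom, map_mul, map_sub, map_one, map_pow, substHom_X] at h4
    rw [h3, ← neg_sq s, ← h4]
    exact (substHom_congr _ _ h1 _).symm
  have h5 : substHom hS (gSeries N * substHom small_neg_X (gSeries N) * (1 - X ^ 2)) =
      gSeries N * substHom small_neg_X (gSeries N) * (1 - X ^ 2) := by
    rw [map_mul, map_mul, hg, map_sub, map_one, map_pow, substHom_X, mul_assoc, ← h2]
    ring
  have h6 := eq_C_of_shift_eq hN ((substHom_congr _ _ hs.symm _).trans h5)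
  have h7 : constantCoeff (gSeries N * substHom small_neg_X (gSeries N) * (1 - X ^ 2)) = 1 := by
    rw [map_mul, map_mul, (isG_gSeries hN).1, ← coeff_zero_eq_constantCoeff_apply, substHom_eq,
      compSeries, coeff_mk]
    simp [gSeries, gCoeff]
  rw [h6, coeff_zero_eq_constantCoeff_apply, h7, map_one]

variable {L : Type} [CommRing L] (ψ : ℂ →+* L)

/-- The series `g`, with `q` in the role of `u⁻¹`. -/
def gAt (N : ℕ) (q : PowerSeries L) : PowerSeries L :=
  compSeries (fun k => ψ (coeff k (gSeries N))) q

theorem gAt_eq {q : PowerSeries L} (hq : Small q) :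
    gAt ψ N q = substHom hq (PowerSeries.map ψ (gSeries N)) := by
  rw [substHom_eq, gAt]
  simp only [coeff_map]

theorem map_substHom {s : PowerSeries ℂ} (hs : Small s) {q : PowerSeries L} (hq : Small q)
    (hsq : Small (substHom hq (PowerSeries.map ψ s))) (f : PowerSeries ℂ) :
    substHom hq (PowerSeries.map ψ (substHom hs f)) = substHom hsq (PowerSeries.map ψ f) := by
  have hψs : Small (PowerSeries.map ψ s) := hs.map ψ fun _ _ => mul_comm _ _
  have : PowerSeries.map ψ (substHom hs f) = substHom hψs (PowerSeries.map ψ f) := by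
    rw [substHom_eq, substHom_eq, map_compSeries]
    simp only [coeff_map]
  rw [this, substHom_substHom]

theorem gAt_unitary (hN : N ≠ 0) {q : PowerSeries L} (hq : coeff 0 q = 0) :
    gAt ψ N q * gAt ψ N (-q) * (1 - q ^ 2) = 1 := by
  have hq' := Small.of_coeff_zero hq
  have hq'' : Small (-q) := Small.of_coeff_zero (by rw [map_neg, hq, neg_zero])
  have h := congrArg (fun f => substHom hq' (PowerSeries.map ψ f)) (gSeries_unitary hN)
  simp only [map_mul, map_sub, map_one, map_pow, map_X, substHom_X] at h
  refine Eq.trans ?_ h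
  rw [gAt_eq ψ hq', gAt_eq ψ hq'', map_substHom ψ small_neg_X hq' (hq'.substHom
    (Small.map ψ (fun _ _ => mul_comm _ _) small_neg_X))]
  congr 2
  refine substHom_congr _ _ ?_ _
  rw [map_neg, map_X, map_neg, substHom_X]

/-- With q in the role of x⁻¹, the hypothesis identifies q' with (x + N)⁻¹, and the claim is the
functional equation of g. -/
theorem gAt_crossing (hN : N ≠ 0) {q q' : PowerSeries L} (hq : coeff 0 q = 0)
    (h : (1 + N * q) * q' = q) : gAt ψ N q' = gAt ψ N q * (1 - q ^ 2) := by
  have hq₁ := Small.of_coeff_zero hq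
  have hs := small_invSub (commute_all (-(N : ℂ)))
  have hsq := hq₁.substHom (Small.map ψ (fun _ _ => mul_comm _ _) hs)
  obtain ⟨r, hr⟩ : ∃ r, r = substHom hq₁ (PowerSeries.map ψ (invSub (-(N : ℂ)))) := ⟨_, rfl⟩
  have h1 : (1 + N * q) * r = q := by
    have := congrArg (fun f => substHom hq₁ (PowerSeries.map ψ f)) (one_sub_mul_invSub (-(N : ℂ)))
    simp only [map_mul, map_sub, map_one, map_X, substHom_X, map_neg, map_natCast] at this
    rw [← hr] at this
    linear_combination this
  have h2 : q' = r := by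
    have hu : IsUnit (1 + N * q) := by
      rw [PowerSeries.isUnit_iff_constantCoeff, map_add, map_mul, map_one,
        ← coeff_zero_eq_constantCoeff_apply q, hq, mul_zero, add_zero]
      exact isUnit_one
    exact hu.mul_left_cancel (h.trans h1.symm)
  have hq₂ : Small q' := by rw [h2, hr]; exact hsq
  rw [gAt_eq ψ hq₁, gAt_eq ψ hq₂]
  have h3 := congrArg (fun f => substHom hq₁ (PowerSeries.map ψ f)) (shift_gSeries hN)
  simp only [map_mul, map_sub, map_one, map_pow, map_X, substHom_X] at h3
  rw [← h3, map_substHom ψ hs hq₁ hsq]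
  exact substHom_congr _ _ (h2.trans hr) _

end Normalization

/-! ### Complete algebras over `ℂ[[h]]` -/

section HAdic

open PowerSeries

variable (A : Type) [Ring A] [Algebra Ch A]

/-- The algebra `A` is `h`-adically separated and complete. -/
structure IsHAdic : Prop where
  sep : ∀ x : A, (∀ n, ∃ y : A, x = hh ^ n • y) → x = 0
  complete : ∀ y : ℕ → A, ∃ b : A, ∀ n, ∃ r : A,
    b = ∑ k ∈ Finset.range n, hh ^ k • y k + hh ^ n • r

variable {A}

theorem smul_dvd_mono {m n : ℕ} (h : m ≤ n) {x : A} (hx : ∃ y : A, x = hh ^ n • y) :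
    ∃ y : A, x = hh ^ m • y := by
  obtain ⟨y, rfl⟩ := hx
  obtain ⟨d, rfl⟩ := Nat.exists_eq_add_of_le h
  exact ⟨hh ^ d • y, by rw [pow_add, mul_smul]⟩

/-- The filtration of `A[[u]]` by the powers of the ideal generated by `h` and `u`, up to
reindexing. -/
def hFilt (hA : IsHAdic A) : Filt (PowerSeries A) where
  J m :=
    { carrier := {f | ∀ a < m, ∃ y : A, coeff a f = hh ^ m • y}
      add_mem' := by
        intro f g hf hg a ha
        obtain ⟨y, hy⟩ := hf a ha
        obtain ⟨y', hy'⟩ := hg a ha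
        exact ⟨y + y', by rw [map_add, hy, hy', smul_add]⟩
      zero_mem' := fun a _ => ⟨0, by rw [map_zero, smul_zero]⟩
      neg_mem' := by
        intro f hf a ha
        obtain ⟨y, hy⟩ := hf a ha
        exact ⟨-y, by rw [map_neg, hy, smul_neg]⟩ }
  mul_left m f g hg := by
    intro a ha
    choose! y hy using hg
    refine ⟨∑ p ∈ Finset.HasAntidiagonal.antidiagonal a, coeff p.1 f * y p.2, ?_⟩
    rw [coeff_mul, Finset.smul_sum]
    refine Finset.sum_congr rfl fun p hp => ?_
    rw [Finset.HasAntidiagonal.mem_antidiagonal] at hp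
    rw [hy _ (by omega), mul_smul_comm]
  mul_right m f g hf := by
    intro a ha
    choose! y hy using hf
    refine ⟨∑ p ∈ Finset.HasAntidiagonal.antidiagonal a, y p.1 * coeff p.2 g, ?_⟩
    rw [coeff_mul, Finset.smul_sum]
    refine Finset.sum_congr rfl fun p hp => ?_
    rw [Finset.HasAntidiagonal.mem_antidiagonal] at hp
    rw [hy _ (by omega), smul_mul_assoc]
  sep f hf := by
    ext a
    refine hA.sep _ fun n => smul_dvd_mono (le_max_left n (a + 1)) (hf _ a ?_)
    exact (Nat.lt_succ_self a).trans_le (le_max_right _ _)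
  complete s hs := by
    have key : ∀ a, ∃ b : A, ∀ n, a < n → ∃ y : A, b - coeff a (s n) = hh ^ n • y := by
      intro a
      have h1 : ∀ k, ∃ y : A, coeff a (s (a + 1 + k + 1)) - coeff a (s (a + 1 + k)) =
          hh ^ (a + 1 + k) • y := fun k => by
        rw [← map_sub]
        exact hs (a + 1 + k) a (by omega)
      choose y hy using h1
      obtain ⟨b, hb⟩ := hA.complete y
      -- Only for n > a does the filtration control the coefficient of index a; the telescoping
      -- series thus starts at a + 1, where the increments are divisible by growing powers of h.
      refine ⟨coeff a (s (a + 1)) + hh ^ (a + 1) • b, fun n hn => ?_⟩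
      obtain ⟨k, rfl⟩ := Nat.exists_eq_add_of_le hn
      obtain ⟨r, hr⟩ := hb k
      have h2 : coeff a (s (a + 1 + k)) = coeff a (s (a + 1)) +
          hh ^ (a + 1) • ∑ k ∈ Finset.range k, hh ^ k • y k := by
        clear hr hn
        induction k with
        | zero => simp
        | succ k ih =>
          rw [Finset.sum_range_succ, smul_add, smul_smul, ← pow_add, ← hy k,
            show a + 1 + (k + 1) = a + 1 + k + 1 from rfl, ih]
          abel
      refine ⟨r, ?_⟩
      change _ - coeff a (s (a + 1 + k)) = hh ^ (a + 1 + k) • r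
      rw [h2, hr, smul_add, pow_add _ (a + 1) k, mul_smul]
      abel
    choose b hb using key
    exact ⟨PowerSeries.mk b, fun n a ha => by rw [map_sub, coeff_mk]; exact hb a n ha⟩

theorem cst_commute (x : ℂ) (y : A) : Commute (cst A x) y := Algebra.commutes _ y

theorem hIn_commute (y : A) : Commute (hIn A) y := Algebra.commutes _ y

theorem commute_C {R : Type} [Ring R] {x : R} (hx : ∀ y, Commute x y) (f : PowerSeries R) : Commute (C x) f := by
  ext n
  rw [coeff_C_mul, coeff_mul_C, (hx _).eq]

/-- The element `ε u + α h` of `A[[u]]`. -/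
def point (A : Type) [Ring A] [Algebra Ch A] (ε α : ℂ) : PowerSeries A :=
  C (cst A ε) * X + C (cst A α * hIn A)

theorem point_commute (ε α : ℂ) (f : PowerSeries A) : Commute (point A ε α) f :=
  (((commute_C (cst_commute ε) f).mul_left (PowerSeries.commute_X f).symm)).add_left
    (commute_C (fun y => (cst_commute α y).mul_left (hIn_commute y)) f)

theorem coeff_point_pow (ε α : ℂ) (k a : ℕ) :
    coeff a (point A ε α ^ k) =
      if a ≤ k then cst A ((k.choose a : ℂ) * ε ^ a * α ^ (k - a)) * hIn A ^ (k - a) else 0 := by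
  have hc : Commute (C (cst A ε) * X : PowerSeries A) (C (cst A α * hIn A)) :=
    (commute_C (fun y => (cst_commute α y).mul_left (hIn_commute y)) _).symm
  have h1 : ∀ m, coeff a ((C (cst A ε) * X : PowerSeries A) ^ m * C (cst A α * hIn A) ^ (k - m) *
      (k.choose m : PowerSeries A)) =
      if a = m then cst A ((k.choose a : ℂ) * ε ^ a * α ^ (k - a)) * hIn A ^ (k - a) else 0 := by
    intro m
    have h2 : (k.choose m : PowerSeries A) = C (cst A (k.choose m : ℂ)) := by
      rw [map_natCast, map_natCast]
    have h3 : Commute (C (cst A ε)) (X : PowerSeries A) := commute_C (cst_commute ε) _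
    have h4 : (X ^ m * C (cst A α * hIn A) ^ (k - m) : PowerSeries A) =
        C ((cst A α * hIn A) ^ (k - m)) * X ^ m := by
      rw [map_pow]
      exact (((PowerSeries.commute_X _).symm.pow_left m).pow_right (k - m)).eq
    rw [h2, h3.mul_pow, ← (commute_C (cst_commute (A := A) (k.choose m : ℂ)) _).eq,
      mul_assoc, h4, ← map_pow, ← mul_assoc, ← mul_assoc, ← map_mul, ← map_mul, coeff_C_mul,
      coeff_X_pow]
    split_ifs with h
    · subst h
      rw [mul_one, (cst_commute α _).mul_pow, ← map_pow, ← map_pow, ← map_mul, ← mul_assoc,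
        ← map_mul]
    · rw [mul_zero]
  rw [point, hc.add_pow, map_sum, Finset.sum_congr rfl fun m _ => h1 m, Finset.sum_ite_eq]
  simp only [Finset.mem_range, Nat.lt_succ_iff]

theorem evaluable_point (hA : IsHAdic A) (ε α : ℂ) : Evaluable (hFilt hA) (point A ε α) := by
  -- In the power 2m, the coefficient of uᵃ contains h to the power 2m - a, which is at least m when
  -- a < m.
  refine ⟨point_commute ε α, fun m => ⟨2 * m, fun a ha => ?_⟩⟩
  rw [coeff_point_pow, if_pos (by omega)]
  refine smul_dvd_mono (show m ≤ 2 * m - a by omega) ⟨cst A (((2 * m).choose a : ℂ) * ε ^ a *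
    α ^ (2 * m - a)), ?_⟩
  rw [Algebra.smul_def, map_pow, (cst_commute (A := A) _ _).eq]
  rfl

/-- The evaluation of a series with coefficients in `A` at `ε u + α h`. -/
def evalPt (hA : IsHAdic A) (ε α : ℂ) : PowerSeries A →+* PowerSeries A :=
  (evalHom (evaluable_point hA ε α)).comp (PowerSeries.map C)

theorem evalPt_C (hA : IsHAdic A) (ε α : ℂ) (x : A) : evalPt hA ε α (C x) = C x := by
  rw [evalPt, RingHom.comp_apply, map_C, evalHom_C]

theorem evalPt_X (hA : IsHAdic A) (ε α : ℂ) : evalPt hA ε α X = point A ε α := by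
  rw [evalPt, RingHom.comp_apply, map_X, evalHom_X]

theorem coeff_eval_point (ε α : ℂ) (f : PowerSeries A) (K a : ℕ) :
    coeff a ((trunc (a + K) (PowerSeries.map C f)).eval (point A ε α)) =
      ∑ s ∈ Finset.range K, hh ^ s • (cst A (((a + s).choose a : ℂ) * ε ^ a * α ^ s) *
        coeff (a + s) f) := by
  rcases Nat.eq_zero_or_pos (a + K) with h0 | h0
  · obtain ⟨rfl, rfl⟩ : a = 0 ∧ K = 0 := by omega
    simp
  obtain ⟨d, hd⟩ := Nat.exists_eq_succ_of_ne_zero h0.ne'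
  have h1 : (trunc (a + K) (PowerSeries.map C f)).eval (point A ε α) =
      ∑ k ∈ Finset.range (a + K), C (coeff k f) * point A ε α ^ k := by
    rw [Polynomial.eval_eq_sum_range' (n := a + K)]
    · refine Finset.sum_congr rfl fun k hk => ?_
      rw [coeff_trunc, if_pos (Finset.mem_range.1 hk), coeff_map]
    · rw [hd]
      exact natDegree_trunc_lt _ _
  rw [h1, map_sum, Finset.sum_range_add, Finset.sum_eq_zero, zero_add]
  · refine Finset.sum_congr rfl fun s _ => ?_
    rw [coeff_C_mul, coeff_point_pow, if_pos (by omega), Nat.add_sub_cancel_left, ← mul_assoc,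
      ← ((cst_commute (A := A) _ _).eq : _ = _), ← ((hIn_commute (A := A) _).pow_left s).eq,
      Algebra.smul_def, map_pow]
    rfl
  · intro k hk
    rw [coeff_C_mul, coeff_point_pow, if_neg (by simpa using hk), mul_zero]

/-- Links the evaluation homomorphism to the explicit h-adic sum that defines `matTPlus`. The
remainder is given as an explicit multiple of hⁿ. -/
theorem coeff_evalPt (hA : IsHAdic A) (ε α : ℂ) (f : PowerSeries A) (a n : ℕ) :
    ∃ r : A, coeff a (evalPt hA ε α f) =
      ∑ s ∈ Finset.range n, hh ^ s • (cst A (((a + s).choose a : ℂ) * ε ^ a * α ^ s) *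
        coeff (a + s) f) + hh ^ n • r := by
  obtain ⟨K₀, hK⟩ := hasEval_evalHom (evaluable_point hA ε α) (PowerSeries.map C f) (a + 1 + n)
  obtain ⟨y, hy⟩ := hK (a + (n + K₀)) (by omega) a (by omega)
  rw [map_sub, coeff_eval_point, sub_eq_iff_eq_add, Finset.sum_range_add] at hy
  obtain ⟨y', hy'⟩ := smul_dvd_mono (show n ≤ a + 1 + n by omega) ⟨y, rfl⟩
  refine ⟨y' + ∑ s ∈ Finset.range K₀, hh ^ s • (cst A (((a + (n + s)).choose a : ℂ) * ε ^ a *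
    α ^ (n + s)) * coeff (a + (n + s)) f), ?_⟩
  rw [evalPt, RingHom.comp_apply, hy, hy', smul_add, Finset.smul_sum]
  simp only [pow_add hh n, mul_smul]
  abel

theorem evalPt_eq (hA : IsHAdic A) (ε α : ℂ) (f g : PowerSeries A)
    (h : ∀ a n, ∃ r : A, coeff a g =
      ∑ s ∈ Finset.range n, hh ^ s • (cst A (((a + s).choose a : ℂ) * ε ^ a * α ^ s) *
        coeff (a + s) f) + hh ^ n • r) : evalPt hA ε α f = g := by
  ext a
  rw [← sub_eq_zero]
  refine hA.sep _ fun n => ?_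
  obtain ⟨r, hr⟩ := coeff_evalPt hA ε α f a n
  obtain ⟨r', hr'⟩ := h a n
  exact ⟨r - r', by rw [hr, hr', smul_sub]; abel⟩

end HAdic

/-! ### The completed double Yangian is h-adically separated and complete -/

section HAdicCompletion

variable {A₀ : Type} [Ring A₀] [Algebra Ch A₀]

theorem hSum_eq (x : ℕ → A₀) (n : ℕ) :
    hSum x = ∑ s ∈ Finset.range n, hh ^ s • toCompletion A₀ (x s) +
      hh ^ n • hSum fun s => x (n + s) := by
  apply Subtype.ext
  funext m
  have h1 : (∑ s ∈ Finset.range n, hh ^ s • toCompletion A₀ (x s) : Completion A₀).val m =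
      Ideal.Quotient.mk (hIdeal A₀ m) (∑ s ∈ Finset.range n, algebraMap Ch A₀ (hh ^ s) * x s) := by
    rw [AddSubmonoidClass.coe_finsetSum, Finset.sum_apply, map_sum]
    refine Finset.sum_congr rfl fun s _ => ?_
    rw [← Algebra.smul_def]
    rfl
  change Ideal.Quotient.mk (hIdeal A₀ m) _ = (∑ s ∈ Finset.range n, hh ^ s • toCompletion A₀ (x s) :
    Completion A₀).val m + hh ^ n • Ideal.Quotient.mk (hIdeal A₀ m) _
  rw [h1]
  have h2 : ∀ y : A₀, hh ^ n • Ideal.Quotient.mk (hIdeal A₀ m) y =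
      Ideal.Quotient.mk (hIdeal A₀ m) (algebraMap Ch A₀ (hh ^ n) * y) := fun y => by
    rw [← Algebra.smul_def]
    rfl
  rw [h2, ← map_add, Finset.mul_sum]
  have h3 : ∑ s ∈ Finset.range n, algebraMap Ch A₀ (hh ^ s) * x s +
      ∑ s ∈ Finset.range m, algebraMap Ch A₀ (hh ^ n) * (algebraMap Ch A₀ (hh ^ s) * x (n + s)) =
      ∑ s ∈ Finset.range (m + n), algebraMap Ch A₀ (hh ^ s) * x s := by
    rw [add_comm m n, Finset.sum_range_add]
    simp only [pow_add, map_mul, mul_assoc]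
  rw [h3, Finset.sum_range_add, map_add, eq_comm, add_eq_left, map_sum]
  refine Finset.sum_eq_zero fun s _ => Ideal.Quotient.eq_zero_iff_mem.2 ((mem_hIdeal A₀).2
    ⟨algebraMap Ch A₀ (hh ^ s) * x (m + s), ?_⟩)
  rw [pow_add, map_mul, mul_assoc]

theorem smul_val_eq_zero (n : ℕ) (y : Completion A₀) : (hh ^ n • y).val n = 0 := by
  rw [Algebra.smul_def]
  change (algebraMap Ch (Completion A₀) (hh ^ n)).val n * y.val n = 0
  rw [val_hh_pow, zero_mul]

theorem isHAdic_completion : IsHAdic (Completion A₀) where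
  sep x hx := by
    apply Subtype.ext
    funext n
    obtain ⟨y, rfl⟩ := hx n
    exact smul_val_eq_zero n y
  complete y := by
    have key : ∀ y : ℕ → Completion A₀, ∃ b : Completion A₀, ∀ n,
        b.val n = (∑ k ∈ Finset.range n, hh ^ k • y k).val n := by
      intro y
      refine ⟨⟨fun n => (∑ k ∈ Finset.range n, hh ^ k • y k).val n, fun n => ?_⟩, fun n => rfl⟩
      have h1 := (∑ k ∈ Finset.range (n + 1), hh ^ k • y k).2 n
      refine h1.trans ?_
      rw [Finset.sum_range_succ]
      change _ + (hh ^ n • y n).val n = _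
      rw [smul_val_eq_zero, add_zero]
    obtain ⟨b, hb⟩ := key y
    refine ⟨b, fun n => ?_⟩
    -- The remainder is the sum of the shifted series, so it is found without cancelling hⁿ.
    obtain ⟨r, hr⟩ := key fun k => y (n + k)
    refine ⟨r, ?_⟩
    apply Subtype.ext
    funext m
    have h2 : (hh ^ n • r).val m = (hh ^ n • ∑ k ∈ Finset.range m, hh ^ k • y (n + k)).val m := by
      change hh ^ n • r.val m = hh ^ n • (∑ k ∈ Finset.range m, hh ^ k • y (n + k)).val m
      rw [hr]
    change b.val m = (∑ k ∈ Finset.range n, hh ^ k • y k).val m + (hh ^ n • r).val m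
    rw [h2, hb]
    change _ = (∑ k ∈ Finset.range n, hh ^ k • y k +
      hh ^ n • ∑ k ∈ Finset.range m, hh ^ k • y (n + k)).val m
    rw [Finset.smul_sum]
    simp only [smul_smul, ← pow_add]
    rw [← Finset.sum_range_add (fun k => hh ^ k • y k), add_comm n m, Finset.sum_range_add]
    change _ = _ + (∑ k ∈ Finset.range n, hh ^ (m + k) • y (m + k)).val m
    rw [eq_comm, add_eq_left, AddSubmonoidClass.coe_finsetSum, Finset.sum_apply]
    refine Finset.sum_eq_zero fun k _ => ?_
    rw [pow_add, mul_smul]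
    exact smul_val_eq_zero m _

theorem isHAdic_DYHat (N : ℕ) (c : ℂ) : IsHAdic (DYHat N c) :=
  isHAdic_completion (A₀ := DYc N c)

theorem hatSum_eq (N : ℕ) (c : ℂ) (x : ℕ → DYc N c) (n : ℕ) :
    hatSum N c x = ∑ s ∈ Finset.range n, hh ^ s • toDYHat N c (x s) +
      hh ^ n • hatSum N c fun s => x (n + s) := hSum_eq x n

end HAdicCompletion

/-! ### Matrix elements of the defining relations -/

section Entries

variable {N : ℕ} {R : Type} [Ring R]

theorem vec_comp_swap {α : Type} (a i : α) : ![a, i] ∘ Equiv.swap (0 : Fin 2) 1 = ![i, a] := by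
  funext k
  fin_cases k <;> simp

theorem smul_sub_flip_mul_apply (x y : R) (F : Matrix (Fin 2 → Fin N) (Fin 2 → Fin N) R)
    (a b i j : Fin N) : ((x • (1 : Matrix (Fin 2 → Fin N) (Fin 2 → Fin N) R) - y • flipOp) * F :
      Matrix (Fin 2 → Fin N) (Fin 2 → Fin N) R)
      ![a, i] ![b, j] = x * F ![a, i] ![b, j] - y * F ![i, a] ![b, j] := by
  rw [sub_mul, smul_mul_assoc, smul_mul_assoc, one_mul, Matrix.sub_apply, Matrix.smul_apply,
    Matrix.smul_apply, flipOp, permOp_mul_apply, vec_comp_swap, smul_eq_mul, smul_eq_mul]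

theorem mul_smul_sub_flip_apply (x y : R) (F : Matrix (Fin 2 → Fin N) (Fin 2 → Fin N) R)
    (a b i j : Fin N) : (F * (x • (1 : Matrix (Fin 2 → Fin N) (Fin 2 → Fin N) R) - y • flipOp) :
      Matrix (Fin 2 → Fin N) (Fin 2 → Fin N) R)
      ![a, i] ![b, j] = F ![a, i] ![b, j] * x - F ![a, i] ![j, b] * y := by
  have h : ∀ (z : R) (G : Matrix (Fin 2 → Fin N) (Fin 2 → Fin N) R),
      z • G = Matrix.scalar (Fin 2 → Fin N) z * G := fun z G => by
    rw [Matrix.scalar_apply, Matrix.smul_eq_diagonal_mul]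
  rw [h, h, mul_sub, mul_one, ← mul_assoc, Matrix.sub_apply, flipOp, mul_permOp_apply,
    Equiv.symm_swap, vec_comp_swap, Matrix.scalar_apply, Matrix.scalar_apply,
    Matrix.mul_diagonal, Matrix.mul_diagonal]

theorem atFactor_zero_one_apply (M M' : Matrix (Fin N) (Fin N) R) (a b i j : Fin N) :
    (atFactor (0 : Fin 2) M * atFactor 1 M' : Matrix (Fin 2 → Fin N) (Fin 2 → Fin N) R)
      ![a, i] ![b, j] = M a b * M' i j := by
  rw [atFactor_mul_atFactor_apply (by decide), if_pos]
  · rfl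
  · intro k h0 h1
    omega

theorem atFactor_one_zero_apply (M M' : Matrix (Fin N) (Fin N) R) (a b i j : Fin N) :
    (atFactor (1 : Fin 2) M' * atFactor 0 M : Matrix (Fin 2 → Fin N) (Fin 2 → Fin N) R)
      ![a, i] ![b, j] = M' i j * M a b := by
  rw [atFactor_mul_atFactor_apply (by decide), if_pos]
  · rfl
  · intro k h0 h1
    omega

/-- On the left the flip exchanges the row indices a and i, on the right the column indices b and j.
-/
theorem rtt_apply {x y x' y' : R} {M M' : Matrix (Fin N) (Fin N) R}
    (h : (x • (1 : Matrix (Fin 2 → Fin N) (Fin 2 → Fin N) R) - y • flipOp) * atFactor 0 M *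
      atFactor 1 M' = atFactor 1 M' * atFactor 0 M * (x' • 1 - y' • flipOp)) (a b i j : Fin N) :
    x * (M a b * M' i j) - y * (M i b * M' a j) = M' i j * M a b * x' - M' i b * M a j * y' := by
  have := congrFun (congrFun h ![a, i]) ![b, j]
  rwa [mul_assoc, smul_sub_flip_mul_apply, mul_smul_sub_flip_apply, atFactor_zero_one_apply,
    atFactor_zero_one_apply, atFactor_one_zero_apply, atFactor_one_zero_apply] at this

end Entries

/-! ### The defining relations in the completed double Yangian -/

section Relations

open PowerSeries

variable (N : ℕ) (c : ℂ)

/-- The projection of the free algebra onto the completed double Yangian at the level `c`. -/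
def proj : FreeGen N →+* DYHat N c :=
  (toDYHat N c).comp ((toDYc N c).toRingHom.comp (toDY N).toRingHom)

theorem proj_algebraMap (r : Ch) :
    proj N c (algebraMap Ch (FreeGen N) r) = algebraMap Ch (DYHat N c) r := by
  have h1 : (toDY N) (algebraMap Ch (FreeGen N) r) = algebraMap Ch (DY N) r := AlgHom.commutes _ r
  have h2 : (toDYc N c) (algebraMap Ch (DY N) r) = algebraMap Ch (DYc N c) r := AlgHom.commutes _ r
  change toDYHat N c (toDYc N c (toDY N _)) = _
  rw [h1, h2]
  rfl

theorem proj_hIn : proj N c (hIn (FreeGen N)) = hIn (DYHat N c) := proj_algebraMap N c _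

theorem proj_cst (x : ℂ) : proj N c (cst (FreeGen N) x) = cst (DYHat N c) x :=
  proj_algebraMap N c _

theorem proj_gen_C : proj N c (gen N .C) = cst (DYHat N c) c := by
  have h : toDYc N c (toDY N (gen N .C)) = toDYc N c (cst (DY N) c) :=
    RingQuot.mkAlgHom_rel Ch LevelRel.level
  change toDYHat N c (toDYc N c (toDY N _)) = _
  rw [h]
  have h2 : (toDYc N c) (algebraMap Ch (DY N) (PowerSeries.C c)) =
    algebraMap Ch (DYc N c) (PowerSeries.C c) := AlgHom.commutes _ _
  exact congrArg (toDYHat N c) h2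

theorem proj_eq_zero {x : FreeGen N} (hx : x ∈ rttCoeffs N) : proj N c x = 0 := by
  -- The relations with exponent 0, where no power of h is cancelled, are sufficient.
  have h : toDY N x = toDY N 0 :=
    RingQuot.mkAlgHom_rel Ch (DYRel.rtt 0 x (by rwa [pow_zero, one_mul]))
  change toDYHat N c (toDYc N c (toDY N x)) = 0
  rw [h, map_zero, map_zero, map_zero]

theorem map_proj_eq_zero {L : Matrix (Fin 2 → Fin N) (Fin 2 → Fin N) (TwoVar N)}
    (hL : L = rttPos N ∨ L = rttNeg N ∨ L = rttMixed N) :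
    L.map (PowerSeries.map (PowerSeries.map (proj N c))) = 0 := by
  ext I J p q
  rw [Matrix.map_apply, coeff_map, coeff_map]
  exact proj_eq_zero N c ⟨L, I, J, p, q, hL, rfl⟩

/-- The series `t_{ij}(u)` over the completed double Yangian, in `X = u⁻¹`. -/
def tSer (i j : Fin N) : PowerSeries (DYHat N c) :=
  PowerSeries.mk fun k => toDYHat N c (posCoeff (fun i j r => genC N c (.tPos i j r)) i j k)

/-- The series `t⁺_{ij}(u)` over the completed double Yangian, in `X = u`. -/
def tPlusSer (i j : Fin N) : PowerSeries (DYHat N c) :=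
  PowerSeries.mk fun k => toDYHat N c (negCoeff (fun i j r => genC N c (.tNeg i j r)) i j k)

theorem map_freeT (i j : Fin N) : PowerSeries.map (proj N c) (freeT N i j) = tSer N c i j := by
  ext k
  rw [coeff_map, tSer, freeT, Matrix.of_apply, coeff_mk, coeff_mk]
  rcases k with _ | k
  · simp only [posCoeff]
    split_ifs <;> simp
  · simp only [posCoeff, map_mul, proj_hIn]
    rfl

theorem map_freeTPlus (i j : Fin N) :
    PowerSeries.map (proj N c) (freeTPlus N i j) = tPlusSer N c i j := by
  ext k
  rw [coeff_map, tPlusSer, freeTPlus, Matrix.of_apply, coeff_mk, coeff_mk]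
  simp only [negCoeff, map_mul, map_sub, proj_hIn]
  congr 1
  split_ifs <;> simp

/-- Since evaluation is a ring homomorphism, relations between the entries of T⁺(u) carry over to
the arguments εu + αh. -/
theorem matTPlus_eq (ε α : ℂ) (i j : Fin N) :
    matTPlus N c ε α i j = evalPt (isHAdic_DYHat N c) ε α (tPlusSer N c i j) := by
  symm
  apply evalPt_eq
  intro a n
  refine ⟨hatSum N c fun s => cst (DYc N c) (((a + (n + s)).choose a : ℂ) * ε ^ a * α ^ (n + s)) *
      negCoeff (fun i j r => genC N c (.tNeg i j r)) i j (a + (n + s)), ?_⟩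
  rw [matTPlus, Matrix.of_apply, coeff_mk, hatSum_eq N c _ n]
  simp only [map_mul, tPlusSer, coeff_mk]
  rfl

theorem matT_eq {s : PowerSeries (DYHat N c)} (hs : Small s) (i j : Fin N) :
    matT N c s i j = substHom hs (tSer N c i j) := by
  rw [substHom_eq]
  simp only [matT, Matrix.of_apply, tSer, coeff_mk]

variable {S : Type} [Ring S]

/-- The flip operators and the matrices of the relations under a change of coefficients. -/
theorem map_sub_flip {R R' : Type} [Ring R] [Ring R'] (φ : R →+* R') (x y : R) :
    (x • (1 : Matrix (Fin 2 → Fin N) (Fin 2 → Fin N) R) - y • flipOp).map φ =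
      φ x • (1 : Matrix (Fin 2 → Fin N) (Fin 2 → Fin N) R') - φ y • flipOp := by
  ext I J
  simp only [Matrix.map_apply, Matrix.sub_apply, Matrix.smul_apply, smul_eq_mul, map_sub, map_mul,
    flipOp, permOp_apply, Matrix.one_apply]
  split_ifs <;> simp

theorem rttNeg_apply (φ : TwoVar N →+* S) (hφ : (rttNeg N).map φ = 0) (a b i j : Fin N) :
    φ (X - C X) * (φ (PowerSeries.map C (freeTPlus N a b)) * φ (C (freeTPlus N i j))) -
      φ (hTwo N) * (φ (PowerSeries.map C (freeTPlus N i b)) * φ (C (freeTPlus N a j))) =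
    φ (C (freeTPlus N i j)) * φ (PowerSeries.map C (freeTPlus N a b)) * φ (X - C X) -
      φ (C (freeTPlus N i b)) * φ (PowerSeries.map C (freeTPlus N a j)) * φ (hTwo N) := by
  rw [rttNeg, Matrix.map_sub _ (fun x y => map_sub φ x y), sub_eq_zero, Matrix.map_mul,
    Matrix.map_mul, Matrix.map_mul, Matrix.map_mul, yangPlus, map_sub_flip, first, second,
    atFactor_map, atFactor_map] at hφ
  exact rtt_apply hφ a b i j

theorem rttMixed_apply (φ : TwoVar N →+* S) (hφ : (rttMixed N).map φ = 0)
    (G : PowerSeries (FreeGen N) → TwoVar N)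
    (hG : G = fun y => compSeries
      (fun k => C (cst (FreeGen N) (coeff k (gSeries N)) * hIn (FreeGen N) ^ k)) (invSub y))
    (a b i j : Fin N) :
    φ (G (X - C (halfC N))) * (φ (PowerSeries.map C (freeT N a b)) * φ (C (freeTPlus N i j))) -
      φ (G (X - C (halfC N)) * (hTwo N * invSub (X - C (halfC N)))) *
        (φ (PowerSeries.map C (freeT N i b)) * φ (C (freeTPlus N a j))) =
    φ (C (freeTPlus N i j)) * φ (PowerSeries.map C (freeT N a b)) * φ (G (X + C (halfC N))) -
      φ (C (freeTPlus N i b)) * φ (PowerSeries.map C (freeT N a j)) *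
        φ (G (X + C (halfC N)) * (hTwo N * invSub (X + C (halfC N)))) := by
  have h : ∀ y, rBar N y = G y • 1 - (G y * (hTwo N * invSub y)) • flipOp := fun y => by
    rw [rBar, hG, smul_sub, smul_smul]
  rw [rttMixed, Matrix.map_sub _ (fun x y => map_sub φ x y), sub_eq_zero, Matrix.map_mul,
    Matrix.map_mul, Matrix.map_mul, Matrix.map_mul, h, h, map_sub_flip, map_sub_flip, first, second,
    atFactor_map, atFactor_map] at hφ
  exact rtt_apply hφ a b i j

end Relations

open PowerSeries

/-! ### Relations for the matrices `T⁺(ε u + α h)` -/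

section Division

variable {R : Type} [Ring R]

theorem coeff_X_sub_mul (E : PowerSeries (PowerSeries R)) (p q : ℕ) :
    coeff q (coeff (p + 1) ((X - C X) * E)) =
      coeff q (coeff p E) - if q = 0 then 0 else coeff (q - 1) (coeff (p + 1) E) := by
  rw [sub_mul, map_sub, map_sub, coeff_succ_X_mul, coeff_C_mul]
  rcases q with _ | q
  · simp
  · simp [coeff_succ_X_mul]

theorem coeff_zero_X_sub_mul (E : PowerSeries (PowerSeries R)) (q : ℕ) :
    coeff q (coeff 0 ((X - C X) * E)) = -if q = 0 then 0 else coeff (q - 1) (coeff 0 E) := by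
  rw [sub_mul, map_sub, map_sub, coeff_zero_X_mul, coeff_C_mul, map_zero, zero_sub]
  rcases q with _ | q
  · simp
  · simp [coeff_succ_X_mul]

/-- If `(u - v) E = h F` and `F` vanishes for `u = v`, then `E = h F'` with `(u - v) F' = F`. -/
theorem exists_div_sub {h : R} {E F : PowerSeries (PowerSeries R)}
    (hE : (X - C X) * E = C (C h) * F)
    (hF : ∀ q, ∑ k ∈ Finset.range (q + 1), coeff (q - k) (coeff k F) = 0) :
    ∃ F' : PowerSeries (PowerSeries R), E = C (C h) * F' ∧ (X - C X) * F' = F := by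
  -- The equation (u - v) F' = F reads F'_{p,q} = F_{p+1,q} + F'_{p+1,q-1}; iterating until the
  -- second index is exhausted gives this sum.
  refine ⟨PowerSeries.mk fun p => PowerSeries.mk fun q =>
    ∑ k ∈ Finset.range (q + 1), coeff (q - k) (coeff (p + 1 + k) F), ?_, ?_⟩
  · ext p q
    rw [coeff_C_mul, coeff_C_mul, coeff_mk, coeff_mk]
    have hrec : ∀ p q, coeff q (coeff p E) = h * coeff q (coeff (p + 1) F) +
        if q = 0 then 0 else coeff (q - 1) (coeff (p + 1) E) := by
      intro p q
      have := congrArg (fun f => coeff q (coeff (p + 1) f)) hE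
      simp only [coeff_X_sub_mul, coeff_C_mul] at this
      rw [← this]
      abel
    induction q generalizing p with
    | zero => rw [hrec]; simp
    | succ q ih =>
      rw [hrec, if_neg (Nat.succ_ne_zero q), Nat.add_sub_cancel, ih, Finset.sum_range_succ' _ (q + 1),
        mul_add, add_comm]
      congr 2
      refine Finset.sum_congr rfl fun k _ => ?_
      rw [Nat.add_sub_add_right, show p + 1 + 1 + k = p + 1 + (k + 1) by omega]
  · ext p q
    rcases p with _ | p
    · rw [coeff_zero_X_sub_mul, coeff_mk]
      rcases q with _ | q
      · have := hF 0
        simp at this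
        simp [this]
      · have := hF (q + 1)
        rw [Finset.sum_range_succ', Nat.sub_zero] at this
        rw [if_neg (Nat.succ_ne_zero q), Nat.add_sub_cancel, coeff_mk, ← sub_eq_zero, ← neg_eq_zero,
          ← this]
        rw [neg_sub, sub_neg_eq_add, add_comm]
        congr 1
        refine Finset.sum_congr rfl fun k _ => ?_
        rw [Nat.add_sub_add_right, show 0 + 1 + k = k + 1 by omega]
    · rw [coeff_X_sub_mul, coeff_mk, coeff_mk, coeff_mk]
      rcases q with _ | q
      · simp
      · rw [if_neg (Nat.succ_ne_zero q), Nat.add_sub_cancel, Finset.sum_range_succ' _ (q + 1),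
          coeff_mk, add_comm, add_sub_assoc]
        rw [show (∑ k ∈ Finset.range (q + 1), coeff (q + 1 - (k + 1)) (coeff (p + 1 + (k + 1)) F)) =
          ∑ k ∈ Finset.range (q + 1), coeff (q - k) (coeff (p + 1 + 1 + k) F) from
          Finset.sum_congr rfl fun k _ => by
            rw [Nat.add_sub_add_right, show p + 1 + 1 + k = p + 1 + (k + 1) by omega],
          sub_self, add_zero]
        rfl

end Division

/-! ### Specialization of both variables in the relations for T⁺ -/

section Specialization

variable (N : ℕ) (c : ℂ)

theorem coeff_coeff_map_C_mul_C {R : Type} [Ring R] (f g : PowerSeries R) (p q : ℕ) :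
    coeff q (coeff p (PowerSeries.map C f * C g)) = coeff p f * coeff q g := by
  rw [coeff_mul_C, coeff_map, coeff_C_mul]

theorem coeff_coeff_C_mul_map_C {R : Type} [Ring R] (f g : PowerSeries R) (p q : ℕ) :
    coeff q (coeff p (C g * PowerSeries.map C f)) = coeff q g * coeff p f := by
  rw [coeff_C_mul, coeff_map, coeff_mul_C]

/-- The evaluation of series in two variables at `u = ε₁ x + α₁ h`, `v = ε₂ x + α₂ h`. -/
def evalPt₂ (ε₁ α₁ ε₂ α₂ : ℂ) : PowerSeries (PowerSeries (DYHat N c)) →+* PowerSeries (DYHat N c) :=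
  (evalHom (evaluable_point (isHAdic_DYHat N c) ε₁ α₁)).comp
    (PowerSeries.map (evalPt (isHAdic_DYHat N c) ε₂ α₂))

variable {N c} (ε₁ α₁ ε₂ α₂ : ℂ)

theorem evalPt₂_map_C (f : PowerSeries (DYHat N c)) :
    evalPt₂ N c ε₁ α₁ ε₂ α₂ (PowerSeries.map C f) = evalPt (isHAdic_DYHat N c) ε₁ α₁ f := by
  have h : PowerSeries.map (evalPt (isHAdic_DYHat N c) ε₂ α₂) (PowerSeries.map C f) =
      PowerSeries.map C f := by
    ext1 n
    rw [coeff_map, coeff_map, evalPt_C]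
  rw [evalPt₂, RingHom.comp_apply, h]
  rfl

theorem evalPt₂_C (f : PowerSeries (DYHat N c)) :
    evalPt₂ N c ε₁ α₁ ε₂ α₂ (C f) = evalPt (isHAdic_DYHat N c) ε₂ α₂ f := by
  rw [evalPt₂, RingHom.comp_apply, map_C, evalHom_C]

theorem evalPt₂_X : evalPt₂ N c ε₁ α₁ ε₂ α₂ X = point _ ε₁ α₁ := by
  rw [evalPt₂, RingHom.comp_apply, map_X, evalHom_X]

theorem point_sub (A : Type) [Ring A] [Algebra Ch A] :
    point A ε₁ α₁ - point A ε₂ α₂ = point A (ε₁ - ε₂) (α₁ - α₂) := by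
  simp only [point, map_sub, sub_mul]
  abel

theorem X_sub_C_X_commute {R : Type} [Ring R] (E : PowerSeries (PowerSeries R)) :
    Commute (X - C X) E :=
  (PowerSeries.commute_X E).symm.sub_left (commute_C (fun f => (PowerSeries.commute_X f).symm) E)

theorem tPlusSer_rel (a b i j : Fin N) :
    (X - C X) * (PowerSeries.map C (tPlusSer N c a b) * C (tPlusSer N c i j) -
      C (tPlusSer N c i j) * PowerSeries.map C (tPlusSer N c a b)) =
    C (C (hIn (DYHat N c))) * (PowerSeries.map C (tPlusSer N c i b) * C (tPlusSer N c a j) -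
      C (tPlusSer N c i b) * PowerSeries.map C (tPlusSer N c a j)) := by
  have h := rttNeg_apply N (PowerSeries.map (PowerSeries.map (proj N c)))
    (map_proj_eq_zero N c (Or.inr (Or.inl rfl))) a b i j
  have h1 : ∀ a b, PowerSeries.map (PowerSeries.map (proj N c)) (PowerSeries.map C (freeTPlus N a b)) =
      PowerSeries.map C (tPlusSer N c a b) := by
    intro a b
    rw [← map_freeTPlus]
    ext1 k
    simp only [coeff_map, map_C]
  simp only [h1, map_C, map_freeTPlus, map_sub, map_X, hTwo, proj_hIn] at h
  have hH : ∀ E : PowerSeries (PowerSeries (DYHat N c)),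
      E * C (C (hIn (DYHat N c))) = C (C (hIn (DYHat N c))) * E := fun E =>
    (commute_C (fun f => commute_C (fun y => hIn_commute y) f) E).eq.symm
  rw [hH, ← (X_sub_C_X_commute (C (tPlusSer N c i j) * PowerSeries.map C (tPlusSer N c a b))).eq,
    sub_eq_sub_iff_add_eq_add] at h
  rw [mul_sub, mul_sub, sub_eq_sub_iff_add_eq_add, h, add_comm]

theorem matTPlus_rel (a b i j : Fin N) :
    point (DYHat N c) (ε₁ - ε₂) (α₁ - α₂) * (matTPlus N c ε₁ α₁ a b * matTPlus N c ε₂ α₂ i j -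
      matTPlus N c ε₂ α₂ i j * matTPlus N c ε₁ α₁ a b) =
    C (hIn (DYHat N c)) * (matTPlus N c ε₁ α₁ i b * matTPlus N c ε₂ α₂ a j -
      matTPlus N c ε₂ α₂ i b * matTPlus N c ε₁ α₁ a j) := by
  have h := congrArg (evalPt₂ N c ε₁ α₁ ε₂ α₂) (tPlusSer_rel (c := c) a b i j)
  simp only [map_mul, map_sub, evalPt₂_map_C, evalPt₂_C, evalPt₂_X, evalPt_X, evalPt_C,
    point_sub] at h
  simp only [matTPlus_eq]
  exact h

/-- For equal ε the factor u - v becomes (α₁ - α₂)h, and `matTPlus_rel` carries a superfluous h on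
both sides. Since the ring might have h-torsion, it is not cancelled: the relation is divided by u -
v first, giving E = hF' and (u - v)F' = F. After specialization F = (α₁ - α₂)hF' = (α₁ - α₂)E. -/
theorem matTPlus_rel_of_eq (ε : ℂ) (a b i j : Fin N) :
    C (cst (DYHat N c) (α₁ - α₂)) * (matTPlus N c ε α₁ a b * matTPlus N c ε α₂ i j -
      matTPlus N c ε α₂ i j * matTPlus N c ε α₁ a b) =
    matTPlus N c ε α₁ i b * matTPlus N c ε α₂ a j -
      matTPlus N c ε α₂ i b * matTPlus N c ε α₁ a j := by
  -- The right-hand side vanishes for u = v: its two sums are exchanged by the reflection k ↔ q - k.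
  obtain ⟨F', h1, h2⟩ := exists_div_sub (tPlusSer_rel (c := c) a b i j) (by
    intro q
    simp only [map_sub, coeff_coeff_map_C_mul_C, coeff_coeff_C_mul_map_C, Finset.sum_sub_distrib]
    rw [sub_eq_zero, ← Finset.sum_range_reflect]
    refine Finset.sum_congr rfl fun k hk => ?_
    have := Finset.mem_range.1 hk
    rw [show q + 1 - 1 - k = q - k by omega, show q - (q - k) = k by omega])
  have h1' := congrArg (evalPt₂ N c ε α₁ ε α₂) h1
  have h2' := congrArg (evalPt₂ N c ε α₁ ε α₂) h2
  simp only [map_mul, map_sub, evalPt₂_map_C, evalPt₂_C, evalPt₂_X, evalPt_X, evalPt_C,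
    point_sub, sub_self] at h1' h2'
  simp only [matTPlus_eq]
  rw [← h2', h1', ← mul_assoc]
  congr 1
  simp [point]

end Specialization

/-! ### Exchange relations on tensor powers -/

section TensorRelations

variable {N n : ℕ} {S : Type} [Ring S]

theorem mul_central_smul {S : Type} [Ring S] {z : S} (hz : ∀ s, Commute z s)
    {ι : Type} [Fintype ι] (F G : Matrix ι ι S) : F * (z • G) = z • (F * G) := by
  ext I J
  rw [Matrix.smul_apply, Matrix.mul_apply, Matrix.mul_apply, smul_eq_mul, Finset.mul_sum]
  refine Finset.sum_congr rfl fun K _ => ?_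
  rw [Matrix.smul_apply, smul_eq_mul, ← mul_assoc, ← (hz _).eq, mul_assoc]

/-- The relation between entries is the same for every pair of factors, as the entries in all the
other factors are those of the identity. -/
theorem tensor_rel {x y : S} (hx : ∀ s, Commute x s) (hy : ∀ s, Commute y s)
    {M M' : Matrix (Fin N) (Fin N) S} (h : ∀ a b i j,
      x * (M a b * M' i j - M' i j * M a b) = y * (M i b * M' a j - M' i b * M a j))
    {k l : Fin n} (hkl : k ≠ l) :
    (x • (1 : Matrix (Fin n → Fin N) (Fin n → Fin N) S) - y • permOp (Equiv.swap k l)) *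
      (atFactor k M * atFactor l M') =
    (atFactor l M' * atFactor k M) * (x • 1 - y • permOp (Equiv.swap k l)) := by
  rw [sub_mul, mul_sub, mul_central_smul hx, mul_central_smul hy, smul_mul_assoc, smul_mul_assoc, one_mul, mul_one]
  ext I J
  rw [Matrix.sub_apply, Matrix.sub_apply, Matrix.smul_apply, Matrix.smul_apply, Matrix.smul_apply,
    Matrix.smul_apply, permOp_mul_apply, mul_permOp_apply, Equiv.symm_swap,
    atFactor_mul_atFactor_apply hkl, atFactor_mul_atFactor_apply hkl,
    atFactor_mul_atFactor_apply hkl.symm, atFactor_mul_atFactor_apply hkl.symm]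
  have h1 : (∀ a, a ≠ k → a ≠ l → (I ∘ Equiv.swap k l) a = J a) ↔
      ∀ a, a ≠ k → a ≠ l → I a = J a := by
    refine forall_congr' fun a => forall_congr' fun hk => forall_congr' fun hl => ?_
    rw [Function.comp_apply, Equiv.swap_apply_of_ne_of_ne hk hl]
  have h2 : (∀ a, a ≠ l → a ≠ k → I a = (J ∘ Equiv.swap k l) a) ↔
      ∀ a, a ≠ k → a ≠ l → I a = J a := by
    constructor
    · intro h a hk hl
      have := h a hl hk
      rwa [Function.comp_apply, Equiv.swap_apply_of_ne_of_ne hk hl] at this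
    · intro h a hl hk
      rw [Function.comp_apply, Equiv.swap_apply_of_ne_of_ne hk hl, h a hk hl]
  have h3 : (∀ a, a ≠ l → a ≠ k → I a = J a) ↔ ∀ a, a ≠ k → a ≠ l → I a = J a :=
    ⟨fun h a hk hl => h a hl hk, fun h a hl hk => h a hk hl⟩
  rw [if_congr h1 rfl rfl, if_congr h2 rfl rfl, if_congr h3 rfl rfl]
  split_ifs with hIJ
  · have := h (I k) (J k) (I l) (J l)
    rw [mul_sub, mul_sub] at this
    simp only [Function.comp_apply, Equiv.swap_apply_left, Equiv.swap_apply_right, smul_eq_mul]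
    rw [sub_eq_sub_iff_add_eq_add] at this ⊢
    rw [this]
    abel
  · simp

end TensorRelations

/-! ### The exchange relations between `T` and `T⁺` -/

section Scalars

/-- The scalar series in `u` and `v⁻¹`. -/
abbrev ScalarSeries : Type := PowerSeries (PowerSeries Ch)

/-- The embedding of the scalar series. -/
def scal (A : Type) [Ring A] [Algebra Ch A] : ScalarSeries →+* PowerSeries (PowerSeries A) :=
  PowerSeries.map (PowerSeries.map (algebraMap Ch A))

variable {A : Type} [Ring A] [Algebra Ch A]

theorem commute_map_algebraMap (f : PowerSeries Ch) (g : PowerSeries A) :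
    Commute (PowerSeries.map (algebraMap Ch A) f) g := by
  ext n
  rw [coeff_mul, coeff_mul, ← Finset.Nat.sum_antidiagonal_swap]
  refine Finset.sum_congr rfl fun p _ => ?_
  rw [coeff_map]
  exact Algebra.commutes _ _

theorem scal_commute (f : ScalarSeries) (g : PowerSeries (PowerSeries A)) :
    Commute (scal A f) g := by
  ext1 n
  rw [coeff_mul, coeff_mul, ← Finset.Nat.sum_antidiagonal_swap]
  refine Finset.sum_congr rfl fun p _ => ?_
  rw [scal, coeff_map]
  exact (commute_map_algebraMap _ _).eq

/-- Complex numbers as constant scalar series in `u`. -/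
def cstScalar : ℂ →+* PowerSeries Ch := C.comp (cst Ch)

/-- The expansion of `h (v - y)⁻¹`. -/
def qAt (y : PowerSeries Ch) : ScalarSeries := C (C hh) * invSub y

theorem coeff_zero_qAt (y : PowerSeries Ch) : coeff 0 (qAt y) = 0 := by
  rw [qAt, coeff_C_mul]
  simp [invSub]

theorem hIn_Ch : hIn Ch = hh := rfl

theorem map_point (ε α : ℂ) :
    PowerSeries.map (algebraMap Ch A) (point Ch ε α) = point A ε α := by
  rw [point, map_add, map_mul, map_X, map_C, map_C, map_mul]
  rfl

theorem point_add (ε₁ α₁ ε₂ α₂ : ℂ) :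
    point A ε₁ α₁ + point A ε₂ α₂ = point A (ε₁ + ε₂) (α₁ + α₂) := by
  simp only [point, map_add, add_mul]
  abel

theorem neg_point (ε α : ℂ) : -point A ε α = point A (-ε) (-α) := by
  simp only [point, map_neg, neg_mul]
  abel

/-- Replacing y by y + mh lowers the inverse (v - y)/h of `qAt` by m. Clearing denominators gives
the stated form. -/
theorem qAt_shift (ε α m : ℂ) :
    (1 + C (cstScalar m) * qAt (point Ch ε (α + m))) * qAt (point Ch ε α) =
      qAt (point Ch ε (α + m)) := by
  have h1 := one_sub_mul_invSub (point Ch ε α)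
  have h2 := one_sub_mul_invSub (point Ch ε (α + m))
  have h3 : (C (point Ch ε (α + m)) : ScalarSeries) =
      C (point Ch ε α) + C (cstScalar m) * C (C hh) := by
    rw [← map_mul, ← map_add]
    congr 1
    rw [cstScalar, RingHom.comp_apply, ← map_mul]
    simp only [point, map_add, add_mul, hIn_Ch]
    abel
  rw [← sub_eq_zero]
  apply eq_zero_of_one_sub_mul (y := point Ch ε α)
  apply eq_zero_of_one_sub_mul (y := point Ch ε (α + m))
  rw [qAt, qAt]
  generalize invSub (point Ch ε α) = i₁ at *
  generalize invSub (point Ch ε (α + m)) = i₂ at *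
  generalize (C (point Ch ε (α + m)) : ScalarSeries) = y₂ at *
  generalize (C (point Ch ε α) : ScalarSeries) = y₁ at *
  generalize (C (C hh) : ScalarSeries) = H at *
  generalize (C (cstScalar m) : ScalarSeries) = m at *
  subst h3
  linear_combination (1 - (y₁ + m * H) * X) * H * h1 + m * H ^ 2 * X * h2 +
    m * H ^ 2 * (1 - (y₁ + m * H) * X) * i₂ * h1 - (1 - y₁ * X) * H * h2

theorem scal_small {s : ScalarSeries} (hs : Small s) : Small (scal A s) :=
  hs.map _ fun x y => commute_map_algebraMap x y

theorem substHom_scal {s : ScalarSeries} (hs : Small s) (f : ScalarSeries) :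
    substHom (scal_small (A := A) hs) (scal A f) = scal A (substHom hs f) := by
  rw [substHom_eq, substHom_eq, scal, map_compSeries]
  simp only [coeff_map]

theorem substHom_gAt {N : ℕ} {s q : ScalarSeries} (hs : Small s) (hq : Small q) :
    substHom hs (gAt cstScalar N q) = gAt cstScalar N (substHom hs q) := by
  rw [gAt_eq _ hq, gAt_eq _ (hs.substHom hq), substHom_substHom]

/-- The normalization g((v - y)/h) has the coefficients g_k hᵏ (v - y)⁻ᵏ; the powers of h are
collected into the argument h(v - y)⁻¹. -/
theorem scal_gAt (N : ℕ) (y : PowerSeries Ch) :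
    scal A (gAt cstScalar N (qAt y)) =
      compSeries (fun k => C (cst A (coeff k (gSeries N)) * hIn A ^ k))
        (invSub (PowerSeries.map (algebraMap Ch A) y)) := by
  rw [scal, gAt, map_compSeries]
  have h1 : PowerSeries.map (PowerSeries.map (algebraMap Ch A)) (qAt y) =
      C (C (hIn A)) * invSub (PowerSeries.map (algebraMap Ch A) y) := by
    rw [qAt, map_mul, map_C, map_C, map_invSub]
    rfl
  ext1 p
  rw [h1, compSeries, compSeries, coeff_mk, coeff_mk]
  refine Finset.sum_congr rfl fun k _ => ?_
  rw [(commute_C (commute_C hIn_commute) _).mul_pow, ← map_pow, ← map_pow, coeff_C_mul,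
    cstScalar, RingHom.comp_apply, map_C]
  have h2 : Commute (C (hIn A ^ k)) (coeff p (invSub (PowerSeries.map (algebraMap Ch A) y) ^ k)) :=
    commute_C (fun y => (hIn_commute y).pow_left k) _
  rw [h2.eq, mul_assoc, ← map_mul, ((hIn_commute (A := A) _).pow_left k).eq]
  rfl

end Scalars

/-! ### Exchange relations of T(v + hc) and T(-v) with T⁺ -/

section Mixed

variable (N : ℕ) (c : ℂ) (ε α : ℂ)

/-- The change of coefficients from the free algebra which specializes the second variable to
`ε u + α h`. -/
def specialize : TwoVar N →+* PowerSeries (PowerSeries (DYHat N c)) :=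
  PowerSeries.map ((evalPt (isHAdic_DYHat N c) ε α).comp (PowerSeries.map (proj N c)))

theorem specialize_mixed : (rttMixed N).map (specialize N c ε α) = 0 := by
  have h := map_proj_eq_zero N c (Or.inr (Or.inr rfl) : rttMixed N = _ ∨ _)
  have h2 : specialize N c ε α = (PowerSeries.map (evalPt (isHAdic_DYHat N c) ε α)).comp
      (PowerSeries.map (PowerSeries.map (proj N c))) := by
    refine RingHom.ext fun f => ?_
    ext1 k
    simp only [specialize, coeff_map, RingHom.comp_apply]
  ext1 I J
  rw [Matrix.map_apply, h2, RingHom.comp_apply]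
  have := congrFun (congrFun h I) J
  rw [Matrix.map_apply] at this
  rw [this]
  exact map_zero _

theorem specialize_C (i j : Fin N) :
    specialize N c ε α (C (freeTPlus N i j)) = C (matTPlus N c ε α i j) := by
  rw [specialize, map_C, RingHom.comp_apply, map_freeTPlus, matTPlus_eq]

theorem specialize_map_C (i j : Fin N) :
    specialize N c ε α (PowerSeries.map C (freeT N i j)) = PowerSeries.map C (tSer N c i j) := by
  rw [← map_freeT]
  ext1 k
  simp only [specialize, coeff_map, RingHom.comp_apply, map_C, evalPt_C]

theorem specialize_hTwo : specialize N c ε α (hTwo N) = scal _ (C (C hh)) := by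
  rw [specialize, hTwo, map_C, RingHom.comp_apply, map_C, proj_hIn, evalPt_C, scal, map_C, map_C]
  rfl

theorem specialize_invSub (y : PowerSeries (FreeGen N)) (y₀ : PowerSeries Ch)
    (hy : evalPt (isHAdic_DYHat N c) ε α (PowerSeries.map (proj N c) y) =
      PowerSeries.map (algebraMap Ch _) y₀) :
    specialize N c ε α (invSub y) = scal _ (invSub y₀) := by
  rw [specialize, map_invSub, RingHom.comp_apply, hy, scal, map_invSub]

theorem specialize_g (y : PowerSeries (FreeGen N)) (y₀ : PowerSeries Ch)
    (hy : evalPt (isHAdic_DYHat N c) ε α (PowerSeries.map (proj N c) y) =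
      PowerSeries.map (algebraMap Ch _) y₀) :
    specialize N c ε α (compSeries
      (fun k => C (cst (FreeGen N) (coeff k (gSeries N)) * hIn (FreeGen N) ^ k)) (invSub y)) =
      scal _ (gAt cstScalar N (qAt y₀)) := by
  rw [scal_gAt, specialize, map_compSeries, map_invSub, RingHom.comp_apply, hy]
  simp only [RingHom.comp_apply, map_C, evalPt_C, map_mul, map_pow, proj_cst, proj_hIn]

theorem specialize_halfC :
    PowerSeries.map (proj N c) (C (halfC N)) = point (DYHat N c) 0 (c / 2) := by
  have h : proj N c (halfC N) = cst (DYHat N c) (c / 2) * hIn (DYHat N c) := by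
    rw [halfC, map_mul, map_mul, proj_cst, proj_hIn, proj_gen_C, mul_assoc,
      (hIn_commute (cst (DYHat N c) c)).eq, ← mul_assoc, ← map_mul]
    congr 2
    ring
  rw [map_C, h]
  simp [point]

theorem mixed_rel (a b i j : Fin N) :
    scal _ (gAt cstScalar N (qAt (point Ch ε (α - c / 2)))) *
      (PowerSeries.map C (tSer N c a b) * C (matTPlus N c ε α i j) -
        scal _ (qAt (point Ch ε (α - c / 2))) *
          (PowerSeries.map C (tSer N c i b) * C (matTPlus N c ε α a j))) =
    scal _ (gAt cstScalar N (qAt (point Ch ε (α + c / 2)))) *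
      (C (matTPlus N c ε α i j) * PowerSeries.map C (tSer N c a b) -
        scal _ (qAt (point Ch ε (α + c / 2))) *
          (C (matTPlus N c ε α i b) * PowerSeries.map C (tSer N c a j))) := by
  have h := rttMixed_apply N (specialize N c ε α) (specialize_mixed N c ε α) _ rfl a b i j
  have e1 : evalPt (isHAdic_DYHat N c) ε α (PowerSeries.map (proj N c) (X - C (halfC N))) =
      PowerSeries.map (algebraMap Ch _) (point Ch ε (α - c / 2)) := by
    have h0 : ∀ x : ℂ, point (DYHat N c) 0 x = C (cst _ x * hIn _) := fun x => by simp [point]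
    rw [map_sub, map_X, specialize_halfC, map_sub, evalPt_X, map_point, h0, evalPt_C, ← h0,
      point_sub, sub_zero]
  have e2 : evalPt (isHAdic_DYHat N c) ε α (PowerSeries.map (proj N c) (X + C (halfC N))) =
      PowerSeries.map (algebraMap Ch _) (point Ch ε (α + c / 2)) := by
    have h0 : ∀ x : ℂ, point (DYHat N c) 0 x = C (cst _ x * hIn _) := fun x => by simp [point]
    rw [map_add, map_X, specialize_halfC, map_add, evalPt_X, map_point, h0, evalPt_C, ← h0,
      point_add, add_zero]
  simp only [map_mul (specialize N c ε α), specialize_C, specialize_map_C, specialize_hTwo,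
    specialize_invSub N c ε α _ _ e1, specialize_invSub N c ε α _ _ e2,
    specialize_g N c ε α _ _ e1, specialize_g N c ε α _ _ e2] at h
  simp only [← map_mul (scal (DYHat N c))] at h
  rw [← (scal_commute (A := DYHat N c) _ _).eq, ← (scal_commute (A := DYHat N c) _ _).eq] at h
  simp only [map_mul (scal (DYHat N c)), qAt, mul_sub] at h ⊢
  simpa only [mul_assoc] using h

/-- The exchange relation between the matrices `T(x)`, for `x⁻¹` expanded as the scalar series
`s`, and `T⁺(ε u + α h)`. -/
theorem mixed_rel_subst {s : ScalarSeries} (hs : Small s) (s' : PowerSeries (DYHat N c))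
    (hs' : scal _ s = PowerSeries.map C s') (h' : Small s')
    (a b i j : Fin N) :
    scal _ (gAt cstScalar N (substHom hs (qAt (point Ch ε (α - c / 2))))) *
      (PowerSeries.map C (matT N c s' a b) * C (matTPlus N c ε α i j) -
        scal _ (substHom hs (qAt (point Ch ε (α - c / 2)))) *
          (PowerSeries.map C (matT N c s' i b) * C (matTPlus N c ε α a j))) =
    scal _ (gAt cstScalar N (substHom hs (qAt (point Ch ε (α + c / 2))))) *
      (C (matTPlus N c ε α i j) * PowerSeries.map C (matT N c s' a b) -
        scal _ (substHom hs (qAt (point Ch ε (α + c / 2)))) *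
          (C (matTPlus N c ε α i b) * PowerSeries.map C (matT N c s' a j))) := by
  have h := congrArg (substHom (scal_small (A := DYHat N c) hs)) (mixed_rel N c ε α a b i j)
  have hT : ∀ a b, substHom (scal_small (A := DYHat N c) hs) (PowerSeries.map C (tSer N c a b)) =
      PowerSeries.map C (matT N c s' a b) := by
    intro a b
    rw [matT_eq N c h', substHom_eq, substHom_eq, map_compSeries, hs']
    simp only [coeff_map]
  have hq : ∀ y, Small (qAt y) := fun y => Small.of_coeff_zero (coeff_zero_qAt y)
  have hsc : ∀ f, substHom (scal_small (A := DYHat N c) hs) (scal _ f) =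
      scal _ (substHom hs f) := substHom_scal hs
  have hg : ∀ y, substHom hs (gAt cstScalar N (qAt y)) = gAt cstScalar N (substHom hs (qAt y)) :=
    fun y => substHom_gAt hs (hq y)
  simp only [map_mul, map_sub, hT, substHom_C, hsc, hg] at h
  exact h

instance scalAlgebra (A : Type) [Ring A] [Algebra Ch A] :
    Algebra ScalarSeries (PowerSeries (PowerSeries A)) :=
  (scal A).toAlgebra' scal_commute

/-- The factor `g(q)` of the normalized `R`-matrix. -/
def gS (q : ScalarSeries) : ScalarSeries := gAt cstScalar N q

/-- The matrix `T(v + hc)`. -/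
def tUp : Matrix (Fin N) (Fin N) (PowerSeries (PowerSeries (DYHat N c))) :=
  (matT N c (invSub (-(hIn (DYHat N c) * cst (DYHat N c) c)))).map (PowerSeries.map C)

/-- The matrix `T(-v)`. -/
def tNegV : Matrix (Fin N) (Fin N) (PowerSeries (PowerSeries (DYHat N c))) :=
  (matT N c (-X)).map (PowerSeries.map C)

/-- The matrix `T⁺(ε u + α h)`. -/
def tP : Matrix (Fin N) (Fin N) (PowerSeries (PowerSeries (DYHat N c))) :=
  (matTPlus N c ε α).map C

/-- The substitution v ↦ v + hc lowers the shifts α ∓ c/2 of the two R-matrices by c. On the right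
this gives α + c/2 - c = α - c/2. -/
theorem tUp_rel (a b i j : Fin N) :
    gS N (qAt (point Ch ε (α - 3 * c / 2))) • (tUp N c a b * tP N c ε α i j -
      qAt (point Ch ε (α - 3 * c / 2)) • (tUp N c i b * tP N c ε α a j)) =
    gS N (qAt (point Ch ε (α - c / 2))) • (tP N c ε α i j * tUp N c a b -
      qAt (point Ch ε (α - c / 2)) • (tP N c ε α i b * tUp N c a j)) := by
  have hs : Small (invSub (point Ch 0 (-c))) := small_invSub fun x => Commute.all _ _
  have e : C (-(hIn (DYHat N c) * cst (DYHat N c) c)) = point (DYHat N c) 0 (-c) := by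
    rw [(hIn_commute (cst (DYHat N c) c)).eq]
    simp [point]
  have hs' : scal (DYHat N c) (invSub (point Ch 0 (-c))) =
      PowerSeries.map C (invSub (-(hIn (DYHat N c) * cst (DYHat N c) c))) := by
    rw [scal, map_invSub, map_invSub, map_point, e]
  have h' : Small (invSub (-(hIn (DYHat N c) * cst (DYHat N c) c))) :=
    small_invSub fun x => ((hIn_commute x).mul_left (cst_commute c x)).neg_left
  have hq : ∀ x : ℂ, substHom hs (qAt (point Ch ε x)) = qAt (point Ch ε (x - c)) := by
    intro x
    rw [qAt, map_mul, substHom_C, substHom_invSub (fun x => Commute.all _ _) fun x => Commute.all _ _, point_add, zero_add, neg_add_eq_sub]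
    rfl
  have h := mixed_rel_subst N c ε α hs _ hs' h' a b i j
  rw [hq, hq] at h
  rw [show α - c / 2 = α + c / 2 - c by ring, show α - 3 * c / 2 = α - c / 2 - c by ring]
  exact h

/-- Here h(-v - y)⁻¹ = -h(v + y)⁻¹, so the parameters change sign and y is replaced by -y. -/
theorem tNegV_rel (a b i j : Fin N) :
    gS N (-qAt (point Ch (-ε) (-α + c / 2))) • (tNegV N c a b * tP N c ε α i j -
      (-qAt (point Ch (-ε) (-α + c / 2))) • (tNegV N c i b * tP N c ε α a j)) =
    gS N (-qAt (point Ch (-ε) (-α - c / 2))) • (tP N c ε α i j * tNegV N c a b -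
      (-qAt (point Ch (-ε) (-α - c / 2))) • (tP N c ε α i b * tNegV N c a j)) := by
  have hs : Small (-X : ScalarSeries) := small_neg_X
  have h' : Small (-X : PowerSeries (DYHat N c)) := small_neg_X
  have hs' : scal (DYHat N c) (-X) = PowerSeries.map C (-X) := by
    rw [scal, map_neg, map_neg, map_X, map_X]
  have hq : ∀ x : ℂ, substHom hs (qAt (point Ch ε x)) = -qAt (point Ch (-ε) (-x)) := by
    intro x
    rw [qAt, map_mul, substHom_C, substHom_neg_X_invSub, neg_point, mul_neg]
    rfl
  have h := mixed_rel_subst N c ε α hs _ hs' h' a b i j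
  rw [hq, hq] at h
  rw [show -α + c / 2 = -(α - c / 2) by ring, show -α - c / 2 = -(α + c / 2) by ring]
  exact h

end Mixed

/-! ### Symmetrizers -/

section Symmetrizers

variable {N n : ℕ} {S : Type} [Ring S]

theorem absorbs_intCast {K : Type} [CommRing K] [Algebra K S] {e : ℤ} {s : Set (Fin n)}
    {Θ : Matrix (Fin n → Fin N) (Fin n → Fin N) S} :
    Absorbs (e : K) s Θ ↔ Absorbs e s Θ := by
  have h : (e : K) • Θ = e • Θ := by
    ext I J
    rw [Matrix.smul_apply, Matrix.smul_apply, Int.cast_smul_eq_zsmul]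
  simp only [Absorbs, h]

/-- `Absorbs` for an integral sign. -/
abbrev SignAbsorbs (e : ℤ) (s : Set (Fin n))
    (Θ : Matrix (Fin n → Fin N) (Fin n → Fin N) S) : Prop := Absorbs e s Θ

theorem IsSymm.signAbsorbs {e : ℤ} {Q : Matrix (Fin n → Fin N) (Fin n → Fin N) S}
    (h : IsSymm e Q) : SignAbsorbs e Set.univ Q := h.right

theorem IsSymm.intCast {K : Type} [CommRing K] [Algebra K S] {e : ℤ}
    {Q : Matrix (Fin n → Fin N) (Fin n → Fin N) S} (h : IsSymm e Q) : IsSymm (e : K) Q where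
  right := absorbs_intCast.2 h.right
  left i j hij := by
    rw [h.left i j hij]
    ext I J
    rw [Matrix.smul_apply, Matrix.smul_apply, Int.cast_smul_eq_zsmul]
  central := h.central
  absorb Θ hΘ := h.absorb Θ (absorbs_intCast.1 hΘ)

theorem Absorbs.map {S' : Type} [Ring S'] (φ : S →+* S') {e : ℤ} {s : Set (Fin n)}
    {Θ : Matrix (Fin n → Fin N) (Fin n → Fin N) S} (h : Absorbs e s Θ) :
    Absorbs e s (Θ.map φ) := by
  intro i hi j hj hij
  rw [← permOp_map φ, ← Matrix.map_mul, h i hi j hj hij]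
  ext I J
  rw [Matrix.map_apply, Matrix.smul_apply, Matrix.smul_apply, Matrix.map_apply, map_zsmul]

/-- The operator `(1/n!) ∑ χ(s) s` for a character `χ` of the symmetric group. -/
def projector (N : ℕ) {n : ℕ} (χ : Equiv.Perm (Fin n) →* ℤˣ) :
    Matrix (Fin n → Fin N) (Fin n → Fin N) ℂ :=
  (n.factorial : ℂ)⁻¹ • ∑ σ : Equiv.Perm (Fin n), ((χ σ : ℤ) : ℂ) • permOp σ

theorem symmetrizer_eq_projector : symmetrizer N n = projector N 1 := by
  simp [symmetrizer, projector]

theorem antisymmetrizer_eq_projector : antisymmetrizer N n = projector N Equiv.Perm.sign := rfl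

theorem projector_map [Algebra ℂ S] (χ : Equiv.Perm (Fin n) →* ℤˣ) :
    (projector N χ).map (algebraMap ℂ S) =
      (n.factorial : ℂ)⁻¹ • ∑ σ : Equiv.Perm (Fin n), (χ σ : ℤ) • permOp σ := by
  ext I J
  rw [Matrix.map_apply, projector, Matrix.smul_apply, Matrix.smul_apply, Matrix.sum_apply,
    Matrix.sum_apply, smul_eq_mul, map_mul, map_sum, Algebra.smul_def]
  congr 1
  refine Finset.sum_congr rfl fun σ _ => ?_
  rw [Matrix.smul_apply, Matrix.smul_apply, permOp_apply, permOp_apply]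
  split_ifs <;> simp

theorem Absorbs.mul_permOp {χ : Equiv.Perm (Fin n) →* ℤˣ} {e : ℤ}
    (hχ : ∀ i j, i ≠ j → (χ (Equiv.swap i j) : ℤ) = e)
    {Θ : Matrix (Fin n → Fin N) (Fin n → Fin N) S} (h : Absorbs e Set.univ Θ)
    (σ : Equiv.Perm (Fin n)) : Θ * permOp σ = (χ σ : ℤ) • Θ := by
  induction σ using Equiv.Perm.swap_induction_on with
  | one => simp [permOp_one]
  | swap_mul f x y hxy ih =>
    rw [← permOp_mul, ← mul_assoc, h x trivial y trivial hxy, smul_mul_assoc, ih, smul_smul,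
      map_mul, Units.val_mul, hχ x y hxy]

theorem isSymm_projector [Algebra ℂ S] {χ : Equiv.Perm (Fin n) →* ℤˣ} {e : ℤ}
    (hχ : ∀ i j, i ≠ j → (χ (Equiv.swap i j) : ℤ) = e) :
    IsSymm e ((projector N χ).map (algebraMap ℂ S)) where
  right i _ j _ hij := by
    have he : e * e = 1 := by
      rw [← hχ i j hij, ← Units.val_mul, ← map_mul, Equiv.swap_mul_self, map_one, Units.val_one]
    rw [projector_map, smul_mul_assoc, Finset.sum_mul, smul_comm e]
    congr 1
    rw [Finset.smul_sum, ← Equiv.sum_comp (Equiv.mulRight (Equiv.swap i j))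
        fun σ => e • (χ σ : ℤ) • (permOp σ : Matrix (Fin n → Fin N) (Fin n → Fin N) S)]
    refine Finset.sum_congr rfl fun σ _ => ?_
    rw [smul_mul_assoc, permOp_mul, Equiv.coe_mulRight, map_mul, Units.val_mul, hχ i j hij,
      smul_smul, mul_left_comm, he, mul_one]
  left i j hij := by
    have he : e * e = 1 := by
      rw [← hχ i j hij, ← Units.val_mul, ← map_mul, Equiv.swap_mul_self, map_one, Units.val_one]
    rw [projector_map, mul_smul_comm, Finset.mul_sum, smul_comm e]
    congr 1
    rw [Finset.smul_sum, ← Equiv.sum_comp (Equiv.mulLeft (Equiv.swap i j))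
        fun σ => e • (χ σ : ℤ) • (permOp σ : Matrix (Fin n → Fin N) (Fin n → Fin N) S)]
    refine Finset.sum_congr rfl fun σ _ => ?_
    rw [mul_smul_comm, permOp_mul, Equiv.coe_mulLeft, map_mul, Units.val_mul, hχ i j hij,
      smul_smul, ← mul_assoc, he, one_mul]
  central I J x := Algebra.commutes _ x
  absorb Θ h := by
    rw [projector_map, mul_smul_comm, Finset.mul_sum]
    have : ∀ σ : Equiv.Perm (Fin n), Θ * (χ σ : ℤ) • permOp σ = Θ := by
      intro σ
      rw [mul_smul_comm, h.mul_permOp hχ, smul_smul, ← Units.val_mul, ← sq, Int.units_sq,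
        Units.val_one, one_smul]
    rw [Finset.sum_congr rfl fun σ _ => this σ, Finset.sum_const, Finset.card_univ,
      Fintype.card_perm, Fintype.card_fin, ← Nat.cast_smul_eq_nsmul ℂ, smul_smul,
      inv_mul_cancel₀ (by exact_mod_cast n.factorial_ne_zero), one_smul]

end Symmetrizers

/-! ### Absorption of transpositions by ordered products -/

section Absorption

variable {N n : ℕ} {S : Type} [Ring S]

/-- The matrix `M k` in the `k`-th tensor factor. -/
def atNat (n : ℕ) (M : ℕ → Matrix (Fin N) (Fin N) S) (k : ℕ) :
    Matrix (Fin n → Fin N) (Fin n → Fin N) S :=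
  if h : k < n then atFactor ⟨k, h⟩ (M k) else 1

theorem atNat_of_lt (M : ℕ → Matrix (Fin N) (Fin N) S) {k : ℕ} (h : k < n) :
    atNat n M k = atFactor ⟨k, h⟩ (M k) := dif_pos h

/-- The product of the first `k` matrices of a sequence in consecutive tensor factors. -/
def ordProd (n : ℕ) (M : ℕ → Matrix (Fin N) (Fin N) S) (k : ℕ) :
    Matrix (Fin n → Fin N) (Fin n → Fin N) S :=
  ((List.range k).map (atNat n M)).prod

theorem ordProd_zero (M : ℕ → Matrix (Fin N) (Fin N) S) : ordProd n M 0 = 1 := by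
  simp [ordProd]

theorem ordProd_succ (M : ℕ → Matrix (Fin N) (Fin N) S) (k : ℕ) :
    ordProd n M (k + 1) = ordProd n M k * atNat n M k := by
  rw [ordProd, List.prod_range_succ, ordProd]

theorem ordProd_eq_ofFn (M : ℕ → Matrix (Fin N) (Fin N) S) :
    ordProd n M n = (List.ofFn fun k : Fin n => atFactor k (M k)).prod := by
  rw [ordProd, ← List.map_coe_finRange_eq_range, List.map_map, List.ofFn_eq_map]
  congr 1
  refine List.map_congr_left fun k _ => ?_
  rw [Function.comp_apply, atNat_of_lt _ k.2]

theorem commute_atFactor_swap {i j k : Fin n} (hi : k ≠ i) (hj : k ≠ j)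
    (M : Matrix (Fin N) (Fin N) S) :
    Commute (atFactor k M) (permOp (Equiv.swap i j)) := by
  rw [commute_iff_eq, permOp_mul_atFactor, Equiv.swap_apply_of_ne_of_ne hi hj]

theorem Absorbs.mul {e : ℤ} {s : Set (Fin n)}
    {Θ X : Matrix (Fin n → Fin N) (Fin n → Fin N) S} (hΘ : Absorbs e s Θ)
    (hX : ∀ i ∈ s, ∀ j ∈ s, Commute X (permOp (Equiv.swap i j))) : Absorbs e s (Θ * X) := by
  intro i hi j hj hij
  rw [mul_assoc, (hX i hi j hj).eq, ← mul_assoc, hΘ i hi j hj hij, smul_mul_assoc]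

/-- The exchange relation between consecutive factors for which the symmetrization of the product
is symmetric. -/
def AdjacentExchange (n : ℕ) (e : ℤ) (M : ℕ → Matrix (Fin N) (Fin N) S) : Prop :=
  ∀ (k : ℕ) (hk : k + 1 < n),
    (1 + e • permOp (Equiv.swap ⟨k, by omega⟩ ⟨k + 1, hk⟩)) *
        (atNat n M k * atNat n M (k + 1)) =
      atNat n M (k + 1) * atNat n M k *
        (1 + e • permOp (Equiv.swap ⟨k, by omega⟩ ⟨k + 1, hk⟩))

/-- The factors M_0, …, M_{k-1} already placed and the factors from k on are symmetric separately;
M_k must be joined to the first group. The transposition of the last two placed factors comes from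
the exchange relation, and it generates the remaining ones. -/
theorem absorbs_ordProd {e : ℤ} (he : e * e = 1) (h2 : ∀ x : S, x + x = 0 → x = 0)
    {M : ℕ → Matrix (Fin N) (Fin N) S} (hM : AdjacentExchange n e M) (m : ℕ)
    {Θ : Matrix (Fin n → Fin N) (Fin n → Fin N) S} (hΘ : Absorbs e {i | (i : ℕ) < m} Θ) (k : ℕ)
    (hkm : k ≤ m) (hkn : k ≤ n) :
    Absorbs e {i | (i : ℕ) < k} (Θ * ordProd n M k) ∧
      Absorbs e {i | k ≤ (i : ℕ) ∧ (i : ℕ) < m} (Θ * ordProd n M k) := by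
  have hup : ∀ k, k ≤ n → Absorbs e {i | k ≤ (i : ℕ) ∧ (i : ℕ) < m} (Θ * ordProd n M k) := by
    intro k hk
    induction k with
    | zero =>
      rw [ordProd_zero, mul_one]
      intro i hi j hj hij
      exact hΘ i hi.2 j hj.2 hij
    | succ k ih =>
      rw [ordProd_succ, ← mul_assoc]
      refine Absorbs.mul (fun i hi j hj hij => ih (by omega) i ⟨?_, hi.2⟩ j ⟨?_, hj.2⟩ hij) ?_
      · exact (Nat.le_succ k).trans hi.1
      · exact (Nat.le_succ k).trans hj.1
      · intro i hi j hj
        rw [atNat_of_lt _ (by omega : k < n)]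
        refine commute_atFactor_swap (fun h => ?_) (fun h => ?_) _
        · have := hi.1
          rw [← h] at this
          exact absurd this (by simp)
        · have := hj.1
          rw [← h] at this
          exact absurd this (by simp)
  refine ⟨?_, hup k hkn⟩
  induction k with
  | zero => intro i hi; exact absurd hi (by simp)
  | succ k ih =>
    have ih := ih (by omega) (by omega)
    have hk : k < n := by omega
    have hlow : Absorbs e {i | (i : ℕ) < k} (Θ * ordProd n M (k + 1)) := by
      rw [ordProd_succ, ← mul_assoc]
      refine ih.mul fun i hi j hj => ?_
      rw [atNat_of_lt _ hk]
      refine commute_atFactor_swap (fun h => ?_) (fun h => ?_) _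
      · rw [← h] at hi
        exact absurd hi (by simp)
      · rw [← h] at hj
        exact absurd hj (by simp)
    have hlast : ∀ i : Fin n, (i : ℕ) + 1 = k → Θ * ordProd n M (k + 1) *
        permOp (Equiv.swap i ⟨k, hk⟩) = e • (Θ * ordProd n M (k + 1)) := by
      rintro ⟨i, hi⟩ rfl
      have h0 := hup i (by omega) ⟨i, hi⟩ ⟨le_refl i, by simp only at hkm ⊢; omega⟩ ⟨i + 1, hk⟩
        ⟨Nat.le_succ i, hkm⟩ (by simp)
      have h1 := hM i hk
      generalize hP : (permOp (Equiv.swap ⟨i, hi⟩ ⟨i + 1, hk⟩) :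
        Matrix (Fin n → Fin N) (Fin n → Fin N) S) = P at *
      have hPP : P * P = 1 := by
        rw [← hP, permOp_mul, Equiv.swap_mul_self, permOp_one]
      rw [ordProd_succ, ordProd_succ, mul_assoc (ordProd n M i), ← mul_assoc Θ]
      generalize Θ * ordProd n M i = Y at *
      -- The operator Y before the last two factors absorbs P, so 2Y = Y(1 + eP). The exchange
      -- relation moves 1 + eP to the right of Z, where 1 - eP kills it; dividing by 2 gives YZ =
      -- eYZP.
      have h3 : (1 + e • P) * (1 - e • P) = 0 := by
        rw [mul_sub, mul_one, mul_smul_comm, add_mul, one_mul, smul_mul_assoc, hPP, smul_add,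
          smul_smul, he, one_smul]
        abel
      have h4 : Y * (1 + e • P) = Y + Y := by
        rw [mul_add, mul_one, mul_smul_comm, h0, smul_smul, he, one_smul]
      generalize atNat n M i * atNat n M (i + 1) = Z at *
      have h5 : Y * Z * (1 - e • P) = 0 := by
        have : Y * Z * (1 - e • P) + Y * Z * (1 - e • P) = 0 := by
          calc _ = (Y + Y) * Z * (1 - e • P) := by simp only [add_mul]
            _ = Y * ((1 + e • P) * Z) * (1 - e • P) := by rw [← h4]; simp only [mul_assoc]
            _ = Y * (atNat n M (i + 1) * atNat n M i) * ((1 + e • P) * (1 - e • P)) := by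
              rw [h1]; simp only [mul_assoc]
            _ = 0 := by rw [h3, mul_zero]
        ext I J
        exact h2 _ (congrFun (congrFun this I) J)
      rw [mul_sub, mul_one, mul_smul_comm, sub_eq_zero] at h5
      nth_rewrite 2 [h5]
      rw [smul_smul, he, one_smul]
    have hk1 : ∀ i : Fin n, (i : ℕ) < k → Θ * ordProd n M (k + 1) *
        permOp (Equiv.swap i ⟨k, hk⟩) = e • (Θ * ordProd n M (k + 1)) := by
      intro i hi
      by_cases hik : (i : ℕ) + 1 = k
      · exact hlast i hik
      · have hj : k - 1 < n := by omega
        have h1 := hlast ⟨k - 1, hj⟩ (by simp; omega)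
        have h2 := hlow i hi ⟨k - 1, hj⟩ (by simp; omega) (by
          intro h; rw [h] at hik; simp at hik; omega)
        -- The transposition (i k) is the conjugate of (i k-1) by (k-1 k), and both of these are
        -- known to be absorbed.
        have hsw : Equiv.swap i ⟨k, hk⟩ = Equiv.swap (⟨k - 1, hj⟩ : Fin n) ⟨k, hk⟩ *
            (Equiv.swap i ⟨k - 1, hj⟩ * Equiv.swap ⟨k - 1, hj⟩ ⟨k, hk⟩) := by
          rw [← mul_assoc, Equiv.swap_mul_swap_mul_swap, Equiv.swap_comm]
          · exact fun h => hik (by rw [h]; simp; omega)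
          · exact fun h => by simp [h] at hi
        rw [hsw, ← permOp_mul, ← permOp_mul, ← mul_assoc, ← mul_assoc, h1, smul_mul_assoc, h2,
          smul_mul_assoc, smul_mul_assoc, h1, smul_smul, smul_smul, he, one_mul]
    intro i hi j hj hij
    rcases Nat.lt_succ_iff_lt_or_eq.1 hi with hi | hi <;>
      rcases Nat.lt_succ_iff_lt_or_eq.1 hj with hj | hj
    · exact hlow i hi j hj hij
    · obtain rfl : j = ⟨k, hk⟩ := Fin.ext hj
      exact hk1 i hi
    · obtain rfl : i = ⟨k, hk⟩ := Fin.ext hi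
      rw [Equiv.swap_comm]
      exact hk1 j hj
    · exact absurd (Fin.ext (hi.trans hj.symm)) hij

end Absorption

/-! ### The ordered products in the two trace series -/

section Concrete

variable (N : ℕ) (c : ℂ) (n : ℕ) (e : ℤ)

/-- The matrices `T⁺(u + e k h)`. -/
def seqT (k : ℕ) : Matrix (Fin N) (Fin N) (PowerSeries (DYHat N c)) := matTPlus N c 1 (e * k)

/-- The matrices `T⁺(-u - e k h)`. -/
def seqTNeg (k : ℕ) : Matrix (Fin N) (Fin N) (PowerSeries (DYHat N c)) :=
  matTPlus N c (-1) (-e * k)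

/-- The matrices `T⁺(-u - e k h)⁻¹`. -/
def seqInv (k : ℕ) : Matrix (Fin N) (Fin N) (PowerSeries (DYHat N c)) :=
  Ring.inverse (seqTNeg N c e k)

theorem seqTNeg_mul_seqInv (k : ℕ) : seqTNeg N c e k * seqInv N c e k = 1 :=
  Ring.mul_inverse_cancel _ (isUnit_matTPlus N c _ _)

theorem seqInv_mul_seqTNeg (k : ℕ) : seqInv N c e k * seqTNeg N c e k = 1 :=
  Ring.inverse_mul_cancel _ (isUnit_matTPlus N c _ _)

variable {N c} in
theorem eq_zero_of_add_self (x : PowerSeries (DYHat N c)) (h : x + x = 0) : x = 0 := by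
  have : cstSeries N c (1 / 2) * (x + x) = x := by
    rw [mul_add, ← add_mul, ← map_add]
    norm_num
  rw [← this, h, mul_zero]

/-- At u - v = -eh the operator (u - v) - hP equals -eh(1 + eP). -/
theorem atFactor_rel_of_eq {e : ℤ} (he : e * e = 1) (ε α₁ α₂ : ℂ) (hα : α₁ - α₂ = -e) {k l : Fin n}
    (hkl : k ≠ l) :
    (1 + e • permOp (Equiv.swap k l)) *
        (atFactor k (matTPlus N c ε α₁) * atFactor l (matTPlus N c ε α₂)) =
      atFactor l (matTPlus N c ε α₂) * atFactor k (matTPlus N c ε α₁) *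
        (1 + e • permOp (Equiv.swap k l)) := by
  have h := tensor_rel (S := PowerSeries (DYHat N c)) (x := ((-e : ℤ) : PowerSeries (DYHat N c)))
    (y := 1) (fun _ => Int.cast_commute _ _) (fun _ => Commute.one_left _)
    (M := matTPlus N c ε α₁) (M' := matTPlus N c ε α₂) (fun a b i j => by
      have := matTPlus_rel_of_eq α₁ α₂ ε a b i j (N := N) (c := c)
      rw [hα, map_neg, map_neg, map_intCast, map_intCast] at this
      rw [one_mul, Int.cast_neg, this]) hkl
  have h1 : (1 + e • permOp (Equiv.swap k l) :
      Matrix (Fin n → Fin N) (Fin n → Fin N) (PowerSeries (DYHat N c))) =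
      (-e) • (((-e : ℤ) : PowerSeries (DYHat N c)) • 1 -
        (1 : PowerSeries (DYHat N c)) • permOp (Equiv.swap k l)) := by
    rw [Int.cast_smul_eq_zsmul, one_smul, smul_sub, smul_smul, neg_mul_neg, he, one_smul, neg_smul,
      sub_neg_eq_add]
  rw [h1, smul_mul_assoc, h, mul_smul_comm]

theorem adjacentExchange_seqT (he : e * e = 1) : AdjacentExchange n e (seqT N c e) := by
  intro k hk
  rw [atNat_of_lt _ (by omega : k < n), atNat_of_lt _ hk]
  refine atFactor_rel_of_eq N c n he _ _ _ ?_ (by simp)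
  push_cast
  ring

theorem adjacentExchange_seqInv (he : e * e = 1) : AdjacentExchange n e (seqInv N c e) := by
  intro k hk
  have hk' : k < n := by omega
  rw [atNat_of_lt _ hk', atNat_of_lt _ hk]
  -- Inversion reverses products, so the exchange for the inverses in the order k, k + 1 comes from
  -- the relation for T⁺(-u - ekh) with the factors k + 1, k. The difference of these two arguments
  -- is again -eh.
  have h := atFactor_rel_of_eq N c n he (-1) (-e * ((k + 1 : ℕ) : ℂ)) (-e * (k : ℂ))
    (by push_cast; ring) (k := ⟨k + 1, hk⟩) (l := ⟨k, hk'⟩) (by simp)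
  rw [Equiv.swap_comm] at h
  generalize (1 + e • permOp (Equiv.swap ⟨k, hk'⟩ ⟨k + 1, hk⟩) :
      Matrix (Fin n → Fin N) (Fin n → Fin N) (PowerSeries (DYHat N c))) = Y at *
  have h1 : ∀ (i : Fin n) (m : ℕ), atFactor i (seqTNeg N c e m) * atFactor i (seqInv N c e m) = 1 :=
    fun i m => by rw [← atFactor_mul, seqTNeg_mul_seqInv, atFactor_one]
  have h2 : ∀ (i : Fin n) (m : ℕ), atFactor i (seqInv N c e m) * atFactor i (seqTNeg N c e m) = 1 :=
    fun i m => by rw [← atFactor_mul, seqInv_mul_seqTNeg, atFactor_one]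
  change Y * (atFactor _ (seqTNeg N c e (k + 1)) * atFactor _ (seqTNeg N c e k)) =
    atFactor _ (seqTNeg N c e k) * atFactor _ (seqTNeg N c e (k + 1)) * Y at h
  have a1 := h1 ⟨k, hk'⟩ k
  have a2 := h2 ⟨k, hk'⟩ k
  have b1 := h1 ⟨k + 1, hk⟩ (k + 1)
  have b2 := h2 ⟨k + 1, hk⟩ (k + 1)
  generalize atFactor ⟨k, hk'⟩ (seqInv N c e k) = A' at *
  generalize atFactor ⟨k, hk'⟩ (seqTNeg N c e k) = A at *
  generalize atFactor ⟨k + 1, hk⟩ (seqInv N c e (k + 1)) = B' at *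
  generalize atFactor ⟨k + 1, hk⟩ (seqTNeg N c e (k + 1)) = B at *
  calc Y * (A' * B') = B' * (A' * A) * B * Y * (A' * B') := by rw [a2, mul_one, b2, one_mul]
    _ = B' * A' * (A * B * Y) * (A' * B') := by simp only [mul_assoc]
    _ = B' * A' * Y * B * (A * A') * B' := by rw [← h]; simp only [mul_assoc]
    _ = B' * A' * Y := by rw [a1, mul_one, mul_assoc, b1, mul_one]

theorem absorbs_ordProd_seqT {e : ℤ} (he : e * e = 1)
    {Θ : Matrix (Fin n → Fin N) (Fin n → Fin N) (PowerSeries (DYHat N c))}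
    (hΘ : SignAbsorbs e Set.univ Θ) {k : ℕ} (hk : k ≤ n) :
    SignAbsorbs e {i | (i : ℕ) < k} (Θ * ordProd n (seqT N c e) k) :=
  (absorbs_ordProd he eq_zero_of_add_self (adjacentExchange_seqT N c n e he) n
    (fun i _ j _ => hΘ i trivial j trivial) k hk hk).1

theorem absorbs_ordProd_seqInv {e : ℤ} (he : e * e = 1)
    {Θ : Matrix (Fin n → Fin N) (Fin n → Fin N) (PowerSeries (DYHat N c))}
    (hΘ : SignAbsorbs e Set.univ Θ) {k : ℕ} (hk : k ≤ n) :
    SignAbsorbs e {i | (i : ℕ) < k}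
      (Θ * ordProd n (seqT N c e) k * ordProd n (seqInv N c e) k) :=
  (absorbs_ordProd he eq_zero_of_add_self (adjacentExchange_seqInv N c n e he) k
    (absorbs_ordProd_seqT N c n he hΘ hk) k le_rfl hk).1

theorem setOf_lt_eq_univ : {i : Fin n | (i : ℕ) < n} = Set.univ :=
  Set.eq_univ_of_forall fun i => i.2

/-- The common form of the series attached to the symmetrizer and to the anti-symmetrizer. -/
def traceSeries (χ : Equiv.Perm (Fin n) →* ℤˣ) : PowerSeries (DYHat N c) :=
  Matrix.trace ((projector N χ).map (cstSeries N c) *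
    (ordProd n (seqT N c e) n * ordProd n (seqInv N c e) n))

theorem isSymm_projector_map {S : Type} [Ring S] (ψ : ℂ →+* S) (hψ : ∀ x y, Commute (ψ x) y)
    {n : ℕ} {χ : Equiv.Perm (Fin n) →* ℤˣ} {e : ℤ}
    (hχ : ∀ i j, i ≠ j → (χ (Equiv.swap i j) : ℤ) = e) :
    IsSymm e ((projector N χ).map ψ) := by
  let : Algebra ℂ S := ψ.toAlgebra' hψ
  exact isSymm_projector hχ

theorem cstSeries_commute (x : ℂ) (f : PowerSeries (DYHat N c)) :
    Commute (cstSeries N c x) f := commute_C (cst_commute x) f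

theorem tPlusProd_eq : tPlusProd N c n 1 e = ordProd n (seqT N c e) n := by
  rw [ordProd_eq_ofFn]
  rfl

theorem reverse_prod_mul_ordProd :
    ((List.finRange n).reverse.map fun k : Fin n => atFactor k (seqTNeg N c e k)).prod *
      ordProd n (seqInv N c e) n = 1 := by
  have h := prod_mul_prod_reverse (fun k : Fin n => atFactor k (seqTNeg N c e k))
    (fun k : Fin n => atFactor k (seqInv N c e k))
    (fun k => by rw [← atFactor_mul, seqTNeg_mul_seqInv, atFactor_one]) (List.finRange n).reverse
  rw [List.reverse_reverse] at h
  rw [ordProd_eq_ofFn, List.ofFn_eq_map, h]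

theorem ordProd_mul_reverse_prod :
    ordProd n (seqInv N c e) n *
      ((List.finRange n).reverse.map fun k : Fin n => atFactor k (seqTNeg N c e k)).prod = 1 := by
  rw [ordProd_eq_ofFn, List.ofFn_eq_map]
  exact prod_mul_prod_reverse (fun k : Fin n => atFactor k (seqInv N c e k))
    (fun k : Fin n => atFactor k (seqTNeg N c e k))
    (fun k => by rw [← atFactor_mul, seqInv_mul_seqTNeg, atFactor_one]) (List.finRange n)

theorem tPlusRevProd_eq : tPlusRevProd N c n (-1) (-e) =
    ((List.finRange n).reverse.map fun k : Fin n => atFactor k (seqTNeg N c e k)).prod := by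
  rw [tPlusRevProd, List.ofFn_eq_map, List.map_reverse]
  rfl

/-- Inverting the reversed product restores the ascending order. Both halves of the trace series are
thus covered by `absorbs_ordProd`. -/
theorem inverse_tPlusRevProd :
    Ring.inverse (tPlusRevProd N c n (-1) (-e)) = ordProd n (seqInv N c e) n := by
  have h1 := ordProd_mul_reverse_prod N c n e
  have h2 := Ring.mul_inverse_cancel _ (isUnit_tPlusRevProd N c n (-1) (-e))
  rw [← tPlusRevProd_eq] at h1
  rw [← one_mul (Ring.inverse _), ← h1, mul_assoc, h2, mul_one]

theorem rowSeries_eq : rowSeries N c n = traceSeries N c n 1 1 := by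
  rw [rowSeries, traceSeries, symmetrizer_eq_projector, ← tPlusProd_eq, ← inverse_tPlusRevProd,
    mul_assoc, Int.cast_one]

theorem colSeries_eq : colSeries N c n = traceSeries N c n (-1) Equiv.Perm.sign := by
  rw [colSeries, traceSeries, antisymmetrizer_eq_projector, ← tPlusProd_eq, ← inverse_tPlusRevProd,
    mul_assoc, Int.cast_neg, Int.cast_one, neg_neg]

end Concrete

/-! ### Fusion, unitarity and crossing of the spectral parameters -/

section ScalarIdentities

variable {N : ℕ}

theorem qAt_fuse (ε α m : ℂ) : qAt (point Ch ε (α + m)) *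
    (1 - C (cstScalar m) * qAt (point Ch ε α)) = qAt (point Ch ε α) := by
  linear_combination (-1) * qAt_shift ε α m

theorem neg_qAt_fuse (ε α m : ℂ) : -qAt (point Ch ε (α - m)) *
    (1 - C (cstScalar m) * (-qAt (point Ch ε α))) = -qAt (point Ch ε α) := by
  have h := qAt_shift ε (α - m) m
  rw [sub_add_cancel] at h
  linear_combination (-1) * h

theorem gS_unitary (hN : N ≠ 0) (y : PowerSeries Ch) :
    gS N (qAt y) * gS N (-qAt y) * (1 - qAt y ^ 2) = 1 :=
  gAt_unitary _ hN (coeff_zero_qAt y)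

/-- With x the inverse of the second `qAt`, the product is g(x + N) g(-x) = g(x) g(-x)(1 - x⁻²),
which is 1 by unitarity. -/
theorem gS_crossing (hN : N ≠ 0) (ε α : ℂ) :
    gS N (qAt (point Ch ε α)) * gS N (-qAt (point Ch ε (α + N))) = 1 := by
  have h := qAt_shift ε α N
  rw [map_natCast, map_natCast] at h
  have h1 : gS N (qAt (point Ch ε α)) = _ := gAt_crossing cstScalar hN (coeff_zero_qAt _) h
  have h2 := gS_unitary hN (point Ch ε (α + N))
  rw [h1]
  rw [gS, gS] at h2
  rw [gS]
  linear_combination h2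

/-- The condition on the parameters required by `crossed_rOp`. -/
theorem qAt_crossing (ε α : ℂ) : qAt (point Ch ε α) + -qAt (point Ch ε (α + N)) =
    N * qAt (point Ch ε α) * -qAt (point Ch ε (α + N)) := by
  have h := qAt_shift ε α N
  rw [map_natCast, map_natCast] at h
  linear_combination h

end ScalarIdentities

/-! ### Families of R-matrices to which fusion applies -/

section Families

variable {N n : ℕ} {S : Type} [Ring S] [Algebra ScalarSeries S] (e : ℤ) (ε α : ℂ)

theorem prod_rOp_mem (g q : Fin n → ScalarSeries) (l : List (Fin n)) :
    (l.map fun i => (rOp i (g i) (q i) : Blk N n S)).prod ∈ centralOps N n ScalarSeries S :=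
  list_prod_mem fun x hx => by
    obtain ⟨i, _, rfl⟩ := List.mem_map.1 hx
    exact rOp_mem _ _ _

/-- κ is the parameter of the operator which stands last in the product. This holds in the
descending case as well, where that operator has index 0. Accordingly the sign in front of `e * i`
below depends on the order of the factors and on the sign of the parameter. -/
theorem fused_asc (g q : Fin n → ScalarSeries) (κ : ScalarSeries)
    (h : ∀ a : Fin n, q a * (1 - C (cstScalar (e * (n - 1 - a))) * κ) = κ) :
    Fused (e : ScalarSeries)
      ((List.finRange n).map fun i => (rOp i (g i) (q i) : Blk N n S)).prod := by
  rw [← List.ofFn_eq_map]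
  refine fused_ofFn (e : ScalarSeries) id Function.injective_id g q κ fun a => ?_
  have := h a
  simpa only [map_mul, map_sub, map_intCast, map_natCast, map_one] using this

theorem fused_desc (g q : Fin n → ScalarSeries) (κ : ScalarSeries)
    (h : ∀ a : Fin n, q a * (1 - C (cstScalar (e * a)) * κ) = κ) :
    Fused (e : ScalarSeries)
      ((List.finRange n).reverse.map fun i => (rOp i (g i) (q i) : Blk N n S)).prod := by
  rw [List.finRange_reverse, List.map_map, ← List.ofFn_eq_map]
  refine fused_ofFn (e : ScalarSeries) Fin.rev Fin.rev_injective (g ∘ Fin.rev) (q ∘ Fin.rev) κ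
    fun a => ?_
  have := h a.rev
  rw [Fin.val_rev, Nat.cast_sub (by omega)] at this
  simp only [map_mul, map_sub, map_intCast, map_natCast] at this
  rw [Function.comp_apply]
  convert this using 4
  push_cast
  ring

theorem fused_asc_pos (g : Fin n → ScalarSeries) : Fused (e : ScalarSeries)
    ((List.finRange n).map fun i =>
      (rOp i (g i) (qAt (point Ch ε (α - e * (i : ℕ)))) : Blk N n S)).prod := by
  refine fused_asc e g _ (qAt (point Ch ε (α - e * (n - 1)))) fun a => ?_
  rw [show α - e * (a : ℕ) = α - e * (n - 1) + e * (n - 1 - (a : ℕ)) by ring]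
  exact qAt_fuse _ _ _

theorem fused_asc_neg (g : Fin n → ScalarSeries) : Fused (e : ScalarSeries)
    ((List.finRange n).map fun i =>
      (rOp i (g i) (-qAt (point Ch ε (α + e * (i : ℕ)))) : Blk N n S)).prod := by
  refine fused_asc e g _ (-qAt (point Ch ε (α + e * (n - 1)))) fun a => ?_
  rw [show α + e * (a : ℕ) = α + e * (n - 1) - e * (n - 1 - (a : ℕ)) by ring]
  exact neg_qAt_fuse _ _ _

theorem fused_desc_pos (g : Fin n → ScalarSeries) : Fused (e : ScalarSeries)
    ((List.finRange n).reverse.map fun i =>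
      (rOp i (g i) (qAt (point Ch ε (α + e * (i : ℕ)))) : Blk N n S)).prod :=
  fused_desc e g _ (qAt (point Ch ε α)) fun _ => qAt_fuse _ _ _

theorem fused_desc_neg (g : Fin n → ScalarSeries) : Fused (e : ScalarSeries)
    ((List.finRange n).reverse.map fun i =>
      (rOp i (g i) (-qAt (point Ch ε (α - e * (i : ℕ)))) : Blk N n S)).prod :=
  fused_desc e g _ (-qAt (point Ch ε α)) fun _ => neg_qAt_fuse _ _ _

theorem exchange_rOp (t : Matrix (Fin N) (Fin N) S) (s : Fin n → Matrix (Fin N) (Fin N) S)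
    (g q g' q' : Fin n → ScalarSeries)
    (h : ∀ k a b i j, g k • (t a b * s k i j - q k • (t i b * s k a j)) =
      g' k • (s k i j * t a b - q' k • (s k i b * t a j))) (l : List (Fin n)) (hl : l.Nodup) :
    (l.reverse.map fun i => (rOp i (g i) (q i) : Blk N n S)).prod * onZero t *
        onRest (l.map fun i => atFactor i (s i)).prod =
      onRest (l.map fun i => atFactor i (s i)).prod * onZero t *
        (l.reverse.map fun i => rOp i (g' i) (q' i)).prod := by
  rw [map_list_prod, List.map_map]
  exact exchange_prod _ _ (onRest ∘ fun i => atFactor i (s i)) _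
    (fun i j hij => commute_onRest_rOp hij _ _ _) (fun i j hij => commute_onRest_rOp hij _ _ _)
    (fun i => rOp_mixed i _ _ _ _ t (s i) (h i)) l hl

end Families

/-! ### The action on the vacuum -/

section Vacuum

variable (N : ℕ) (c : ℂ)

theorem toDYHat_smul_vac {x : DYc N c} (hx : x ∈ vacIdeal N c) : toDYHat N c x • vac N c = 0 := by
  apply Subtype.ext
  funext n
  have h : Submodule.Quotient.mk (p := vacIdeal N c) x = 0 := (Submodule.Quotient.mk_eq_zero _).2 hx
  change Submodule.Quotient.mk (x • Submodule.Quotient.mk (1 : DYc N c)) = _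
  rw [← Submodule.Quotient.mk_smul, smul_eq_mul, mul_one, h]
  rfl

/-- The left ideal of the series all of whose coefficients annihilate the vacuum. -/
def vacSeriesIdeal : Ideal (PowerSeries (PowerSeries (DYHat N c))) where
  carrier := {f | ∀ k l, coeff l (coeff k f) • vac N c = 0}
  add_mem' := fun hf hg k l => by rw [map_add, map_add, add_smul, hf, hg, add_zero]
  zero_mem' := fun k l => by rw [map_zero, map_zero, zero_smul]
  smul_mem' := fun f g hg k l => by
    rw [smul_eq_mul, coeff_mul, map_sum, Finset.sum_smul]
    refine Finset.sum_eq_zero fun p _ => ?_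
    rw [coeff_mul, Finset.sum_smul]
    refine Finset.sum_eq_zero fun p' _ => ?_
    rw [mul_smul, hg, smul_zero]

theorem coeff_matT_smul_vac (s : PowerSeries (DYHat N c)) (i j : Fin N) (p : ℕ) :
    coeff p (matT N c s i j) • vac N c =
      coeff p ((1 : Matrix (Fin N) (Fin N) (PowerSeries (DYHat N c))) i j) • vac N c := by
  rw [matT, Matrix.of_apply, compSeries, coeff_mk, Finset.sum_range_succ', add_smul,
    Finset.sum_smul, Finset.sum_eq_zero, zero_add]
  · rw [pow_zero, posCoeff, Matrix.one_apply]
    split_ifs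
    · rw [map_one (toDYHat N c), mul_one]
    · rw [map_zero (toDYHat N c), mul_zero, map_zero]
  · intro k _
    rw [mul_smul, toDYHat_smul_vac, smul_zero]
    rw [posCoeff]
    exact Ideal.mul_mem_left _ _ (Ideal.subset_span ⟨i, j, k, rfl⟩)

theorem matT_sub_one_mem (s : PowerSeries (DYHat N c)) (a b : Fin N) :
    ((matT N c s).map (PowerSeries.map C) - 1 :
      Matrix (Fin N) (Fin N) (PowerSeries (PowerSeries (DYHat N c)))) a b ∈
      vacSeriesIdeal N c := by
  intro k l
  have h1 : (1 : Matrix (Fin N) (Fin N) (PowerSeries (PowerSeries (DYHat N c)))) =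
      (1 : Matrix (Fin N) (Fin N) (PowerSeries (DYHat N c))).map (PowerSeries.map C) :=
    (Matrix.map_one _ (map_zero _) (map_one _)).symm
  rw [h1, Matrix.sub_apply, Matrix.map_apply, Matrix.map_apply, map_sub, coeff_map, coeff_map,
    map_sub, coeff_C, coeff_C]
  split_ifs
  · rw [sub_smul, coeff_matT_smul_vac, sub_self]
  · rw [sub_zero, zero_smul]

/-- The matrix `T(-v)⁻¹`. -/
def tNegVInv : Matrix (Fin N) (Fin N) (PowerSeries (PowerSeries (DYHat N c))) :=
  (Ring.inverse (matT N c (-X))).map (PowerSeries.map C)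

theorem tNegV_mul_tNegVInv : tNegV N c * tNegVInv N c = 1 := by
  rw [tNegV, tNegVInv, ← Matrix.map_mul, Ring.mul_inverse_cancel _ (isUnit_matT N c _)]
  exact Matrix.map_one _ (map_zero _) (map_one _)

theorem tNegVInv_mul_tNegV : tNegVInv N c * tNegV N c = 1 := by
  rw [tNegV, tNegVInv, ← Matrix.map_mul, Ring.inverse_mul_cancel _ (isUnit_matT N c _)]
  exact Matrix.map_one _ (map_zero _) (map_one _)

theorem tUp_mul_tNegVInv_sub_one_mem (a b : Fin N) :
    (tUp N c * tNegVInv N c - 1) a b ∈ vacSeriesIdeal N c := by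
  have hmul : ∀ U V : Matrix (Fin N) (Fin N) (PowerSeries (PowerSeries (DYHat N c))),
      (∀ a b, V a b ∈ vacSeriesIdeal N c) → ∀ a b, (U * V) a b ∈ vacSeriesIdeal N c := by
    intro U V hV a b
    rw [Matrix.mul_apply]
    exact sum_mem fun k _ => Ideal.mul_mem_left _ _ (hV k b)
  -- The differences T - 1 have to stand on the right, because only a left ideal is available.
  have h : tUp N c * tNegVInv N c - 1 = (tUp N c - 1) -
      tUp N c * (tNegVInv N c * (tNegV N c - 1)) := by
    rw [mul_sub, tNegVInv_mul_tNegV]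
    noncomm_ring
  rw [h, Matrix.sub_apply]
  exact sub_mem (matT_sub_one_mem N c _ a b)
    (hmul _ _ (hmul _ _ (matT_sub_one_mem N c _)) a b)

end Vacuum

/-! ### Ordered products of `R`-matrices -/

section Ordered

variable {N n : ℕ} {S : Type} [Ring S] [Algebra ScalarSeries S]

/-- The ordered product of the `R`-matrices with parameters `f`. -/
def rProd (N : ℕ) {n : ℕ} (S : Type) [Ring S] [Algebra ScalarSeries S] (f : Fin n → ScalarSeries)
    (l : List (Fin n)) : Blk N n S :=
  (l.map fun i => rOp i (gS N (f i)) (f i)).prod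

theorem rProd_mul_rProd_neg (hN : N ≠ 0) {f : Fin n → ScalarSeries} (hf : ∀ i, coeff 0 (f i) = 0)
    (l : List (Fin n)) : rProd N S f l * rProd N S (fun i => -f i) l.reverse = 1 :=
  prod_mul_prod_reverse _ _ (fun i => rOp_mul_rOp i (gAt_unitary cstScalar hN (hf i))) l

theorem rProd_neg_mul_rProd (hN : N ≠ 0) {f : Fin n → ScalarSeries} (hf : ∀ i, coeff 0 (f i) = 0)
    (l : List (Fin n)) : rProd N S (fun i => -f i) l * rProd N S f l.reverse = 1 := by
  have := rProd_mul_rProd_neg (S := S) hN (f := fun i => -f i)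
    (fun i => by rw [map_neg, hf, neg_zero]) l
  simpa only [neg_neg] using this

theorem rProd_mem (f : Fin n → ScalarSeries) (l : List (Fin n)) :
    rProd N S f l ∈ centralOps N n ScalarSeries S := prod_rOp_mem _ _ _

theorem crossed_rProd {f f' : Fin n → ScalarSeries} (hg : ∀ i, gS N (f i) * gS N (f' i) = 1)
    (hq : ∀ i, f i + f' i = N * f i * f' i) {l : List (Fin n)} (hl : l.Nodup) :
    Crossed (rProd N S f l.reverse) (rProd N S f' l) :=
  crossed_prod _ _ (fun i => crossed_rOp i (hg i) (hq i))
    (fun _ _ hij => blocksCommute_rOp hij _ _ _ _) (fun _ _ hij => blocksCommute_rOp hij _ _ _ _)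
    l hl

end Ordered

/-! ### Invariance of the trace series at c = -N/2 -/

section Invariance

variable (N : ℕ) (c : ℂ) (n : ℕ) (e : ℤ)

theorem map_seqT_prod :
    (ordProd n (seqT N c e) n).map C =
      ((List.finRange n).map fun i : Fin n => atFactor i (tP N c 1 (e * (i : ℕ)))).prod := by
  rw [ordProd_eq_ofFn, List.ofFn_eq_map]
  change (C (R := PowerSeries (DYHat N c))).mapMatrix _ = _
  rw [map_list_prod, List.map_map]
  congr 1
  refine List.map_congr_left fun i _ => ?_
  exact atFactor_map _ _ _

theorem map_seqTNeg_prod :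
    (((List.finRange n).reverse.map fun k : Fin n => atFactor k (seqTNeg N c e k)).prod).map C =
      ((List.finRange n).reverse.map fun i : Fin n =>
        atFactor i (tP N c (-1) (-e * (i : ℕ)))).prod := by
  change (C (R := PowerSeries (DYHat N c))).mapMatrix _ = _
  rw [map_list_prod, List.map_map]
  congr 1
  refine List.map_congr_left fun i _ => ?_
  exact atFactor_map _ _ _

variable {N c n e}

/-- Here u is the inner variable and v⁻¹ the outer one; T and T⁺ depend on one of them each, so the
statement encodes the action of every coefficient in v on every coefficient in u. -/
theorem trace_invariant (hN : N ≠ 0) (hc : c = -N / 2) (he : e * e = 1)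
    {χ : Equiv.Perm (Fin n) →* ℤˣ} (hχ : ∀ i j, i ≠ j → (χ (Equiv.swap i j) : ℤ) = e)
    (a b : Fin N) :
    (tUp N c * tNegVInv N c) a b * C (traceSeries N c n e χ) -
      (if a = b then C (traceSeries N c n e χ) else 0) ∈ vacSeriesIdeal N c := by
  have hQB := isSymm_projector_map N _ (cstSeries_commute N c) hχ
  have hQ : IsSymm (e : ScalarSeries) (((projector N χ).map (cstSeries N c)).map C) := by
    have := isSymm_projector_map N ((C (R := PowerSeries (DYHat N c))).comp (cstSeries N c))
      (fun x => commute_C (cstSeries_commute N c x)) hχ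
    exact this.intCast
  have huniv := setOf_lt_eq_univ n
  have h1 := absorbs_ordProd_seqT N c n he hQB.signAbsorbs le_rfl
  have h2 := absorbs_ordProd_seqInv N c n he hQB.signAbsorbs le_rfl
  rw [huniv] at h1 h2
  have hQT := absorbs_intCast (K := ScalarSeries).2 (h1.map (C (R := PowerSeries (DYHat N c))))
  have hQX := absorbs_intCast (K := ScalarSeries).2 (h2.map (C (R := PowerSeries (DYHat N c))))
  rw [Matrix.map_mul] at hQT
  rw [mul_assoc, Matrix.map_mul, Matrix.map_mul] at hQX
  have htr : C (traceSeries N c n e χ) = Matrix.trace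
      (((projector N χ).map (cstSeries N c)).map C *
        ((ordProd n (seqT N c e) n).map C * (ordProd n (seqInv N c e) n).map C)) := by
    rw [← Matrix.map_mul, ← Matrix.map_mul, traceSeries]
    exact AddMonoidHom.map_trace (C (R := PowerSeries (DYHat N c))).toAddMonoidHom _
  have hT' := congrArg (fun Y => Y.map (C (R := PowerSeries (DYHat N c))))
    (reverse_prod_mul_ordProd N c n e)
  have hTinv := congrArg (fun Y => Y.map (C (R := PowerSeries (DYHat N c))))
    (ordProd_mul_reverse_prod N c n e)
  simp only [Matrix.map_mul, Matrix.map_one _ (map_zero C) (map_one C)] at hT' hTinv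
  have hrev : (List.finRange n).reverse.reverse = List.finRange n := List.reverse_reverse _
  have hnd := List.nodup_finRange n
  rw [htr]
  have hz := fun y => coeff_zero_qAt y
  -- The parameters are those of `tUp_rel` and `tNegV_rel` at the arguments u + eih (`α`, `β`) and
  -- -u - eih (`γ`, `δ`). T(v + hc) at an argument and T(-v) at its opposite produce the same shift
  -- -c/2 on the right, with opposite signs of the parameter; this is why `α₂'` serves in the
  -- relation for `δ` and `β₂` is inverse to `γ₂`.
  refine reflection_trace (K := ScalarSeries) (e := (e : ScalarSeries)) (vacSeriesIdeal N c) hQ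
    hT' hTinv hQT hQX (tNegV_mul_tNegVInv N c) (tNegVInv_mul_tNegV N c)
    (tUp_mul_tNegVInv_sub_one_mem N c)
    (α₁ := rProd N _ (fun i => qAt (point Ch 1 (-3 * c / 2 + e * (i : ℕ)))) (List.finRange n).reverse)
    (α₁' := rProd N _ (fun i => -qAt (point Ch 1 (-3 * c / 2 + e * (i : ℕ)))) (List.finRange n))
    (α₂ := rProd N _ (fun i => qAt (point Ch 1 (-c / 2 + e * (i : ℕ)))) (List.finRange n).reverse)
    (α₂' := rProd N _ (fun i => -qAt (point Ch 1 (-c / 2 + e * (i : ℕ)))) (List.finRange n))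
    (β₁ := rProd N _ (fun i => -qAt (point Ch (-1) (c / 2 - e * (i : ℕ)))) (List.finRange n).reverse)
    (β₁' := rProd N _ (fun i => qAt (point Ch (-1) (c / 2 - e * (i : ℕ)))) (List.finRange n))
    (β₂ := rProd N _ (fun i => -qAt (point Ch (-1) (-c / 2 - e * (i : ℕ)))) (List.finRange n).reverse)
    (γ₁ := rProd N _ (fun i => qAt (point Ch (-1) (-3 * c / 2 - e * (i : ℕ)))) (List.finRange n))
    (γ₁' := rProd N _ (fun i => -qAt (point Ch (-1) (-3 * c / 2 - e * (i : ℕ)))) (List.finRange n).reverse)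
    (γ₂ := rProd N _ (fun i => qAt (point Ch (-1) (-c / 2 - e * (i : ℕ)))) (List.finRange n))
    (δ₁ := rProd N _ (fun i => -qAt (point Ch 1 (c / 2 + e * (i : ℕ)))) (List.finRange n))
    (δ₁' := rProd N _ (fun i => qAt (point Ch 1 (c / 2 + e * (i : ℕ)))) (List.finRange n).reverse)
    ?_ ?_ ?_ ?_ ?_ ?_ ?_ ?_ ?_ ?_ (fused_asc_neg _ _ _ _) (fused_desc_pos _ _ _ _)
    (fused_asc_pos _ _ _ _) (fused_asc_pos _ _ _ _) (fused_desc_neg _ _ _ _)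
    (fused_desc_pos _ _ _ _) (fused_asc_pos _ _ _ _) (rProd_mem _ _) (rProd_mem _ _)
    (rProd_mem _ _) (rProd_mem _ _) ?_ ?_ a b
  · exact rProd_neg_mul_rProd hN (fun _ => hz _) _
  · have := rProd_mul_rProd_neg (S := PowerSeries (PowerSeries (DYHat N c))) hN
      (fun i : Fin n => hz (point Ch 1 (-c / 2 + e * (i : ℕ)))) (List.finRange n).reverse
    rwa [hrev] at this
  · exact rProd_mul_rProd_neg hN (fun _ => hz _) _
  · have := rProd_neg_mul_rProd (S := PowerSeries (PowerSeries (DYHat N c))) hN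
      (fun i : Fin n => hz (point Ch (-1) (-c / 2 - e * (i : ℕ)))) (List.finRange n).reverse
    rwa [hrev] at this
  · exact rProd_mul_rProd_neg hN (fun _ => hz _) _
  · exact rProd_neg_mul_rProd hN (fun _ => hz _) _
  · rw [map_seqT_prod]
    refine exchange_rOp _ _ _ _ _ _ (fun k a b i j => ?_) _ hnd
    have := tUp_rel N c 1 (e * (k : ℕ)) a b i j
    rw [show (e : ℂ) * (k : ℕ) - 3 * c / 2 = -3 * c / 2 + e * (k : ℕ) by ring,
      show (e : ℂ) * (k : ℕ) - c / 2 = -c / 2 + e * (k : ℕ) by ring] at this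
    exact this
  · rw [map_seqT_prod]
    refine exchange_rOp _ _ _ _ _ _ (fun k a b i j => ?_) _ hnd
    have := tNegV_rel N c 1 (e * (k : ℕ)) a b i j
    rw [show -((e : ℂ) * (k : ℕ)) + c / 2 = c / 2 - e * (k : ℕ) by ring,
      show -((e : ℂ) * (k : ℕ)) - c / 2 = -c / 2 - e * (k : ℕ) by ring] at this
    exact this
  · rw [map_seqTNeg_prod]
    have := exchange_rOp (tUp N c) (fun k : Fin n => tP N c (-1) (-e * (k : ℕ))) _ _ _ _
      (fun k a b i j => by
        have := tUp_rel N c (-1) (-e * (k : ℕ)) a b i j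
        rw [show -(e : ℂ) * (k : ℕ) - 3 * c / 2 = -3 * c / 2 - e * (k : ℕ) by ring,
          show -(e : ℂ) * (k : ℕ) - c / 2 = -c / 2 - e * (k : ℕ) by ring] at this
        exact this) (List.finRange n).reverse (List.nodup_reverse.2 hnd)
    rw [hrev] at this
    exact this
  · rw [map_seqTNeg_prod]
    have := exchange_rOp (tNegV N c) (fun k : Fin n => tP N c (-1) (-e * (k : ℕ))) _ _ _ _
      (fun k a b i j => by
        have := tNegV_rel N c (-1) (-e * (k : ℕ)) a b i j
        rw [neg_neg, show -(-(e : ℂ) * (k : ℕ)) + c / 2 = c / 2 + e * (k : ℕ) by ring,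
          show -(-(e : ℂ) * (k : ℕ)) - c / 2 = -c / 2 + e * (k : ℕ) by ring] at this
        exact this) (List.finRange n).reverse (List.nodup_reverse.2 hnd)
    rw [hrev] at this
    exact this
  -- The left-hand parameters have shifts c/2 and -3c/2. Crossing needs c/2 + N = -3c/2, which is c
  -- = -N/2.
  · refine crossed_rProd (fun i => ?_) (fun i => ?_) hnd
    · have := gS_crossing hN (-1) (c / 2 - e * (i : ℕ))
      rw [mul_comm, show (c / 2 - e * (i : ℕ) + N : ℂ) = -3 * c / 2 - e * (i : ℕ) by
        rw [hc]; ring] at this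
      exact this
    · have := qAt_crossing (N := N) (-1) (c / 2 - e * (i : ℕ))
      rw [show (c / 2 - e * (i : ℕ) + N : ℂ) = -3 * c / 2 - e * (i : ℕ) by rw [hc]; ring] at this
      linear_combination this
  · refine crossed_rProd (fun i => ?_) (fun i => ?_) hnd
    · have := gS_crossing hN 1 (c / 2 + e * (i : ℕ))
      rw [show (c / 2 + e * (i : ℕ) + N : ℂ) = -3 * c / 2 + e * (i : ℕ) by rw [hc]; ring] at this
      exact this
    · have := qAt_crossing (N := N) 1 (c / 2 + e * (i : ℕ))
      rw [show (c / 2 + e * (i : ℕ) + N : ℂ) = -3 * c / 2 + e * (i : ℕ) by rw [hc]; ring] at this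
      linear_combination this

end Invariance

/-! ### The coefficients of `B⁺(u)` -/

section Closure

variable (N : ℕ) (c : ℂ) (M : ℕ)

/-- The `h`-adic closure of the subalgebra generated by the coefficients of `B⁺(u)`. -/
def bClosure : Subalgebra Ch (DYHat N c) where
  carrier := {x | ∀ n : ℕ, ∃ b ∈ bPlusPre N c M, ∃ y : DYHat N c, x = b + hh ^ n • y}
  mul_mem' := by
    intro x x' hx hx' n
    obtain ⟨b, hb, y, rfl⟩ := hx n
    obtain ⟨b', hb', y', rfl⟩ := hx' n
    refine ⟨b * b', mul_mem hb hb', b * y' + y * (b' + hh ^ n • y'), ?_⟩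
    rw [smul_add, add_mul, mul_add b, mul_smul_comm, smul_mul_assoc, add_assoc]
  add_mem' := by
    intro x x' hx hx' n
    obtain ⟨b, hb, y, rfl⟩ := hx n
    obtain ⟨b', hb', y', rfl⟩ := hx' n
    exact ⟨b + b', add_mem hb hb', y + y', by rw [smul_add]; abel⟩
  algebraMap_mem' r n := ⟨_, Subalgebra.algebraMap_mem _ r, 0, by rw [smul_zero, add_zero]⟩

variable {N c M}

theorem bPlusPre_le : bPlusPre N c M ≤ bClosure N c M :=
  fun x hx _ => ⟨x, hx, 0, by rw [smul_zero, add_zero]⟩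

theorem mem_bClosure_of_approx {x : DYHat N c}
    (h : ∀ n, ∃ b ∈ bClosure N c M, ∃ y : DYHat N c, x = b + hh ^ n • y) : x ∈ bClosure N c M := by
  intro n
  obtain ⟨b, hb, y, rfl⟩ := h n
  obtain ⟨b', hb', y', rfl⟩ := hb n
  exact ⟨b', hb', y' + y, by rw [smul_add, add_assoc]⟩

theorem cst_mem (x : ℂ) : cst (DYHat N c) x ∈ bClosure N c M := Subalgebra.algebraMap_mem _ _

theorem hIn_mem : hIn (DYHat N c) ∈ bClosure N c M := Subalgebra.algebraMap_mem _ _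

variable (N c M) in
/-- The series with coefficients in the closure of the algebra generated by the coefficients of
`B⁺(u)`. -/
def bSeries : Subring (PowerSeries (DYHat N c)) where
  carrier := {f | ∀ k, coeff k f ∈ bClosure N c M}
  mul_mem' hf hg k := by
    rw [coeff_mul]
    exact sum_mem fun p _ => mul_mem (hf _) (hg _)
  one_mem' k := by
    rw [coeff_one]
    split_ifs
    · exact one_mem _
    · exact zero_mem _
  add_mem' hf hg k := by
    rw [map_add]
    exact add_mem (hf k) (hg k)
  zero_mem' k := by
    rw [map_zero]
    exact zero_mem _
  neg_mem' hf k := by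
    rw [map_neg]
    exact neg_mem (hf k)

theorem C_mem_bSeries {x : DYHat N c} (hx : x ∈ bClosure N c M) : C x ∈ bSeries N c M := by
  intro k
  rw [coeff_C]
  split_ifs
  · exact hx
  · exact zero_mem _

theorem X_mem_bSeries : X ∈ bSeries N c M := by
  intro k
  rw [coeff_X]
  split_ifs
  · exact one_mem _
  · exact zero_mem _

theorem point_mem_bSeries (ε α : ℂ) : point (DYHat N c) ε α ∈ bSeries N c M :=
  add_mem (mul_mem (C_mem_bSeries (cst_mem ε)) X_mem_bSeries)
    (C_mem_bSeries (mul_mem (cst_mem α) hIn_mem))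

theorem evalPt_mem_bSeries (ε α : ℂ) {f : PowerSeries (DYHat N c)} (hf : f ∈ bSeries N c M) :
    evalPt (isHAdic_DYHat N c) ε α f ∈ bSeries N c M := by
  intro a
  refine mem_bClosure_of_approx fun n => ?_
  obtain ⟨r, hr⟩ := coeff_evalPt (isHAdic_DYHat N c) ε α f a n
  refine ⟨_, sum_mem fun s _ => ?_, r, hr⟩
  exact Subalgebra.smul_mem _ (mul_mem (cst_mem _) (hf _)) _

/-- Division by `2 u + γ h`. -/
theorem mem_bSeries_of_point_mul {γ : ℂ} {f : PowerSeries (DYHat N c)}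
    (h : point (DYHat N c) 2 γ * f ∈ bSeries N c M) : f ∈ bSeries N c M := by
  -- The coefficient of index a + 1 in (2u + γh)f is 2f_a + γh f_{a+1}. Solving for f_a and
  -- iterating determines it modulo every power of h by elements of the closure.
  have key : ∀ a, ∃ b ∈ bClosure N c M, coeff a f = b + hh • (cst _ (-γ / 2) * coeff (a + 1) f) := by
    intro a
    refine ⟨cst _ (1 / 2) * coeff (a + 1) (point (DYHat N c) 2 γ * f),
      mul_mem (cst_mem _) (h _), ?_⟩
    have h1 : ∀ x y : ℂ, ∀ z : DYHat N c, cst _ x * (cst _ y * z) = cst _ (x * y) * z :=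
      fun x y z => by rw [map_mul, mul_assoc]
    have h2 : ∀ z : DYHat N c, cst _ (1 / 2) * (cst _ γ * hIn _ * z) +
        hh • (cst _ (-γ / 2) * z) = 0 := by
      intro z
      rw [mul_assoc, h1, Algebra.smul_def, ← mul_assoc, ← mul_assoc,
        show algebraMap Ch (DYHat N c) hh = hIn _ from rfl, (hIn_commute _).eq, ← add_mul, ← add_mul,
        ← map_add, show 1 / 2 * γ + -γ / 2 = 0 by ring, map_zero, zero_mul, zero_mul]
    rw [point, add_mul, map_add, mul_assoc, coeff_C_mul, coeff_succ_X_mul, coeff_C_mul, mul_add,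
      h1, add_assoc, h2, add_zero]
    norm_num
  intro a
  refine mem_bClosure_of_approx fun n => ?_
  induction n generalizing a with
  | zero => exact ⟨0, zero_mem _, coeff a f, by rw [pow_zero, one_smul, zero_add]⟩
  | succ n ih =>
    obtain ⟨b, hb, h1⟩ := key a
    obtain ⟨b', hb', y, h2⟩ := ih (a + 1)
    refine ⟨b + hh • (cst _ (-γ / 2) * b'), add_mem hb (Subalgebra.smul_mem _
      (mul_mem (cst_mem _) hb') _), cst _ (-γ / 2) * y, ?_⟩
    rw [h1, h2, mul_add, smul_add, mul_smul_comm, smul_smul, ← pow_succ', add_assoc]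

/-- The dilation by ε followed by the shift u ↦ u + αh. Being a ring homomorphism, the shift also
carries inverses of T⁺(-u) to inverses of T⁺(-u - αh). -/
theorem evalPt_evalPt (ε α : ℂ) (f : PowerSeries (DYHat N c)) :
    evalPt (isHAdic_DYHat N c) 1 α (evalPt (isHAdic_DYHat N c) ε 0 f) =
      evalPt (isHAdic_DYHat N c) ε (ε * α) f := by
  have h0 : ∀ a, coeff a (evalPt (isHAdic_DYHat N c) ε 0 f) = cst _ (ε ^ a) * coeff a f := by
    intro a
    rw [← sub_eq_zero]
    refine (isHAdic_DYHat N c).sep _ fun n => ?_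
    -- For α = 0 only the term s = 0 survives; the order n + 1 guarantees that this term occurs.
    obtain ⟨r, hr⟩ := coeff_evalPt (isHAdic_DYHat N c) ε 0 f a (n + 1)
    refine smul_dvd_mono n.le_succ ⟨r, ?_⟩
    rw [hr, Finset.sum_range_succ', Finset.sum_eq_zero]
    · simp
    · intro s _
      simp
  symm
  apply evalPt_eq
  intro a n
  obtain ⟨r, hr⟩ := coeff_evalPt (isHAdic_DYHat N c) 1 α (evalPt (isHAdic_DYHat N c) ε 0 f) a n
  refine ⟨r, ?_⟩
  rw [hr]
  congr 1
  refine Finset.sum_congr rfl fun s _ => ?_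
  rw [h0, ← mul_assoc, ← map_mul]
  congr 3
  ring

theorem matTPlus_sub_one_dvd (ε α : ℂ) :
    ∃ Y, matTPlus N c ε α = 1 - C (hIn (DYHat N c)) • Y := by
  refine ⟨Matrix.of fun i j => evalPt (isHAdic_DYHat N c) ε α
    (PowerSeries.mk fun k => toDYHat N c (genC N c (.tNeg i j k))), ?_⟩
  ext1 i j
  rw [matTPlus_eq, Matrix.sub_apply, Matrix.smul_apply, Matrix.of_apply, smul_eq_mul,
    ← evalPt_C (isHAdic_DYHat N c) ε α (hIn (DYHat N c)), ← map_mul]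
  have h : (1 : Matrix (Fin N) (Fin N) (PowerSeries (DYHat N c))) i j =
      evalPt (isHAdic_DYHat N c) ε α ((1 : Matrix (Fin N) (Fin N) (PowerSeries (DYHat N c))) i j) := by
    rw [Matrix.one_apply]
    split_ifs
    · rw [map_one]
    · rw [map_zero]
  rw [h, ← map_sub]
  congr 1
  ext k
  rw [tPlusSer, coeff_mk, map_sub, coeff_C_mul, coeff_mk, negCoeff, map_sub, map_mul]
  congr 1
  rw [Matrix.one_apply]
  by_cases hij : i = j <;> by_cases hk : k = 0 <;> simp [hij, hk, coeff_one]

/-- The generators are the solutions x of an equation involving hx, so it has to be shown that B⁺(u)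
is congruent to G modulo h. -/
theorem coeff_matBPlus_mem (i j : Fin N) (r : ℕ) :
    coeff r (matBPlus N c M i j) ∈ bPlusPre N c M := by
  obtain ⟨Y, hY⟩ := matTPlus_sub_one_dvd (N := N) (c := c) 1 0
  obtain ⟨Y', hY'⟩ := matTPlus_sub_one_dvd (N := N) (c := c) (-1) 0
  have hinv := Ring.mul_inverse_cancel _ (isUnit_matTPlus N c (-1) 0)
  obtain ⟨G, hG⟩ : ∃ G, G = (matG N M).map (cstSeries N c) := ⟨_, rfl⟩
  have hcent : ∀ F : Matrix (Fin N) (Fin N) (PowerSeries (DYHat N c)),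
      G * (C (hIn (DYHat N c)) • F) = C (hIn (DYHat N c)) • (G * F) := by
    intro F
    ext1 i j
    rw [Matrix.smul_apply, Matrix.mul_apply, Matrix.mul_apply, smul_eq_mul, Finset.mul_sum]
    refine Finset.sum_congr rfl fun k _ => ?_
    rw [Matrix.smul_apply, smul_eq_mul, ← mul_assoc, ← (commute_C hIn_commute _).eq, mul_assoc]
  have h : matBPlus N c M = G - C (hIn (DYHat N c)) •
      ((Y * G - G * Y') * Ring.inverse (matTPlus N c (-1) 0)) := by
    -- T⁺(u) and T⁺(-u) are both 1 modulo h, hence commuting G past them costs only a multiple of h.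
    have h1 : matTPlus N c 1 0 * G = G * matTPlus N c (-1) 0 -
        C (hIn (DYHat N c)) • (Y * G - G * Y') := by
      rw [hY, hY', sub_mul, mul_sub, hcent, one_mul, mul_one, smul_mul_assoc, smul_sub]
      abel
    rw [matBPlus, ← hG, h1, sub_mul, mul_assoc G, hinv, mul_one, smul_mul_assoc]
  have hx : coeff r (matBPlus N c M i j) = coeff r (cstSeries N c (matG N M i j)) -
      hIn (DYHat N c) * coeff r (((Y * G - G * Y') * Ring.inverse (matTPlus N c (-1) 0)) i j) := by
    rw [h, Matrix.sub_apply, Matrix.smul_apply, smul_eq_mul, map_sub, coeff_C_mul, hG,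
      Matrix.map_apply]
  rw [hx]
  refine sub_mem ?_ ?_
  · rw [cstSeries, RingHom.comp_apply, coeff_C]
    split_ifs
    · exact Subalgebra.algebraMap_mem _ _
    · exact zero_mem _
  · exact mul_mem (Subalgebra.algebraMap_mem _ _) (Algebra.subset_adjoin ⟨i, j, r, hx⟩)

/-- For G = ±I the product is ± B⁺(u) shifted to u + αh, and the closure is stable under this shift.
-/
theorem matTPlus_mul_inverse_mem (hG : matG N M = 1 ∨ matG N M = -1) (α : ℂ) (i j : Fin N) :
    (matTPlus N c 1 α * Ring.inverse (matTPlus N c (-1) (-α))) i j ∈ bSeries N c M := by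
  have h1 : ∀ i j, (matTPlus N c 1 0 * Ring.inverse (matTPlus N c (-1) 0)) i j ∈ bSeries N c M := by
    intro i j
    have hB : matBPlus N c M i j ∈ bSeries N c M := fun r => bPlusPre_le (coeff_matBPlus_mem i j r)
    rcases hG with hG | hG
    · rwa [matBPlus, hG, Matrix.map_one _ (map_zero _) (map_one _), mul_one] at hB
    · have : (-1 : Matrix (Fin N) (Fin N) ℂ).map (cstSeries N c) = -1 := by
        rw [Matrix.map_neg _ (map_neg _), Matrix.map_one _ (map_zero _) (map_one _)]
      rw [matBPlus, hG, this, mul_neg, mul_one, neg_mul, Matrix.neg_apply] at hB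
      exact neg_mem_iff.1 hB
  obtain ⟨Φ, hΦ⟩ : ∃ Φ, Φ = evalPt (isHAdic_DYHat N c) 1 α := ⟨_, rfl⟩
  have hm : ∀ ε, Φ.mapMatrix (matTPlus N c ε 0) = matTPlus N c ε (ε * α) := by
    intro ε
    ext1 i j
    rw [RingHom.mapMatrix_apply, Matrix.map_apply, matTPlus_eq, matTPlus_eq, hΦ, evalPt_evalPt]
  have hinv : Ring.inverse (matTPlus N c (-1) (-α)) =
      Φ.mapMatrix (Ring.inverse (matTPlus N c (-1) 0)) := by
    have e1 := congrArg Φ.mapMatrix (Ring.mul_inverse_cancel _ (isUnit_matTPlus N c (-1) 0))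
    have e2 := Ring.inverse_mul_cancel _ (isUnit_matTPlus N c (-1) (-α))
    rw [map_mul, map_one, hm, neg_one_mul] at e1
    rw [← mul_one (Ring.inverse (matTPlus N c (-1) (-α))), ← e1, ← mul_assoc, e2, one_mul]
  have e := hm 1
  rw [one_mul] at e
  rw [hinv, ← e, ← map_mul, RingHom.mapMatrix_apply, Matrix.map_apply, hΦ]
  exact evalPt_mem_bSeries 1 α (h1 i j)

end Closure

/-! ### The coefficients of the trace series belong to the closure of `B⁺` -/

section Membership

variable {N n : ℕ} {c : ℂ} {M : ℕ}

variable (N n c) in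
/-- The operator `(2 u + γ h) - h P` with the flip `P` of the factors `k` and `j`. -/
def kOp (k : Fin n) (γ : ℂ) (j : Fin n) :
    Matrix (Fin n → Fin N) (Fin n → Fin N) (PowerSeries (DYHat N c)) :=
  point (DYHat N c) 2 γ • 1 - C (hIn (DYHat N c)) • permOp (Equiv.swap k j)

/-- The arguments u + ekh and -(u + ejh) differ by 2u + e(j + k)h. Multiplying their RTT relation by
T⁺(-u - ejh)⁻¹ from both sides moves the inverse across. -/
theorem kOp_exchange (e : ℤ) {j k : Fin n} (hjk : k ≠ j) :
    atFactor j (seqInv N c e j) * kOp N n c k (e * (j + k)) j * atFactor k (seqT N c e k) =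
      atFactor k (seqT N c e k) * kOp N n c k (e * (j + k)) j * atFactor j (seqInv N c e j) := by
  have h := tensor_rel (S := PowerSeries (DYHat N c)) (x := point (DYHat N c) 2 (e * (j + k)))
    (y := C (hIn (DYHat N c))) (point_commute _ _) (commute_C hIn_commute)
    (M := seqT N c e k) (M' := seqTNeg N c e j) (fun a b i l => by
      have := matTPlus_rel (N := N) (c := c) 1 (e * (k : ℕ)) (-1) (-e * (j : ℕ)) a b i l
      rw [show (1 : ℂ) - -1 = 2 by norm_num,
        show (e : ℂ) * (k : ℕ) - -e * (j : ℕ) = e * (j + k) by ring] at this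
      exact this) hjk
  rw [← kOp] at h
  have a1 : atFactor j (seqTNeg N c e j) * atFactor j (seqInv N c e j) = 1 := by
    rw [← atFactor_mul, seqTNeg_mul_seqInv, atFactor_one]
  have a2 : atFactor j (seqInv N c e j) * atFactor j (seqTNeg N c e j) = 1 := by
    rw [← atFactor_mul, seqInv_mul_seqTNeg, atFactor_one]
  generalize atFactor j (seqInv N c e j) = G at *
  generalize atFactor j (seqTNeg N c e j) = T at *
  generalize atFactor k (seqT N c e k) = F at *
  generalize kOp N n c k (e * (j + k)) j = K at *
  calc G * K * F = G * (K * (F * T)) * G := by simp only [mul_assoc]; rw [a1, mul_one]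
    _ = (G * T) * F * K * G := by rw [h]; simp only [mul_assoc]
    _ = F * K * G := by rw [a2, one_mul]

theorem commute_kOp {i j k : Fin n} (hi : i ≠ k) (hj : i ≠ j) (γ : ℂ)
    (F : Matrix (Fin N) (Fin N) (PowerSeries (DYHat N c))) :
    Commute (atFactor i F) (kOp N n c k γ j) := by
  have hs : ∀ z : PowerSeries (DYHat N c), (∀ s, Commute z s) →
      ∀ Y, Commute (atFactor i F) Y → Commute (atFactor i F) (z • Y) := by
    intro z hz Y hY
    rw [commute_iff_eq, mul_central_smul hz, smul_mul_assoc, hY.eq]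
  exact (hs _ (point_commute _ _) _ (Commute.one_right _)).sub_right
    (hs _ (commute_C hIn_commute) _ (commute_atFactor_swap hi hj _))

theorem exchange_interleaved {E α : Type} [Ring E] (G K : α → E) (F : E) (l : List α)
    (hl : l.Nodup) (h : ∀ j ∈ l, G j * K j * F = F * K j * G j)
    (hGK : ∀ i ∈ l, ∀ j ∈ l, i ≠ j → Commute (G i) (K j)) :
    (l.map G).prod * (l.map K).prod * F = F * (l.map K).prod * (l.map G).prod := by
  induction l with
  | nil => simp
  | cons j l ih =>
    rw [List.nodup_cons] at hl
    have ih := ih hl.2 (fun i hi => h i (by simp [hi]))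
      (fun i hi i' hi' => hGK i (by simp [hi]) i' (by simp [hi']))
    have c1 : Commute (l.map G).prod (K j) := by
      refine Commute.list_prod_left _ _ fun x hx => ?_
      obtain ⟨i, hi, rfl⟩ := List.mem_map.1 hx
      exact hGK i (by simp [hi]) j (by simp) fun hij => hl.1 (hij ▸ hi)
    have c2 : Commute (G j) (l.map K).prod := by
      refine Commute.list_prod_right _ _ fun x hx => ?_
      obtain ⟨i, hi, rfl⟩ := List.mem_map.1 hx
      exact hGK j (by simp) i (by simp [hi]) fun hij => hl.1 (hij ▸ hi)
    simp only [List.map_cons, List.prod_cons]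
    calc _ = G j * ((l.map G).prod * K j) * (l.map K).prod * F := by simp only [mul_assoc]
      _ = G j * K j * ((l.map G).prod * (l.map K).prod * F) := by
        rw [c1.eq]; simp only [mul_assoc]
      _ = (G j * K j * F) * (l.map K).prod * (l.map G).prod := by rw [ih]; simp only [mul_assoc]
      _ = F * K j * (G j * (l.map K).prod) * (l.map G).prod := by
        rw [h j (by simp)]; simp only [mul_assoc]
      _ = _ := by rw [c2.eq]; simp only [mul_assoc]

variable (N n c) in
/-- The operators `kOp` indexed by natural numbers. -/
def kNat (e : ℤ) (k : Fin n) (j : ℕ) :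
    Matrix (Fin n → Fin N) (Fin n → Fin N) (PowerSeries (DYHat N c)) :=
  if h : j < n then kOp N n c k (e * (j + k)) ⟨j, h⟩ else 1

theorem kNat_exchange (e : ℤ) (k : Fin n) :
    ordProd n (seqInv N c e) k * ((List.range k).map (kNat N n c e k)).prod *
        atFactor k (seqT N c e k) =
      atFactor k (seqT N c e k) * ((List.range k).map (kNat N n c e k)).prod *
        ordProd n (seqInv N c e) k := by
  refine exchange_interleaved _ _ _ _ List.nodup_range (fun j hj => ?_) fun i hi j hj hij => ?_
  · have hjk := List.mem_range.1 hj
    have hjn : j < n := hjk.trans k.2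
    rw [atNat_of_lt _ hjn, kNat, dif_pos hjn]
    exact kOp_exchange e (j := ⟨j, hjn⟩) fun h => by
      rw [h] at hjk
      exact absurd hjk (by simp)
  · have hik := List.mem_range.1 hi
    have hin : i < n := hik.trans k.2
    have hjn : j < n := (List.mem_range.1 hj).trans k.2
    rw [atNat_of_lt _ hin, kNat, dif_pos hjn]
    refine commute_kOp (fun h => ?_) (fun h => hij (Fin.mk.inj h)) _ _
    rw [← h] at hik
    exact absurd hik (by simp)

/-- Absorption of the operators `kNat`. -/
theorem mul_kNat_prod (e : ℤ) (k : Fin n)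
    {Θ : Matrix (Fin n → Fin N) (Fin n → Fin N) (PowerSeries (DYHat N c))}
    (hΘ : SignAbsorbs e {i | (i : ℕ) < k + 1} Θ) (m : ℕ) (hm : m ≤ k) :
    Θ * ((List.range m).map (kNat N n c e k)).prod =
      ((List.range m).map fun j : ℕ => point (DYHat N c) 2 (e * (j + (k : ℕ)) - e)).prod • Θ := by
  induction m with
  | zero => simp
  | succ m ih =>
    have hmn : m < n := by omega
    have hmk : (⟨m, hmn⟩ : Fin n) ≠ k := fun h => by
      have := congrArg Fin.val h
      simp at this
      omega
    have h1 := hΘ k (Nat.lt_succ_self _) ⟨m, hmn⟩ (show m < k + 1 by omega) hmk.symm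
    -- The transposition acts on Θ by e, so hP contributes the summand -eh to the scalar.
    have h2 : Θ * kNat N n c e k m = point (DYHat N c) 2 (e * (m + (k : ℕ)) - e) • Θ := by
      rw [kNat, dif_pos hmn, kOp, mul_sub, mul_central_smul (point_commute _ _),
        mul_central_smul (commute_C hIn_commute), mul_one, h1,
        ← Int.cast_smul_eq_zsmul (PowerSeries (DYHat N c)) e Θ, smul_smul, ← sub_smul]
      congr 1
      rw [point, point, map_sub, sub_mul, map_sub, map_intCast (cst (DYHat N c)) e, map_mul _ (e : DYHat N c),
        map_intCast, (Int.cast_commute e (C (hIn (DYHat N c)))).eq]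
      abel
    rw [List.prod_range_succ, List.prod_range_succ, ← mul_assoc, ih (by omega), smul_mul_assoc, h2,
      smul_smul]

theorem kNat_mem (e : ℤ) (k : Fin n) (j : ℕ) :
    kNat N n c e k j ∈ (bSeries N c M).matrix := by
  rw [kNat]
  split_ifs
  · intro I J
    change kOp N n c k _ _ I J ∈ bSeries N c M
    rw [kOp, Matrix.sub_apply, Matrix.smul_apply, Matrix.smul_apply, Matrix.one_apply, permOp_apply]
    refine sub_mem ?_ ?_
    · split_ifs
      · simpa using point_mem_bSeries 2 _
      · simp [zero_mem]
    · split_ifs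
      · simpa using C_mem_bSeries hIn_mem
      · simp [zero_mem]
  · exact one_mem _

theorem mem_of_prod_point_smul (l : List ℂ) {f : PowerSeries (DYHat N c)}
    (h : (l.map (point (DYHat N c) 2)).prod * f ∈ bSeries N c M) : f ∈ bSeries N c M := by
  induction l with
  | nil => simpa using h
  | cons γ l ih =>
    rw [List.map_cons, List.prod_cons, mul_assoc] at h
    exact ih (mem_bSeries_of_point_mul h)

/-- The factors T⁺(u + ekh) and T⁺(-u - ekh)⁻¹ of the new step are separated by the earlier
inverses. Bringing them together by `kNat_exchange` produces B⁺(u + ekh) up to a sign, at the price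
of operators which Θ and the product of the T⁺ turn into scalars. -/
theorem mem_bSeries_of_absorbs (hG : matG N M = 1 ∨ matG N M = -1) {e : ℤ} (he : e * e = 1)
    {Θ : Matrix (Fin n → Fin N) (Fin n → Fin N) (PowerSeries (DYHat N c))}
    (hΘ : SignAbsorbs e Set.univ Θ) (hΘm : Θ ∈ (bSeries N c M).matrix) (k : ℕ) (hk : k ≤ n) :
    Θ * ordProd n (seqT N c e) k * ordProd n (seqInv N c e) k ∈ (bSeries N c M).matrix := by
  induction k with
  | zero => rwa [ordProd_zero, ordProd_zero, mul_one, mul_one]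
  | succ k ih =>
    have hkn : k < n := hk
    have ih := ih hkn.le
    obtain ⟨k', hk'⟩ : ∃ k' : Fin n, k' = ⟨k, hkn⟩ := ⟨_, rfl⟩
    have hkk : (k' : ℕ) = k := by rw [hk']
    have hx := kNat_exchange (N := N) (c := c) e k'
    have ha := mul_kNat_prod e k' (Θ := Θ * ordProd n (seqT N c e) (k + 1))
      (by rw [hkk]; exact absorbs_ordProd_seqT N c n he hΘ hk) k hkk.ge
    rw [hkk] at hx ha
    have hF : atNat n (seqT N c e) k = atFactor k' (seqT N c e k) := by
      rw [atNat_of_lt _ hkn, hk']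
    have hI : atNat n (seqInv N c e) k = atFactor k' (seqInv N c e k) := by
      rw [atNat_of_lt _ hkn, hk']
    -- The scalars are created by absorption behind Θ T⁺₁ ⋯ T⁺_{k+1}; read from the other side, the
    -- same operators follow the product of the previous step, and their entries lie in `bSeries`.
    have key : ((List.range k).map fun j : ℕ => point (DYHat N c) 2 (e * (j + (k : ℕ)) - e)).prod •
        (Θ * ordProd n (seqT N c e) (k + 1) * ordProd n (seqInv N c e) (k + 1)) =
        Θ * ordProd n (seqT N c e) k * ordProd n (seqInv N c e) k *
          ((List.range k).map (kNat N n c e k')).prod *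
          atFactor k' (seqT N c e k * seqInv N c e k) := by
      rw [← smul_mul_assoc, ← ha, ordProd_succ, ordProd_succ, hF, hI, atFactor_mul]
      calc _ = Θ * ordProd n (seqT N c e) k * (atFactor k' (seqT N c e k) *
            ((List.range k).map (kNat N n c e k')).prod * ordProd n (seqInv N c e) k) *
            atFactor k' (seqInv N c e k) := by simp only [mul_assoc]
        _ = _ := by rw [← hx]; simp only [mul_assoc]
    have hmem : Θ * ordProd n (seqT N c e) k * ordProd n (seqInv N c e) k *
          ((List.range k).map (kNat N n c e k')).prod *
          atFactor k' (seqT N c e k * seqInv N c e k) ∈ (bSeries N c M).matrix := by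
      refine mul_mem (mul_mem ih (list_prod_mem fun x hx => ?_)) fun I J => ?_
      · obtain ⟨j, _, rfl⟩ := List.mem_map.1 hx
        exact kNat_mem _ _ _
      · rw [atFactor_apply]
        split_ifs
        · have := matTPlus_mul_inverse_mem (N := N) (c := c) hG (e * (k : ℕ)) (I k') (J k')
          rw [← neg_mul] at this
          exact this
        · exact zero_mem _
    rw [← key] at hmem
    intro I J
    have := hmem I J
    rw [Matrix.smul_apply, smul_eq_mul] at this
    -- The scalar factors 2u + γh are divided out one at a time.
    refine mem_of_prod_point_smul ((List.range k).map fun j : ℕ => (e * (j + (k : ℕ)) - e : ℂ)) ?_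
    rw [List.map_map]
    exact this

theorem traceSeries_mem (hG : matG N M = 1 ∨ matG N M = -1) {e : ℤ} (he : e * e = 1)
    {χ : Equiv.Perm (Fin n) →* ℤˣ} (hχ : ∀ i j, i ≠ j → (χ (Equiv.swap i j) : ℤ) = e) :
    traceSeries N c n e χ ∈ bSeries N c M := by
  have hQ := isSymm_projector_map N _ (cstSeries_commute N c) hχ
  have h := mem_bSeries_of_absorbs hG he hQ.signAbsorbs
    (fun I J => C_mem_bSeries (cst_mem _)) n le_rfl
  rw [mul_assoc] at h
  exact sum_mem fun I _ => h I I

theorem smul_vac_mem_wModule {x : DYHat N c} (hx : x ∈ bClosure N c M) :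
    x • vac N c ∈ wModule N c M := by
  intro n
  obtain ⟨b, hb, y, rfl⟩ := hx n
  -- The unsaturated algebra is enough: no division by h took place.
  have hb' : b ∈ bPlus N c M := ⟨0, by rwa [pow_zero, one_smul]⟩
  refine ⟨b • vac N c, ?_, y • vac N c, by rw [add_smul, smul_assoc]⟩
  exact Submodule.smul_mem _ (⟨b, hb'⟩ : bPlus N c M) (Submodule.mem_span_singleton_self _)

end Membership

/-! ### Invariance and membership combined -/

section Main

variable {N n : ℕ} {c : ℂ} {M : ℕ}

theorem coeff_traceSeries_invariant (hN : N ≠ 0) (hc : c = -N / 2) {e : ℤ} (he : e * e = 1)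
    {χ : Equiv.Perm (Fin n) →* ℤˣ} (hχ : ∀ i j, i ≠ j → (χ (Equiv.swap i j) : ℤ) = e)
    (a b : Fin N) (k l : ℕ) :
    coeff k ((matT N c (invSub (-(hIn (DYHat N c) * cst (DYHat N c) c))) *
        Ring.inverse (matT N c (-X))) a b) • coeff l (traceSeries N c n e χ) • vac N c =
      coeff k ((1 : Matrix (Fin N) (Fin N) (PowerSeries (DYHat N c))) a b) •
        coeff l (traceSeries N c n e χ) • vac N c := by
  have h := trace_invariant hN hc he hχ a b k l
  rw [tUp, tNegVInv, ← Matrix.map_mul, Matrix.map_apply, map_sub, map_sub, coeff_mul_C, coeff_map,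
    coeff_C_mul, sub_smul, sub_eq_zero, mul_smul] at h
  rw [h, Matrix.one_apply]
  split_ifs with hab
  · rw [coeff_C, coeff_one]
    split_ifs
    · rw [one_smul]
    · rw [map_zero, zero_smul, zero_smul]
  · simp

/-- For G = ±I the sign of G occurs on both sides of B(v)w = Gw and drops out, leaving the statement
about T(v + hc) T(-v)⁻¹. -/
theorem coeff_traceSeries_mem_invariants (hN : N ≠ 0) (hc : c = -N / 2)
    (hG : matG N M = 1 ∨ matG N M = -1) {e : ℤ} (he : e * e = 1)
    {χ : Equiv.Perm (Fin n) →* ℤˣ} (hχ : ∀ i j, i ≠ j → (χ (Equiv.swap i j) : ℤ) = e) (l : ℕ) :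
    coeff l (traceSeries N c n e χ) • vac N c ∈ invariants N c M := by
  refine ⟨smul_vac_mem_wModule (traceSeries_mem hG he hχ l), fun a b k => ?_⟩
  have h := coeff_traceSeries_invariant hN hc he hχ a b k l
  have h1 : cstSeries N c ((1 : Matrix (Fin N) (Fin N) ℂ) a b) =
      (1 : Matrix (Fin N) (Fin N) (PowerSeries (DYHat N c))) a b := by
    rw [Matrix.one_apply, Matrix.one_apply]
    split_ifs
    · exact map_one _
    · exact map_zero _
  rcases hG with hG | hG
  · rw [matB, hG, Matrix.map_one _ (map_zero _) (map_one _), mul_one, h, h1]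
  · have : (-1 : Matrix (Fin N) (Fin N) ℂ).map (cstSeries N c) = -1 := by
      rw [Matrix.map_neg _ (map_neg _), Matrix.map_one _ (map_zero _) (map_one _)]
    rw [matB, hG, this, mul_neg, mul_one, neg_mul, Matrix.neg_apply, Matrix.neg_apply, map_neg,
      map_neg, map_neg, neg_smul, neg_smul, h, h1]

end Main

end RTT

end

theorem mainTheorem10 (N n M : ℕ) (hN : 2 ≤ N) (hn : 1 ≤ n) (hM : M ≤ N)
    (hG : RTT.matG N M = 1 ∨ RTT.matG N M = -1) :
    (∀ k : ℕ, PowerSeries.coeff k (RTT.rowSeries N (-(N : ℂ) / 2) n) • RTT.vac N (-(N : ℂ) / 2) ∈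
      RTT.invariants N (-(N : ℂ) / 2) M) ∧
    (∀ k : ℕ, PowerSeries.coeff k (RTT.colSeries N (-(N : ℂ) / 2) n) • RTT.vac N (-(N : ℂ) / 2) ∈
      RTT.invariants N (-(N : ℂ) / 2) M) := by
  refine ⟨fun k => ?_, fun k => ?_⟩
  · rw [RTT.rowSeries_eq]
    exact RTT.coeff_traceSeries_mem_invariants (by omega) rfl hG (by norm_num)
      (fun i j _ => by simp) k
  · rw [RTT.colSeries_eq]
    exact RTT.coeff_traceSeries_mem_invariants (by omega) rfl hG (by norm_num)
      (fun i j hij => by simp [Equiv.Perm.sign_swap hij]) k
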